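/- Let $\Lambda\in\mathbb R$ and $M,Q,J\ge 0$. Put $a:=J/M$ if $M\neq0$ and $a:=J$ if $M=0$, $\lambda:=\Lambda/3$, $\chi:=1+\lambda a^2$, and $$\Sigma:=r^2+a^2\cos^2\theta,\quad \Delta_r:=(1-\lambda r^2)(r^2+a^2)-2Mr+Q^2,\quad \Delta_\theta:=1+\lambda a^2\cos^2\theta .$$ Assume $\chi>0$. The Kerr–Newman–(anti) de Sitter metric is given, in Boyer–Lindquist coordinates $(t,r,\theta,\phi)$ with $t,r\in\mathbb R$, $0<\theta<\pi$ and $\phi\in\mathbb R/2\pi\mathbb Z$, where $\Sigma\Delta_r\Delta_\theta\sin\theta\neq0$, by $$\mathrm ds^2=-\frac{\Delta_r}{\chi^2\Sigma}(\mathrm dt-a\sin^2\theta\,\mathrm d\phi)^2+\frac{\Delta_\theta\sin^2\theta}{\chi^2\Sigma}\bigl(a\,\mathrm dt-(r^2+a^2)\,\mathrm d\phi\bigr)^2+\Sigma\Bigl(\frac{\mathrm dr^2}{\Delta_r}+\frac{\mathrm d\theta^2}{\Delta_\theta}\Bigr).$$ Let $\mathbf A=\frac{Qr}{\chi\Sigma}(\mathrm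 dt-a\sin^2\theta\,\mathrm d\phi)$. Let $\mathcal M=\mathbb R^2\times\mathbb S^2$ with its standard smooth structure and with points $(\bar t,r,n)$, $n=(\sin\theta\cos\bar\phi,\sin\theta\sin\bar\phi,\cos\theta)$, and let $\mathcal U=\mathcal M\setminus\{\Sigma=0\}$. Functions $T,\Phi$ with $T'=\chi(r^2+a^2)/\Delta_r$ and $\Phi'=a\chi/\Delta_r$ on $\{\Delta_r\ne0\}$ exist; for each such choice regard the Boyer–Lindquist coordinates as coordinates on a part of $\mathcal U$ through the passage to Kerr coordinates $$\bar t=t+T(r)-r,\qquad \bar\phi=\phi+\Phi(r).$$ There are a tensor field $\mathbf g$, a $2$-form $\mathbf F$ and a $1$-form $\bar{\mathbf A}$ on $\mathcal U$, all smooth and not depending on the choice of $T,\Phi$, with the following properties. 1. (Extension.) $\mathbf g$ is a smooth Lorentzian metric on $\mathcal U$, of signature $(-,+,+,+)$, and equals $\mathrm ds^2$ in Boyer–Lindquist coordinates. 2. (Maximality.) (a) If $V\subseteq\mathcal M$ is open and contains the domain of the Boyer–Lindquist coordinates, and $\mathbf h$ is a smooth Lorentzian metric on $V$ that equals $\mathrm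 ds^2$ in these coordinates, then $V\subseteq\mathcal U$ and $\mathbf h=\mathbf g|_V$. (b) If $(M,Q)\ne(0,0)$, then $\mathbf g$ does not extend through any point $p$ of $\{\Sigma=0\}$ in any other coordinates either: there are no open neighbourhood $W$ of $p$ in $\mathcal M$, open set $O\subseteq\mathbb R^4$, smooth Lorentzian metric $\mathbf h$ on $O$ and map $Y:W\to O$, continuous at $p$ and smooth on $W\cap\mathcal U$, such that $Y^*\mathbf h=\mathbf g$ on $W\cap\mathcal U$. 3. (Field.) In Boyer–Lindquist coordinates $\mathbf F=\mathrm d\mathbf A$ and $\bar{\mathbf A}=\mathbf A+\frac{Qr}{\Delta_r}\mathrm dr$; and $\mathbf F=\mathrm d\bar{\mathbf A}$ on all of $\mathcal U$. (The added term is closed.) 4. (Maxwell equations.) On all of $\mathcal U$, in all local coordinates, $F_{\mu\nu,\lambda}+F_{\nu\lambda,\mu}+F_{\lambda\mu,\nu}=0$ and $\nabla_\mu F^{\mu\nu}=0$. 5. (Electro-vacuum Einstein–Maxwell equation.) On all of $\mathcal U$, in all local coordinates, $$R_{\mu\nu}-\tfrac12Rg_{\mu\nu}+\Lambda g_{\mu\nu}=8\pi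 T_{\mu\nu},\qquad T_{\mu\nu}=\frac1{4\pi}\Bigl(g^{\alpha\beta}F_{\alpha\mu}F_{\beta\nu}-\tfrac14g_{\mu\nu}F_{\alpha\beta}F^{\alpha\beta}\Bigr).$$ -/

import Mathlib

open scoped Manifold ContDiff

noncomputable section

namespace KNdS

/-! ### Tensor fields on a manifold and their components in local coordinates -/

/-- The coordinate space `ℝ⁴`; coordinates are numbered `0, 1, 2, 3`. -/
abbrev Coord : Type := Fin 4 → ℝ

section Tensors

variable {E : Type*} [NormedAddCommGroup E] [NormedSpace ℝ E] {H : Type*} [TopologicalSpace H]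
  (I : ModelWithCorners ℝ E H) {X : Type*} [TopologicalSpace X] [ChartedSpace H X]

/-- A (not necessarily continuous) covector field. -/
abbrev CovectorField (X : Type*) [TopologicalSpace X] [ChartedSpace H X] : Type _ :=
  ∀ p : X, TangentSpace I p →ₗ[ℝ] ℝ

/-- A (not necessarily continuous) field of bilinear forms on the tangent spaces. -/
abbrev BilinField (X : Type*) [TopologicalSpace X] [ChartedSpace H X] : Type _ :=
  ∀ p : X, TangentSpace I p →ₗ[ℝ] TangentSpace I p →ₗ[ℝ] ℝ

/-- `ψ` gives smooth local coordinates on the part `ψ(Ω)` of `V`: it is a smooth map from the open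
set `Ω ⊆ ℝ⁴` to `V` with bijective differential at every point, so that it restricts near each
point of `Ω` to the inverse of a smooth chart. (Global injectivity is not asked for, so that an
angle may run through all of `ℝ`.) -/
def IsCoordinates (V : Set X) (Ω : Set Coord) (ψ : Coord → X) : Prop :=
  IsOpen Ω ∧ Set.MapsTo ψ Ω V ∧ ContMDiffOn 𝓘(ℝ, Coord) I ∞ ψ Ω ∧
    ∀ x ∈ Ω, Function.Bijective (mfderiv 𝓘(ℝ, Coord) I ψ x)

/-- The coordinate vector `∂_μ` at `ψ x`. -/
def coordVec (ψ : Coord → X) (x : Coord) (μ : Fin 4) : TangentSpace I (ψ x) :=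
  mfderiv 𝓘(ℝ, Coord) I ψ x (Pi.single μ (1 : ℝ) : Coord)

variable {I}

/-- The components `A_μ` of a covector field, as functions of the coordinates. -/
def CovectorField.comp (A : CovectorField I X) (ψ : Coord → X) (x : Coord) : Fin 4 → ℝ :=
  fun μ => A (ψ x) (coordVec I ψ x μ)

/-- The components `g_{μν}` of a field of bilinear forms, as functions of the coordinates. -/
def BilinField.comp (g : BilinField I X) (ψ : Coord → X) (x : Coord) :
    Matrix (Fin 4) (Fin 4) ℝ :=
  Matrix.of fun μ ν => g (ψ x) (coordVec I ψ x μ) (coordVec I ψ x ν)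

/-- Smoothness on `V`: the components in all local coordinates are smooth. -/
def CovectorField.SmoothOn (A : CovectorField I X) (V : Set X) : Prop :=
  ∀ (Ω : Set Coord) (ψ : Coord → X), IsCoordinates I V Ω ψ →
    ∀ μ, ContDiffOn ℝ ∞ (fun x => A.comp ψ x μ) Ω

/-- Smoothness on `V`: the components in all local coordinates are smooth. -/
def BilinField.SmoothOn (g : BilinField I X) (V : Set X) : Prop :=
  ∀ (Ω : Set Coord) (ψ : Coord → X), IsCoordinates I V Ω ψ →
    ∀ μ ν, ContDiffOn ℝ ∞ (fun x => g.comp ψ x μ ν) Ω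

/-- `g` has signature `(-,+,+,+)` at each point of `V`: there is a basis of the tangent space whose
Gram matrix is `diag(-1,1,1,1)` (in particular `g` is symmetric and nondegenerate there). -/
def BilinField.LorentzianOn (g : BilinField I X) (V : Set X) : Prop :=
  ∀ p ∈ V, ∃ b : Module.Basis (Fin 4) ℝ (TangentSpace I p),
    ∀ i j, g p (b i) (b j) = Matrix.diagonal (![-1, 1, 1, 1] : Fin 4 → ℝ) i j

/-- `g` is a smooth Lorentzian metric on `V`. -/
def BilinField.IsLorentzMetricOn (g : BilinField I X) (V : Set X) : Prop :=
  g.SmoothOn V ∧ g.LorentzianOn V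

end Tensors

/-! ### Coordinate expressions -/

/-- The partial derivative `∂_μ f` at `x`. -/
def pd (μ : Fin 4) (f : Coord → ℝ) (x : Coord) : ℝ := fderiv ℝ f x (Pi.single μ (1 : ℝ) : Coord)

/-- The components `∂_μ A_ν - ∂_ν A_μ` of `dA`. -/
def extDer (A : Coord → Fin 4 → ℝ) (x : Coord) : Matrix (Fin 4) (Fin 4) ℝ :=
  Matrix.of fun μ ν => pd μ (fun y => A y ν) x - pd ν (fun y => A y μ) x

/-- The Christoffel symbols `Γ^l_{mn}` of the metric with components `G`. -/
def christoffel (G : Coord → Matrix (Fin 4) (Fin 4) ℝ) (l m n : Fin 4) (x : Coord) : ℝ :=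
  (1 / 2) * ∑ s, (G x)⁻¹ l s *
    (pd m (fun y => G y s n) x + pd n (fun y => G y s m) x - pd s (fun y => G y m n) x)

/-- The Ricci tensor
`R_{mn} = ∂_l Γ^l_{mn} - ∂_n Γ^l_{ml} + Γ^l_{ls} Γ^s_{mn} - Γ^l_{ns} Γ^s_{ml}`. -/
def ricci (G : Coord → Matrix (Fin 4) (Fin 4) ℝ) (x : Coord) : Matrix (Fin 4) (Fin 4) ℝ :=
  Matrix.of fun m n =>
    ∑ l, (pd l (christoffel G l m n) x - pd n (christoffel G l m l) x) +
    ∑ l, ∑ s, (christoffel G l l s x * christoffel G s m n x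
      - christoffel G l n s x * christoffel G s m l x)

/-- The Ricci scalar `g^{mn} R_{mn}`. -/
def scalarCurv (G : Coord → Matrix (Fin 4) (Fin 4) ℝ) (x : Coord) : ℝ :=
  ∑ m, ∑ n, (G x)⁻¹ m n * ricci G x m n

/-- The Einstein tensor `R_{mn} - ½ R g_{mn}`. -/
def einstein (G : Coord → Matrix (Fin 4) (Fin 4) ℝ) (x : Coord) : Matrix (Fin 4) (Fin 4) ℝ :=
  ricci G x - (scalarCurv G x / 2) • G x

/-- Both indices raised: `F^{mn} = g^{mα} g^{nβ} F_{αβ}`. -/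
def raise (G F : Coord → Matrix (Fin 4) (Fin 4) ℝ) (x : Coord) : Matrix (Fin 4) (Fin 4) ℝ :=
  Matrix.of fun m n => ∑ α, ∑ β, (G x)⁻¹ m α * (G x)⁻¹ n β * F x α β

/-- The covariant divergence
`∇_m F^{mn} = ∂_m F^{mn} + Γ^m_{ms} F^{sn} + Γ^n_{ms} F^{ms}`. -/
def divergence (G F : Coord → Matrix (Fin 4) (Fin 4) ℝ) (n : Fin 4) (x : Coord) : ℝ :=
  ∑ m, pd m (fun y => raise G F y m n) x +
  ∑ m, ∑ s, (christoffel G m m s x * raise G F x s n + christoffel G n m s x * raise G F x m s)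

/-- The electromagnetic stress-energy tensor, in units with `G = c = 4πε₀ = 1` (so `μ₀ = 4π`):
`T_{mn} = (1/μ₀) (g^{αβ} F_{αm} F_{βn} - ¼ g_{mn} F_{αβ} F^{αβ})`. -/
def stressEnergy (G F : Coord → Matrix (Fin 4) (Fin 4) ℝ) (x : Coord) :
    Matrix (Fin 4) (Fin 4) ℝ :=
  Matrix.of fun m n => (1 / (4 * Real.pi)) *
    (∑ α, ∑ β, (G x)⁻¹ α β * F x α m * F x β n
      - (1 / 4) * G x m n * ∑ α, ∑ β, F x α β * raise G F x α β)

/-! ### The field equations -/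

section Equations

variable {E : Type*} [NormedAddCommGroup E] [NormedSpace ℝ E] {H : Type*} [TopologicalSpace H]
  {I : ModelWithCorners ℝ E H} {X : Type*} [TopologicalSpace X] [ChartedSpace H X]

/-- `F` is a smooth `2`-form on `V`. -/
def IsTwoFormOn (F : BilinField I X) (V : Set X) : Prop :=
  F.SmoothOn V ∧ ∀ p ∈ V, ∀ v w : TangentSpace I p, F p v w = - F p w v

/-- `F = dA` on `V`. -/
def IsExtDerOn (F : BilinField I X) (A : CovectorField I X) (V : Set X) : Prop :=
  ∀ (Ω : Set Coord) (ψ : Coord → X), IsCoordinates I V Ω ψ →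
    ∀ x ∈ Ω, F.comp ψ x = extDer (A.comp ψ) x

/-- The vacuum Maxwell equations on `V`: in all local coordinates,
`F_{mn,l} + F_{nl,m} + F_{lm,n} = 0` and `∇_m F^{mn} = 0`. -/
def VacuumMaxwellOn (g F : BilinField I X) (V : Set X) : Prop :=
  ∀ (Ω : Set Coord) (ψ : Coord → X), IsCoordinates I V Ω ψ → ∀ x ∈ Ω,
    (∀ l m n : Fin 4, pd l (fun y => F.comp ψ y m n) x + pd m (fun y => F.comp ψ y n l) x
      + pd n (fun y => F.comp ψ y l m) x = 0) ∧
    ∀ n : Fin 4, divergence (g.comp ψ) (F.comp ψ) n x = 0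

/-- The electro-vacuum Einstein–Maxwell equation with cosmological constant `Λ` on `V`:
in all local coordinates, `R_{mn} - ½ R g_{mn} + Λ g_{mn} = 8π T_{mn}`. -/
def EinsteinMaxwellOn (Λ : ℝ) (g F : BilinField I X) (V : Set X) : Prop :=
  ∀ (Ω : Set Coord) (ψ : Coord → X), IsCoordinates I V Ω ψ → ∀ x ∈ Ω,
    einstein (g.comp ψ) x + Λ • g.comp ψ x
      = (8 * Real.pi) • stressEnergy (g.comp ψ) (F.comp ψ) x

/-- The metric `g` on `U` extends through the point `p` in some coordinates, related to those of
`X` near `p` only by continuity: there are a neighbourhood `W` of `p`, a map `Y` from `W` to an open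
set `O ⊆ ℝ⁴` that is continuous at `p` and smooth on `W ∩ U`, and a smooth Lorentzian metric `h`
on `O` whose pull-back by `Y` is `g` on `W ∩ U`. -/
def ExtendsThrough (g : BilinField I X) (U : Set X) (p : X) : Prop :=
  ∃ (W : Set X) (O : Set Coord) (Y : X → Coord) (h : BilinField 𝓘(ℝ, Coord) Coord),
    IsOpen W ∧ p ∈ W ∧ IsOpen O ∧ Set.MapsTo Y W O ∧ ContinuousAt Y p ∧
    ContMDiffOn I 𝓘(ℝ, Coord) ∞ Y (W ∩ U) ∧ h.IsLorentzMetricOn O ∧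
    ∀ q ∈ W ∩ U, ∀ v w : TangentSpace I q,
      g q v w = h (Y q) (mfderiv I 𝓘(ℝ, Coord) Y q v) (mfderiv I 𝓘(ℝ, Coord) Y q w)

end Equations

/-! ### The Kerr–Newman–(anti) de Sitter metric -/

/-- The constants: cosmological constant, mass, charge, angular momentum. -/
structure Params where
  Λ : ℝ
  M : ℝ
  Q : ℝ
  J : ℝ

namespace Params

variable (P : Params)

/-- `a = J / M` if `M ≠ 0`, and `a = J` otherwise. -/
def a : ℝ := if P.M = 0 then P.J else P.J / P.M

/-- `λ = Λ / 3`. -/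
def lam : ℝ := P.Λ / 3

/-- `χ = 1 + λ a²`. -/
def chi : ℝ := 1 + P.lam * P.a ^ 2

/-- `Σ = r² + a² cos² θ`, as a function of `r` and `c = cos θ`. -/
def sigma (r c : ℝ) : ℝ := r ^ 2 + P.a ^ 2 * c ^ 2

/-- `Δ_r = (1 - λ r²) (r² + a²) - 2 M r + Q²`. -/
def deltaR (r : ℝ) : ℝ := (1 - P.lam * r ^ 2) * (r ^ 2 + P.a ^ 2) - 2 * P.M * r + P.Q ^ 2

/-- `Δ_θ = 1 + λ a² cos² θ`, as a function of `c = cos θ`. -/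
def deltaTheta (c : ℝ) : ℝ := 1 + P.lam * P.a ^ 2 * c ^ 2

/-- The range of the Boyer–Lindquist coordinates `x = (t, r, θ, φ)`, with `φ` taken in `ℝ` instead
of modulo `2π`: `0 < θ < π` and `Σ Δ_r Δ_θ sin θ ≠ 0`. -/
def blDomain : Set Coord :=
  {x | 0 < x 2 ∧ x 2 < Real.pi ∧
    P.sigma (x 1) (Real.cos (x 2)) * P.deltaR (x 1) * P.deltaTheta (Real.cos (x 2))
      * Real.sin (x 2) ≠ 0}

/-- The covector `dt - a sin² θ dφ`. -/
def omega (x : Coord) : Fin 4 → ℝ := ![1, 0, 0, -(P.a * Real.sin (x 2) ^ 2)]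

/-- The covector `a dt - (r² + a²) dφ`. -/
def omega' (x : Coord) : Fin 4 → ℝ := ![P.a, 0, 0, -((x 1) ^ 2 + P.a ^ 2)]

/-- The metric in Boyer–Lindquist coordinates:
`-Δ_r/(χ²Σ) (dt - a sin²θ dφ)² + Δ_θ sin²θ/(χ²Σ) (a dt - (r²+a²) dφ)² + Σ (dr²/Δ_r + dθ²/Δ_θ)`. -/
def blMetric (x : Coord) : Matrix (Fin 4) (Fin 4) ℝ :=
  let S := P.sigma (x 1) (Real.cos (x 2))
  let Dr := P.deltaR (x 1)
  let Dθ := P.deltaTheta (Real.cos (x 2))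
  (-(Dr / (P.chi ^ 2 * S))) • Matrix.vecMulVec (P.omega x) (P.omega x)
  + (Dθ * Real.sin (x 2) ^ 2 / (P.chi ^ 2 * S)) • Matrix.vecMulVec (P.omega' x) (P.omega' x)
  + Matrix.diagonal ![0, S / Dr, S / Dθ, 0]

/-- The potential `Q r / (χ Σ) (dt - a sin² θ dφ)` in Boyer–Lindquist coordinates. -/
def blPotential (x : Coord) : Fin 4 → ℝ :=
  (P.Q * x 1 / (P.chi * P.sigma (x 1) (Real.cos (x 2)))) • P.omega x

end Params

/-- The manifold `ℝ² × S²`, with points `(t̄, r, n)`, `n = (sin θ cos φ̄, sin θ sin φ̄, cos θ)`. -/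
abbrev Spacetime : Type := ℝ × ℝ × Metric.sphere (0 : EuclideanSpace ℝ (Fin 3)) 1

/-- The standard smooth structure of `ℝ² × S²`. -/
abbrev model := 𝓘(ℝ, ℝ).prod (𝓘(ℝ, ℝ).prod (𝓡 2))

/-- The point of `S²` with spherical coordinates `(θ, φ)`. -/
def spherePoint (θ φ : ℝ) : Metric.sphere (0 : EuclideanSpace ℝ (Fin 3)) 1 :=
  ⟨!₂[Real.sin θ * Real.cos φ, Real.sin θ * Real.sin φ, Real.cos θ], by
    have h : Real.sin θ ^ 2 * Real.cos φ ^ 2 + Real.sin θ ^ 2 * Real.sin φ ^ 2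
        + Real.cos θ ^ 2 = 1 := by
      rw [← mul_add, add_comm (Real.cos φ ^ 2), Real.sin_sq_add_cos_sq, mul_one,
        Real.sin_sq_add_cos_sq]
    simp [EuclideanSpace.norm_eq, Fin.sum_univ_three, mul_pow, h]⟩

namespace Params

variable (P : Params)

/-- `Σ` on `ℝ² × S²`. -/
def sigmaAt (p : Spacetime) : ℝ := P.sigma p.2.1 ((p.2.2 : EuclideanSpace ℝ (Fin 3)) 2)

/-- The open set `U = {Σ ≠ 0}` of `ℝ² × S²`. -/
def regularSet : Set Spacetime := {p | P.sigmaAt p ≠ 0}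

/-- `T` and `Φ` are primitives of `χ (r² + a²) / Δ_r` and of `a χ / Δ_r` on `{Δ_r ≠ 0}` (with a free
constant on each of its connected components). -/
def IsKerrPair (T Φ : ℝ → ℝ) : Prop :=
  ∀ r, P.deltaR r ≠ 0 →
    HasDerivAt T (P.chi * (r ^ 2 + P.a ^ 2) / P.deltaR r) r ∧
    HasDerivAt Φ (P.a * P.chi / P.deltaR r) r

end Params

/-- The change from Boyer–Lindquist coordinates `(t, r, θ, φ)` to Kerr coordinates
`(t̄, r, θ, φ̄) = (t + T(r) - r, r, θ, φ + Φ(r))`, as a map to `ℝ² × S²`. -/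
def kerrMap (T Φ : ℝ → ℝ) (x : Coord) : Spacetime :=
  (x 0 + T (x 1) - x 1, x 1, spherePoint (x 2) (x 3 + Φ (x 1)))

namespace Params

variable (P : Params)

/-- `h` is a smooth Lorentzian metric on the open set `V ⊆ ℝ² × S²` that extends the metric given
in Boyer–Lindquist coordinates, these being regarded as coordinates on `ℝ² × S²` by means of
`kerrMap T Φ`. -/
def IsExtension (T Φ : ℝ → ℝ) (V : Set Spacetime) (h : BilinField model Spacetime) : Prop :=
  IsOpen V ∧ h.IsLorentzMetricOn V ∧
    ∀ x ∈ P.blDomain, kerrMap T Φ x ∈ V ∧ h.comp (kerrMap T Φ) x = P.blMetric x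

end Params

end KNdS

end

/-! Write `v = t̄ + r = t + T(r)`, `c = cos θ`, `P = Δ_θ sin² θ`. In Kerr coordinates the form `β =
a dv - (r² + a²) dφ̄` equals `a dt - (r² + a²) dφ`, while `α = dv - a sin² θ dφ̄` equals `dt - a
sin² θ dφ + (χΣ/Δ_r) dr`. Inserting this into the metric cancels `Σ dr²/Δ_r` and leaves
`-(Δ_r/Σ)(α/χ)² + 2 (α/χ) dr + (Σ/P) dc² + (P/Σ)(β/χ)²`. Nothing is divided by `Δ_r` any more, so
the horizons are regular (`metricField_comp_kerrMap`).

The axis is treated in the ambient space `ℝ² × ℝ³`, where `τ = x dy - y dx = sin² θ dφ̄` is smooth.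
The two terms in `τ²/sin² θ`, one from `β²` and one from the round metric, combine through `Δ_θ (r²
+ a²) - χΣ = a² sin² θ (1 - λ r²)`, which supplies the missing factor `sin² θ`
(`metricForm_eq_coframe`). The condition `χ > 0` makes `Δ_θ` positive. The only singular points left
are those with `Σ = 0`. The potential is `(Q r/(χΣ)) α`, and the field is its exterior derivative.

The field equations are verified by moving frames. `IsFrame` records a coframe with a metric,
torsion-free connection; curvature, Ricci tensor and divergence then become algebra in the frame.
For `α/χ, dr, dc, β/χ` the identity `aα - β = Σ dφ̄` closes the structure equations, and all
coefficients depend on `r` and `c` only. The explicit connection `frameConn` gives `Ric = Λ g` plus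
`Q²/Σ²` times a trace-free form (`frame_ricci`), and that form is the electromagnetic stress
(`frameField_stress`). This holds off the axis; the off-axis points are dense and both sides are
continuous, so it holds everywhere.

Maximality inside `ℝ² × S²`: Boyer–Lindquist points are dense, so an extension agrees with `g` by
continuity; at `Σ = 0` it would be degenerate, because `g(∂_θ, ·) = (Σ/Δ_θ) dθ` tends to zero
(`subset_regularSet_of_extension`).

Maximality in other coordinates: where `a cos θ = 0`, the Kretschmann scalar is at least `4 (2M/r³ -
Q²/r⁴ + λ)²`. Every point of `{Σ = 0}` is a limit of such points with `r ↑ 0`, along which this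
bound tends to infinity unless `M = Q = 0`. A metric pulled back by a map continuous at the point
would have a bounded scalar there (`not_extendsThrough`). -/

namespace KNdS
noncomputable section

/-! ### Partial derivatives -/

/-- Real `4 × 4` matrices. -/
abbrev Mat : Type := Matrix (Fin 4) (Fin 4) ℝ

variable {U : Set Coord} {x : Coord}

theorem diffAt (hU : IsOpen U) (hx : x ∈ U) {f : Coord → ℝ} (hf : ContDiffOn ℝ ∞ f U) :
    DifferentiableAt ℝ f x :=
  (hf.contDiffAt (hU.mem_nhds hx)).differentiableAt (by simp)

theorem pd_add {f g : Coord → ℝ} (hf : DifferentiableAt ℝ f x) (hg : DifferentiableAt ℝ g x)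
    (m : Fin 4) : pd m (fun y => f y + g y) x = pd m f x + pd m g x := by
  simp [pd, fderiv_fun_add hf hg]

theorem pd_sub {f g : Coord → ℝ} (hf : DifferentiableAt ℝ f x) (hg : DifferentiableAt ℝ g x)
    (m : Fin 4) : pd m (fun y => f y - g y) x = pd m f x - pd m g x := by
  simp [pd, fderiv_fun_sub hf hg]

theorem pd_mul {f g : Coord → ℝ} (hf : DifferentiableAt ℝ f x) (hg : DifferentiableAt ℝ g x)
    (m : Fin 4) : pd m (fun y => f y * g y) x = pd m f x * g x + f x * pd m g x := by
  simp [pd, fderiv_fun_mul hf hg]; ring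

theorem pd_sum {ι : Type*} (s : Finset ι) {f : ι → Coord → ℝ}
    (hf : ∀ i ∈ s, DifferentiableAt ℝ (f i) x) (m : Fin 4) :
    pd m (fun y => ∑ i ∈ s, f i y) x = ∑ i ∈ s, pd m (f i) x := by
  simp [pd, fderiv_fun_sum hf]

@[simp] theorem pd_const (k : ℝ) (m : Fin 4) : pd m (fun _ => k) x = 0 := by
  simp [pd]

theorem pd_congr (hU : IsOpen U) (hx : x ∈ U) {f g : Coord → ℝ} (h : ∀ y ∈ U, f y = g y)
    (m : Fin 4) : pd m f x = pd m g x := by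
  have : f =ᶠ[nhds x] g := Filter.eventually_of_mem (hU.mem_nhds hx) h
  simp [pd, this.fderiv_eq]

/-- The chain rule for a function of one variable. -/
theorem pd_comp_one {φ : ℝ → ℝ} {φ' : ℝ} {f : Coord → ℝ} (hφ : HasDerivAt φ φ' (f x))
    (hf : DifferentiableAt ℝ f x) (m : Fin 4) :
    pd m (fun y => φ (f y)) x = φ' * pd m f x := by
  have := (hφ.comp_hasFDerivAt x hf.hasFDerivAt).fderiv
  simp only [Function.comp_def] at this
  simp [pd, this]

theorem contDiffOn_pd (hU : IsOpen U) {f : Coord → ℝ} (hf : ContDiffOn ℝ ∞ f U) (m : Fin 4) :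
    ContDiffOn ℝ ∞ (fun y => pd m f y) U :=
  (hf.fderiv_of_isOpen hU (by simp)).clm_apply contDiffOn_const

theorem two_le_infty : (2 : WithTop ℕ∞) ≤ ∞ :=
  WithTop.coe_le_coe.2 (le_top : (2 : ℕ∞) ≤ ⊤)

theorem pd_comm (hU : IsOpen U) (hx : x ∈ U) {f : Coord → ℝ} (hf : ContDiffOn ℝ ∞ f U)
    (m n : Fin 4) : pd m (fun y => pd n f y) x = pd n (fun y => pd m f y) x := by
  have hfx := hf.contDiffAt (hU.mem_nhds hx)
  have hs : IsSymmSndFDerivAt ℝ f x := hfx.isSymmSndFDerivAt (by simpa using two_le_infty)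
  have hd : DifferentiableAt ℝ (fderiv ℝ f) x :=
    (hfx.fderiv_right (m := 1) (by rw [one_add_one_eq_two]; exact two_le_infty)).differentiableAt (by simp)
  have key : ∀ v w : Coord, fderiv ℝ (fun y => fderiv ℝ f y v) x w = fderiv ℝ (fderiv ℝ f) x w v := by
    intro v w
    rw [fderiv_clm_apply hd (by fun_prop)]
    simp
  simp only [pd, key]
  exact hs _ _

/-! ### Matrix valued functions -/

/-- The entrywise partial derivative. -/
def pdM (m : Fin 4) (A : Coord → Mat) (x : Coord) : Mat :=
  Matrix.of fun i j => pd m (fun y => A y i j) x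

@[simp] theorem pdM_apply (m : Fin 4) (A : Coord → Mat) (x : Coord) (i j : Fin 4) :
    pdM m A x i j = pd m (fun y => A y i j) x := rfl

/-- Entrywise smoothness on `U`. -/
def SmoothMat (U : Set Coord) (A : Coord → Mat) : Prop :=
  ∀ i j, ContDiffOn ℝ ∞ (fun x => A x i j) U

variable {A B : Coord → Mat}

theorem SmoothMat.mul (hA : SmoothMat U A) (hB : SmoothMat U B) :
    SmoothMat U (fun y => A y * B y) := by
  intro i j
  simp only [Matrix.mul_apply]
  exact ContDiffOn.sum fun k _ => (hA i k).mul (hB k j)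

theorem SmoothMat.add (hA : SmoothMat U A) (hB : SmoothMat U B) :
    SmoothMat U (fun y => A y + B y) := fun i j => (hA i j).add (hB i j)

theorem SmoothMat.sub (hA : SmoothMat U A) (hB : SmoothMat U B) :
    SmoothMat U (fun y => A y - B y) := fun i j => (hA i j).sub (hB i j)

theorem SmoothMat.transpose (hA : SmoothMat U A) : SmoothMat U (fun y => (A y).transpose) :=
  fun i j => hA j i

theorem SmoothMat.pdM (hU : IsOpen U) (hA : SmoothMat U A) (m : Fin 4) :
    SmoothMat U (fun y => pdM m A y) :=
  fun i j => contDiffOn_pd hU (hA i j) m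

theorem SmoothMat.congr (hA : SmoothMat U A) (h : ∀ y ∈ U, B y = A y) : SmoothMat U B :=
  fun i j => (hA i j).congr fun y hy => by rw [h y hy]

theorem SmoothMat.mono {V : Set Coord} (hA : SmoothMat U A) (h : V ⊆ U) : SmoothMat V A :=
  fun i j => (hA i j).mono h

theorem SmoothMat.smul {f : Coord → ℝ} (hf : ContDiffOn ℝ ∞ f U) (hA : SmoothMat U A) :
    SmoothMat U (fun y => f y • A y) := fun i j => hf.mul (hA i j)

theorem SmoothMat.sum {ι : Type*} (s : Finset ι) {A : ι → Coord → Mat}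
    (hA : ∀ i ∈ s, SmoothMat U (A i)) : SmoothMat U (fun y => ∑ i ∈ s, A i y) := by
  intro i j
  simp only [Matrix.sum_apply]
  exact ContDiffOn.sum fun k hk => hA k hk i j

theorem SmoothMat.det (hA : SmoothMat U A) : ContDiffOn ℝ ∞ (fun y => (A y).det) U := by
  simp only [Matrix.det_apply]
  exact ContDiffOn.sum fun σ _ => (contDiffOn_prod fun i _ => hA _ _).const_smul _

/-- Cramer's rule: the entries of the adjugate are determinants of matrices with smooth entries. -/
theorem SmoothMat.inv (hA : SmoothMat U A) (hd : ∀ y ∈ U, (A y).det ≠ 0) :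
    SmoothMat U (fun y => (A y)⁻¹) := by
  have h : SmoothMat U (fun y => (A y).adjugate) := by
    intro i j
    simp only [Matrix.adjugate_apply]
    refine SmoothMat.det fun k l => ?_
    by_cases hk : k = j
    · subst hk; simp only [Matrix.updateRow_self]; exact contDiffOn_const
    · simp only [Matrix.updateRow_ne hk]; exact hA k l
  refine (SmoothMat.smul (f := fun y => (A y).det⁻¹) (hA.det.inv hd) h).congr fun y _ => ?_
  rw [Matrix.inv_def, Ring.inverse_eq_inv']

theorem pdM_mul (hU : IsOpen U) (hx : x ∈ U) (hA : SmoothMat U A) (hB : SmoothMat U B)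
    (m : Fin 4) : pdM m (fun y => A y * B y) x = pdM m A x * B x + A x * pdM m B x := by
  ext i j
  simp only [pdM_apply, Matrix.mul_apply, Matrix.add_apply]
  rw [pd_sum _ fun k _ => diffAt hU hx ((hA i k).mul (hB k j)), ← Finset.sum_add_distrib]
  exact Finset.sum_congr rfl fun k _ => pd_mul (diffAt hU hx (hA i k)) (diffAt hU hx (hB k j)) m

theorem pdM_add (hU : IsOpen U) (hx : x ∈ U) (hA : SmoothMat U A) (hB : SmoothMat U B)
    (m : Fin 4) : pdM m (fun y => A y + B y) x = pdM m A x + pdM m B x := by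
  ext i j
  exact pd_add (diffAt hU hx (hA i j)) (diffAt hU hx (hB i j)) m

theorem pdM_smul (hU : IsOpen U) (hx : x ∈ U) {f : Coord → ℝ} (hf : ContDiffOn ℝ ∞ f U)
    (hA : SmoothMat U A) (m : Fin 4) :
    pdM m (fun y => f y • A y) x = pd m f x • A x + f x • pdM m A x := by
  ext i j
  exact pd_mul (diffAt hU hx hf) (diffAt hU hx (hA i j)) m

theorem pdM_sum (hU : IsOpen U) (hx : x ∈ U) {ι : Type*} (s : Finset ι) {A : ι → Coord → Mat}
    (hA : ∀ i ∈ s, SmoothMat U (A i)) (m : Fin 4) :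
    pdM m (fun y => ∑ i ∈ s, A i y) x = ∑ i ∈ s, pdM m (A i) x := by
  ext i j
  simp only [pdM_apply, Matrix.sum_apply]
  exact pd_sum s (fun k hk => diffAt hU hx (hA k hk i j)) m

theorem pdM_congr (hU : IsOpen U) (hx : x ∈ U) (h : ∀ y ∈ U, A y = B y) (m : Fin 4) :
    pdM m A x = pdM m B x := by
  ext i j
  exact pd_congr hU hx (fun y hy => by rw [h y hy]) m

theorem pdM_transpose (m : Fin 4) :
    pdM m (fun y => (A y).transpose) x = (pdM m A x).transpose := rfl

theorem pdM_comm (hU : IsOpen U) (hx : x ∈ U) (hA : SmoothMat U A) (m n : Fin 4) :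
    pdM m (fun y => pdM n A y) x = pdM n (fun y => pdM m A y) x := by
  ext i j
  exact pd_comm hU hx (hA i j) m n

/-! ### Moving frames -/

/-- The matrices `(Γ_m)^l_n = Γ^l_{mn}`. -/
def chr (G : Coord → Mat) (m : Fin 4) (x : Coord) : Mat :=
  Matrix.of fun l n => christoffel G l m n x

/-- The curvature matrices `(R_{mn})^l_s`. -/
def curv (G : Coord → Mat) (m n : Fin 4) (x : Coord) : Mat :=
  pdM m (chr G n) x - pdM n (chr G m) x + (chr G m x * chr G n x - chr G n x * chr G m x)

/-- The rows of `e` are a coframe in which the metric `G` has the components `h` and the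
Levi-Civita connection the components `γ`, where `D l k` is the derivative of `γ k` along the `l`-th
vector of the dual frame. -/
structure IsFrame (U : Set Coord) (G e h : Coord → Mat) (γ : Fin 4 → Coord → Mat)
    (D : Fin 4 → Fin 4 → Coord → Mat) : Prop where
  isOpen : IsOpen U
  smooth_e : SmoothMat U e
  smooth_h : SmoothMat U h
  smooth_γ : ∀ k, SmoothMat U (γ k)
  det_e : ∀ y ∈ U, (e y).det ≠ 0
  det_h : ∀ y ∈ U, (h y).det ≠ 0
  symm : ∀ y ∈ U, (h y).transpose = h y
  metric : ∀ y ∈ U, G y = (e y).transpose * h y * e y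
  compat : ∀ y ∈ U, ∀ m,
    pdM m h y = ∑ k, e y k m • (h y * γ k y + (γ k y).transpose * h y)
  torsion : ∀ y ∈ U, ∀ m n k, pd m (fun z => e z k n) y - pd n (fun z => e z k m) y
    = ∑ p, ∑ q, e y p m * e y q n * (γ q y k p - γ p y k q)
  deriv : ∀ y ∈ U, ∀ m k, pdM m (γ k) y = ∑ l, e y l m • D l k y

/-- The connection matrices with respect to the coordinates. -/
def conn (e : Coord → Mat) (γ : Fin 4 → Coord → Mat) (m : Fin 4) (y : Coord) : Mat :=
  ∑ k, e y k m • γ k y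

/-- The curvature matrices with respect to the frame. -/
def frameCurv (γ : Fin 4 → Mat) (D : Fin 4 → Fin 4 → Mat) (p q : Fin 4) : Mat :=
  D p q - D q p + (γ p * γ q - γ q * γ p) + ∑ k, (γ q k p - γ p k q) • γ k

namespace IsFrame

variable {U : Set Coord} {G e h : Coord → Mat} {γ : Fin 4 → Coord → Mat}
  {D : Fin 4 → Fin 4 → Coord → Mat} {x : Coord}

theorem det_metric (F : IsFrame U G e h γ D) (hx : x ∈ U) : (G x).det ≠ 0 := by
  rw [F.metric x hx, Matrix.det_mul, Matrix.det_mul, Matrix.det_transpose]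
  exact mul_ne_zero (mul_ne_zero (F.det_e x hx) (F.det_h x hx)) (F.det_e x hx)

theorem smooth_metric (F : IsFrame U G e h γ D) : SmoothMat U G :=
  ((F.smooth_e.transpose.mul F.smooth_h).mul F.smooth_e).congr F.metric

theorem symm_metric (F : IsFrame U G e h γ D) (hx : x ∈ U) : (G x).transpose = G x := by
  rw [F.metric x hx]
  simp [Matrix.transpose_mul, F.symm x hx, Matrix.mul_assoc]

theorem smooth_conn (F : IsFrame U G e h γ D) (m : Fin 4) : SmoothMat U (conn e γ m) :=
  SmoothMat.sum _ fun k _ => SmoothMat.smul (F.smooth_e k m) (F.smooth_γ k)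

theorem compat_conn (F : IsFrame U G e h γ D) (hx : x ∈ U) (m : Fin 4) :
    pdM m h x = h x * conn e γ m x + (conn e γ m x).transpose * h x := by
  rw [F.compat x hx, conn, Finset.mul_sum, Matrix.transpose_sum, Finset.sum_mul,
    ← Finset.sum_add_distrib]
  refine Finset.sum_congr rfl fun k _ => ?_
  rw [smul_add, Matrix.mul_smul, Matrix.transpose_smul, Matrix.smul_mul]

/-- The first structure equation `de + A ∧ e = 0`, put as a symmetry in the two coordinate indices.
In this form it yields the symmetry of the Christoffel symbols directly. -/
theorem torsion_conn (F : IsFrame U G e h γ D) (hx : x ∈ U) (m n a : Fin 4) :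
    (pdM m e x + conn e γ m x * e x) a n = (pdM n e x + conn e γ n x * e x) a m := by
  have key : ∀ m n, (conn e γ m x * e x) a n = ∑ p, ∑ q, e x p m * e x q n * γ p x a q := by
    intro m n
    simp only [conn, Matrix.mul_apply, Matrix.sum_apply, Matrix.smul_apply, smul_eq_mul,
      Finset.sum_mul]
    rw [Finset.sum_comm]
    exact Finset.sum_congr rfl fun p _ => Finset.sum_congr rfl fun q _ => by ring
  have h1 := F.torsion x hx m n a
  have h2 : ∑ p, ∑ q, e x p n * e x q m * γ p x a q = ∑ p, ∑ q, e x p m * e x q n * γ q x a p := by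
    rw [Finset.sum_comm]
    exact Finset.sum_congr rfl fun p _ => Finset.sum_congr rfl fun q _ => by ring
  rw [Matrix.add_apply, Matrix.add_apply, key, key, h2, pdM_apply, pdM_apply]
  simp only [mul_sub, Finset.sum_sub_distrib] at h1
  linarith

theorem mul_inv_cancel (F : IsFrame U G e h γ D) (hx : x ∈ U) : e x * (e x)⁻¹ = 1 :=
  Matrix.mul_nonsing_inv _ (isUnit_iff_ne_zero.2 (F.det_e x hx))

theorem inv_mul_cancel (F : IsFrame U G e h γ D) (hx : x ∈ U) : (e x)⁻¹ * e x = 1 :=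
  Matrix.nonsing_inv_mul _ (isUnit_iff_ne_zero.2 (F.det_e x hx))

/-- Uniqueness of the Levi-Civita connection. The right-hand side is the frame connection
transformed to the coordinate basis; it is torsion-free and metric, so the Koszul formula forces it
to be the Christoffel symbols. -/
theorem chr_eq (F : IsFrame U G e h γ D) (hx : x ∈ U) (m : Fin 4) :
    chr G m x = (e x)⁻¹ * (pdM m e x + conn e γ m x * e x) := by
  set Γ : Fin 4 → Mat := fun m => (e x)⁻¹ * (pdM m e x + conn e γ m x * e x) with hΓ
  have heΓ : ∀ m, e x * Γ m = pdM m e x + conn e γ m x * e x := fun m => by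
    rw [hΓ, ← Matrix.mul_assoc, F.mul_inv_cancel hx, Matrix.one_mul]
  have hsymm : ∀ m l n, Γ m l n = Γ n l m := fun m l n => by
    simp only [hΓ]
    rw [Matrix.mul_apply, Matrix.mul_apply]
    exact Finset.sum_congr rfl fun a _ => by rw [F.torsion_conn hx m n a]
  -- Metric compatibility: the product rule for `eᵀ h e`, with `∂h` replaced by the compatibility of
  -- the frame connection.
  have hd : ∀ m, pdM m G x = G x * Γ m + (Γ m).transpose * G x := fun m => by
    rw [pdM_congr F.isOpen hx F.metric m,
      pdM_mul F.isOpen hx (F.smooth_e.transpose.mul F.smooth_h) F.smooth_e,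
      pdM_mul F.isOpen hx F.smooth_e.transpose F.smooth_h, pdM_transpose, F.metric x hx,
      F.compat_conn hx, Matrix.mul_assoc _ _ (Γ m), heΓ, ← Matrix.mul_assoc, ← Matrix.mul_assoc,
      ← Matrix.transpose_mul, heΓ]
    simp only [Matrix.transpose_add, Matrix.transpose_mul, Matrix.mul_add, Matrix.add_mul,
      Matrix.mul_assoc]
    abel
  have hG := F.symm_metric hx
  have hGs : ∀ i j, G x i j = G x j i := fun i j => by
    conv_lhs => rw [← hG]
    rfl
  ext l n
  -- The Koszul combination: of the six terms given by compatibility, four cancel by symmetry of `Γ`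
  -- and of the metric, and two coincide.
  have hbr : ∀ s, pd m (fun y => G y s n) x + pd n (fun y => G y s m) x
      - pd s (fun y => G y m n) x = 2 * (G x * Γ m) s n := by
    intro s
    have e1 := congrFun (congrFun (hd m) s) n
    have e2 := congrFun (congrFun (hd n) s) m
    have e3 := congrFun (congrFun (hd s) m) n
    have a1 : (G x * Γ n) s m = (G x * Γ m) s n := by
      simp only [Matrix.mul_apply, hsymm n]
    have a2 : ((Γ m).transpose * G x) s n = ((Γ s).transpose * G x) m n := by
      simp only [Matrix.mul_apply, Matrix.transpose_apply, hsymm m _ s]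
    have a3 : ((Γ n).transpose * G x) s m = (G x * Γ s) m n := by
      simp only [Matrix.mul_apply, Matrix.transpose_apply]
      exact Finset.sum_congr rfl fun k _ => by rw [hsymm n k s, hGs k m, mul_comm]
    simp only [pdM_apply, Matrix.add_apply] at e1 e2 e3
    rw [e1, e2, e3, a1, a2, a3]; ring
  have hdet : (G x)⁻¹ * G x = 1 :=
    Matrix.nonsing_inv_mul _ (isUnit_iff_ne_zero.2 (F.det_metric hx))
  calc chr G m x l n = ∑ s, (G x)⁻¹ l s * (G x * Γ m) s n := by
        simp only [chr, Matrix.of_apply, christoffel, hbr, Finset.mul_sum]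
        exact Finset.sum_congr rfl fun s _ => by ring
    _ = Γ m l n := by
        rw [← Matrix.mul_apply, ← Matrix.mul_assoc, hdet, Matrix.one_mul]

theorem smooth_chr (F : IsFrame U G e h γ D) (m : Fin 4) : SmoothMat U (chr G m) :=
  ((F.smooth_e.inv F.det_e).mul ((F.smooth_e.pdM F.isOpen m).add
    ((F.smooth_conn m).mul F.smooth_e))).congr fun _ hy => F.chr_eq hy m

theorem chr_symm (F : IsFrame U G e h γ D) (hx : x ∈ U) (m l n : Fin 4) :
    chr G m x l n = chr G n x l m := by
  rw [F.chr_eq hx, F.chr_eq hx, Matrix.mul_apply, Matrix.mul_apply]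
  exact Finset.sum_congr rfl fun a _ => by rw [F.torsion_conn hx m n a]

/-- Gauge covariance of curvature. Differentiate `e Γ_n = ∂_n e + A_n e` in direction `m` and
antisymmetrise: the second derivatives of `e` drop out, and the first derivatives are eliminated by
the same equation. -/
theorem curv_eq_conn (F : IsFrame U G e h γ D) (hx : x ∈ U) (m n : Fin 4) :
    e x * curv G m n x = (pdM m (conn e γ n) x - pdM n (conn e γ m) x
      + (conn e γ m x * conn e γ n x - conn e γ n x * conn e γ m x)) * e x := by
  have h0 : ∀ y ∈ U, ∀ m, e y * chr G m y = pdM m e y + conn e γ m y * e y := fun y hy m => by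
    rw [F.chr_eq hy, ← Matrix.mul_assoc, F.mul_inv_cancel hy, Matrix.one_mul]
  have h1 : ∀ m n, pdM m e x * chr G n x + e x * pdM m (chr G n) x
      = pdM m (fun y => pdM n e y) x + (pdM m (conn e γ n) x * e x + conn e γ n x * pdM m e x) := by
    intro m n
    rw [← pdM_mul F.isOpen hx F.smooth_e (F.smooth_chr n),
      pdM_congr F.isOpen hx (fun y hy => h0 y hy n),
      pdM_add F.isOpen hx (F.smooth_e.pdM F.isOpen n) ((F.smooth_conn n).mul F.smooth_e),
      pdM_mul F.isOpen hx (F.smooth_conn n) F.smooth_e]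
  have h2 : ∀ m, pdM m e x = e x * chr G m x - conn e γ m x * e x := fun m => by
    rw [h0 x hx]; abel
  have hmn := h1 m n
  have hnm := h1 n m
  rw [pdM_comm F.isOpen hx F.smooth_e] at hnm
  rw [h2 m] at hmn
  rw [h2 n] at hnm
  have := congrArg₂ (· - ·) hmn hnm
  simp only [curv]
  simp only [Matrix.mul_add, Matrix.add_mul, Matrix.mul_sub, Matrix.sub_mul,
    Matrix.mul_assoc] at this ⊢
  rw [← sub_eq_zero] at this ⊢
  rw [← this]
  abel

/-- Expanding `A_m = ∑ e^k_m γ_k` leaves derivatives of the `γ_k`, which are given along the frame,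
and the exterior derivative of the coframe. The torsion equation turns the latter into the last sum
of `frameCurv`. -/
theorem curv_conn (F : IsFrame U G e h γ D) (hx : x ∈ U) (m n : Fin 4) :
    pdM m (conn e γ n) x - pdM n (conn e γ m) x
      + (conn e γ m x * conn e γ n x - conn e γ n x * conn e γ m x)
    = ∑ p, ∑ q, (e x p m * e x q n) • frameCurv (fun k => γ k x) (fun k l => D k l x) p q := by
  have h1 : ∀ m n, pdM m (conn e γ n) x = ∑ k, pd m (fun y => e y k n) x • γ k x
      + ∑ p, ∑ q, (e x p m * e x q n) • D p q x := by
    intro m n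
    have : pdM m (conn e γ n) x = ∑ k, pdM m (fun y => e y k n • γ k y) x :=
      pdM_sum F.isOpen hx _ (fun k _ => SmoothMat.smul (F.smooth_e k n) (F.smooth_γ k)) m
    rw [this, Finset.sum_comm, ← Finset.sum_add_distrib]
    refine Finset.sum_congr rfl fun k _ => ?_
    rw [pdM_smul F.isOpen hx (F.smooth_e k n) (F.smooth_γ k), F.deriv x hx, Finset.smul_sum]
    congr 1
    exact Finset.sum_congr rfl fun l _ => by rw [smul_smul, mul_comm]
  have h2 : ∀ m n, conn e γ m x * conn e γ n x
      = ∑ p, ∑ q, (e x p m * e x q n) • (γ p x * γ q x) := by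
    intro m n
    simp only [conn, Finset.sum_mul, Finset.mul_sum, Matrix.smul_mul, Matrix.mul_smul, smul_smul]
    rw [Finset.sum_comm]
    simp only [mul_comm]
  have h3 : ∀ (m n : Fin 4) (f : Fin 4 → Fin 4 → Mat), ∑ p, ∑ q, (e x p n * e x q m) • f p q
      = ∑ p, ∑ q, (e x p m * e x q n) • f q p := by
    intro m n f
    rw [Finset.sum_comm]
    exact Finset.sum_congr rfl fun p _ => Finset.sum_congr rfl fun q _ => by rw [mul_comm]
  have h4 : ∑ k, pd m (fun y => e y k n) x • γ k x - ∑ k, pd n (fun y => e y k m) x • γ k x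
      = ∑ p, ∑ q, (e x p m * e x q n) • ∑ k, (γ q x k p - γ p x k q) • γ k x := by
    rw [← Finset.sum_sub_distrib]
    simp only [← sub_smul, F.torsion x hx, Finset.sum_smul, Finset.smul_sum, smul_smul]
    rw [Finset.sum_comm]
    exact Finset.sum_congr rfl fun p _ => Finset.sum_comm
  rw [h1, h1, h2, h2 n m, h3 m n, h3 m n]
  simp only [frameCurv, smul_add, smul_sub, Finset.sum_add_distrib, Finset.sum_sub_distrib, ← h4]
  abel

/-- The curvature tensor in the frame. -/
theorem curv_eq (F : IsFrame U G e h γ D) (hx : x ∈ U) (m n : Fin 4) :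
    curv G m n x = ∑ p, ∑ q, (e x p m * e x q n) •
      ((e x)⁻¹ * frameCurv (fun k => γ k x) (fun k l => D k l x) p q * e x) := by
  have h := F.curv_eq_conn hx m n
  rw [F.curv_conn hx] at h
  have h' := congrArg ((e x)⁻¹ * ·) h
  simp only [← Matrix.mul_assoc, F.inv_mul_cancel hx, Matrix.one_mul] at h'
  rw [h']
  simp only [Finset.mul_sum, Finset.sum_mul, Matrix.mul_smul, Matrix.smul_mul, Matrix.mul_assoc]

end IsFrame

/-! ### Contractions -/

/-- The Ricci contraction of curvature matrices. -/
def ricciContr (Ω : Fin 4 → Fin 4 → Mat) : Mat := Matrix.of fun j q => ∑ k, Ω k q k j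

/-- The quadratic curvature invariant `g^{ab} g^{cd} tr (R_{ac} R_{bd})`, which is the negative of
the Kretschmann scalar. -/
def kretschmann (g : Mat) (Ω : Fin 4 → Fin 4 → Mat) : ℝ :=
  ∑ a, ∑ b, g⁻¹ a b * ∑ c, ∑ d, g⁻¹ c d * (Ω a c * Ω b d).trace

/-- Invariance of a contraction under a change of basis. With `A` the inverse metric in coordinates
and `B` the one in the frame, it carries every trace below from the coordinates to the frame. -/
theorem sum_contr {A B e : Mat} (h : e * A * e.transpose = B) (f : Fin 4 → Fin 4 → ℝ) :
    ∑ m, ∑ p, A m p * ∑ a, ∑ b, e a m * e b p * f a b = ∑ a, ∑ b, B a b * f a b := by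
  subst h
  simp only [Matrix.mul_apply, Matrix.transpose_apply, Finset.sum_mul, Finset.mul_sum]
  calc _ = ∑ p, ∑ m, ∑ a, ∑ b, A m p * (e a m * e b p * f a b) := Finset.sum_comm
    _ = ∑ p, ∑ a, ∑ m, ∑ b, A m p * (e a m * e b p * f a b) :=
        Finset.sum_congr rfl fun _ _ => Finset.sum_comm
    _ = ∑ a, ∑ p, ∑ m, ∑ b, A m p * (e a m * e b p * f a b) := Finset.sum_comm
    _ = ∑ a, ∑ p, ∑ b, ∑ m, A m p * (e a m * e b p * f a b) :=
        Finset.sum_congr rfl fun _ _ => Finset.sum_congr rfl fun _ _ => Finset.sum_comm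
    _ = ∑ a, ∑ b, ∑ p, ∑ m, A m p * (e a m * e b p * f a b) :=
        Finset.sum_congr rfl fun _ _ => Finset.sum_comm
    _ = _ := by
        refine Finset.sum_congr rfl fun a _ => Finset.sum_congr rfl fun b _ =>
          Finset.sum_congr rfl fun p _ => Finset.sum_congr rfl fun m _ => ?_
        ring

theorem sum_comm_pairs (f : Fin 4 → Fin 4 → Fin 4 → Fin 4 → ℝ) :
    ∑ a, ∑ b, ∑ c, ∑ d, f a b c d = ∑ c, ∑ d, ∑ a, ∑ b, f a b c d := by
  simp only [← Finset.univ.sum_product' Finset.univ]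
  exact Finset.sum_comm

theorem sum_swap_pairs (f : Fin 4 → Fin 4 → Fin 4 → Fin 4 → ℝ) :
    ∑ a, ∑ c, ∑ b, ∑ d, f a c b d = ∑ c, ∑ d, ∑ a, ∑ b, f a c b d := by
  have h : ∀ a, ∑ c, ∑ b, ∑ d, f a c b d = ∑ b, ∑ c, ∑ d, f a c b d := fun a => Finset.sum_comm
  simp only [h]
  exact sum_comm_pairs fun a b c d => f a c b d

theorem transpose_mul_mul_apply (A e : Mat) (m n : Fin 4) :
    (e.transpose * A * e) m n = ∑ a, ∑ b, e a m * e b n * A a b := by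
  simp only [Matrix.mul_apply, Matrix.transpose_apply, Finset.sum_mul]
  rw [Finset.sum_comm]
  exact Finset.sum_congr rfl fun a _ => Finset.sum_congr rfl fun b _ => by ring

namespace IsFrame

variable {U : Set Coord} {G e h : Coord → Mat} {γ : Fin 4 → Coord → Mat}
  {D : Fin 4 → Fin 4 → Coord → Mat} {x : Coord}

theorem contr_inv (F : IsFrame U G e h γ D) (hx : x ∈ U) :
    e x * (G x)⁻¹ * (e x).transpose = (h x)⁻¹ := by
  have he : IsUnit (e x).det := isUnit_iff_ne_zero.2 (F.det_e x hx)
  have he' : IsUnit (e x).transpose.det := by rwa [Matrix.det_transpose]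
  rw [F.metric x hx, Matrix.mul_inv_rev, Matrix.mul_inv_rev]
  calc _ = (e x * (e x)⁻¹) * (h x)⁻¹ * ((e x).transpose⁻¹ * (e x).transpose) := by
        simp only [Matrix.mul_assoc]
    _ = _ := by
        rw [Matrix.mul_nonsing_inv _ he, Matrix.nonsing_inv_mul _ he', Matrix.one_mul,
          Matrix.mul_one]

/-- The contraction pairs the endomorphism index with the first form index. The conjugating `e⁻¹`
meets the `e` of that form index and both disappear, so the trace may be taken in the frame. -/
theorem ricci_eq (F : IsFrame U G e h γ D) (hx : x ∈ U) :
    ricci G x = (e x).transpose *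
      ricciContr (frameCurv (fun k => γ k x) (fun k l => D k l x)) * e x := by
  set Ω := frameCurv (fun k => γ k x) (fun k l => D k l x) with hΩ
  ext m n
  -- The defining formula has the lower indices of `Γ` in another order than the curvature matrices;
  -- symmetry in these indices reconciles them.
  have h1 : ricci G x m n = ∑ l, curv G l n x l m := by
    simp only [ricci, curv, Matrix.of_apply, Matrix.add_apply, Matrix.sub_apply, pdM_apply,
      Matrix.mul_apply, ← Finset.sum_add_distrib, ← Finset.sum_sub_distrib]
    refine Finset.sum_congr rfl fun l _ => ?_
    have e1 : pd l (christoffel G l m n) x = pd l (fun y => chr G n y l m) x :=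
      pd_congr F.isOpen hx (fun y hy => F.chr_symm hy m l n) l
    have e2 : pd n (christoffel G l m l) x = pd n (fun y => chr G l y l m) x :=
      pd_congr F.isOpen hx (fun y hy => F.chr_symm hy m l l) n
    rw [e1, e2]
    congr 1
    refine Finset.sum_congr rfl fun s _ => ?_
    have e3 : christoffel G s m n x = chr G n x s m := F.chr_symm hx m s n
    have e4 : christoffel G s m l x = chr G l x s m := F.chr_symm hx m s l
    rw [e3, e4]; rfl
  rw [h1, transpose_mul_mul_apply]
  simp only [F.curv_eq hx, ← hΩ, Matrix.sum_apply, Matrix.smul_apply, smul_eq_mul]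
  calc ∑ l, ∑ p, ∑ q, e x p l * e x q n * ((e x)⁻¹ * Ω p q * e x) l m
      = ∑ p, ∑ q, ∑ l, e x p l * e x q n * ((e x)⁻¹ * Ω p q * e x) l m := by
        rw [Finset.sum_comm]
        exact Finset.sum_congr rfl fun p _ => Finset.sum_comm
    _ = ∑ p, ∑ q, ∑ j, e x q n * (Ω p q p j * e x j m) := by
        refine Finset.sum_congr rfl fun p _ => Finset.sum_congr rfl fun q _ => ?_
        have : (e x * ((e x)⁻¹ * Ω p q * e x)) p m = (Ω p q * e x) p m := by
          rw [Matrix.mul_assoc, ← Matrix.mul_assoc, F.mul_inv_cancel hx, Matrix.one_mul]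
        rw [Matrix.mul_apply, Matrix.mul_apply] at this
        rw [← Finset.mul_sum, ← this, Finset.mul_sum]
        exact Finset.sum_congr rfl fun l _ => by ring
    _ = ∑ j, ∑ q, ∑ p, e x q n * (Ω p q p j * e x j m) := by
        rw [Finset.sum_comm]
        calc _ = ∑ q, ∑ j, ∑ p, e x q n * (Ω p q p j * e x j m) :=
              Finset.sum_congr rfl fun q _ => Finset.sum_comm
          _ = _ := Finset.sum_comm
    _ = _ := by
        refine Finset.sum_congr rfl fun j _ => Finset.sum_congr rfl fun q _ => ?_
        simp only [ricciContr, Matrix.of_apply, Finset.mul_sum]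
        exact Finset.sum_congr rfl fun l _ => by ring

/-- The trace of a product of two curvature endomorphisms does not see the conjugation by `e`; the
four form indices are handled by two applications of `sum_contr`. -/
theorem kretschmann_eq (F : IsFrame U G e h γ D) (hx : x ∈ U) :
    kretschmann (G x) (fun m n => curv G m n x)
      = kretschmann (h x) (frameCurv (fun k => γ k x) (fun k l => D k l x)) := by
  set Ω := frameCurv (fun k => γ k x) (fun k l => D k l x) with hΩ
  have htr : ∀ m n p q, (curv G m n x * curv G p q x).trace
      = ∑ c, ∑ d, e x c n * e x d q * ∑ a, ∑ b, e x a m * e x b p * (Ω a c * Ω b d).trace := by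
    intro m n p q
    have h1 : ∀ a b c d, (((e x)⁻¹ * Ω a c * e x) * ((e x)⁻¹ * Ω b d * e x)).trace
        = (Ω a c * Ω b d).trace := by
      intro a b c d
      have : ((e x)⁻¹ * Ω a c * e x) * ((e x)⁻¹ * Ω b d * e x)
          = (e x)⁻¹ * (Ω a c * Ω b d * e x) := by
        calc _ = (e x)⁻¹ * Ω a c * (e x * (e x)⁻¹) * Ω b d * e x := by
              simp only [Matrix.mul_assoc]
          _ = _ := by rw [F.mul_inv_cancel hx]; simp only [Matrix.mul_assoc, Matrix.one_mul]
      rw [this, Matrix.trace_mul_comm, Matrix.mul_assoc, F.mul_inv_cancel hx, Matrix.mul_one]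
    rw [F.curv_eq hx, F.curv_eq hx, ← hΩ]
    simp only [Finset.sum_mul]
    simp only [Finset.mul_sum, Matrix.smul_mul, Matrix.mul_smul, Matrix.trace_sum,
      Matrix.trace_smul, smul_eq_mul, h1]
    rw [sum_swap_pairs]
    refine Finset.sum_congr rfl fun c _ => Finset.sum_congr rfl fun d _ =>
      Finset.sum_congr rfl fun a _ => Finset.sum_congr rfl fun b _ => ?_
    ring
  have hc := F.contr_inv hx
  unfold kretschmann
  simp only [htr]
  have h2 : ∀ m p, ∑ n, ∑ q, (G x)⁻¹ n q * ∑ c, ∑ d, e x c n * e x d q *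
        ∑ a, ∑ b, e x a m * e x b p * (Ω a c * Ω b d).trace
      = ∑ a, ∑ b, e x a m * e x b p * ∑ c, ∑ d, (h x)⁻¹ c d * (Ω a c * Ω b d).trace := by
    intro m p
    rw [sum_contr hc]
    simp only [Finset.mul_sum]
    rw [sum_comm_pairs]
    refine Finset.sum_congr rfl fun a _ => Finset.sum_congr rfl fun b _ =>
      Finset.sum_congr rfl fun c _ => Finset.sum_congr rfl fun d _ => ?_
    ring
  simp only [h2]
  rw [sum_contr hc]

theorem scalarCurv_eq (F : IsFrame U G e h γ D) (hx : x ∈ U) {R : Mat}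
    (hR : ricci G x = (e x).transpose * R * e x) :
    scalarCurv G x = ∑ a, ∑ b, (h x)⁻¹ a b * R a b := by
  simp only [scalarCurv, hR, transpose_mul_mul_apply]
  exact sum_contr (F.contr_inv hx) _

theorem raise_eq (F : IsFrame U G e h γ D) (hx : x ∈ U) {Fm : Coord → Mat} {f : Mat}
    (hF : Fm x = (e x).transpose * f * e x) :
    e x * raise G Fm x * (e x).transpose = (h x)⁻¹ * f * ((h x)⁻¹).transpose := by
  have h1 : raise G Fm x = (G x)⁻¹ * Fm x * ((G x)⁻¹).transpose := by
    ext m n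
    simp only [raise, Matrix.of_apply, Matrix.mul_apply, Matrix.transpose_apply, Finset.sum_mul]
    rw [Finset.sum_comm]
    exact Finset.sum_congr rfl fun a _ => Finset.sum_congr rfl fun b _ => by ring
  rw [h1, hF, ← F.contr_inv hx]
  simp only [Matrix.transpose_mul, Matrix.transpose_transpose, Matrix.mul_assoc]

/-- `F_{αβ} F^{αβ}` in the frame. -/
theorem sum_mul_raise (F : IsFrame U G e h γ D) (hx : x ∈ U) {Fm : Coord → Mat} {f : Mat}
    (hF : Fm x = (e x).transpose * f * e x) :
    ∑ α, ∑ β, Fm x α β * raise G Fm x α β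
      = ∑ a, ∑ b, ((h x)⁻¹ * f * ((h x)⁻¹).transpose) a b * f a b := by
  rw [← sum_contr (F.raise_eq hx hF) fun a b => f a b]
  refine Finset.sum_congr rfl fun m _ => Finset.sum_congr rfl fun n _ => ?_
  rw [hF, transpose_mul_mul_apply, mul_comm]

theorem stressEnergy_eq (F : IsFrame U G e h γ D) (hx : x ∈ U) {Fm : Coord → Mat} {f : Mat}
    (hF : Fm x = (e x).transpose * f * e x) :
    stressEnergy G Fm x = (e x).transpose * ((1 / (4 * Real.pi)) • (f.transpose * (h x)⁻¹ * f
      - ((1 / 4) * ∑ a, ∑ b, ((h x)⁻¹ * f * ((h x)⁻¹).transpose) a b * f a b) • h x)) * e x := by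
  have h1 : stressEnergy G Fm x = (1 / (4 * Real.pi)) • ((Fm x).transpose * (G x)⁻¹ * Fm x
      - ((1 / 4) * ∑ α, ∑ β, Fm x α β * raise G Fm x α β) • G x) := by
    ext m n
    simp only [stressEnergy, Matrix.of_apply, Matrix.smul_apply, Matrix.sub_apply, smul_eq_mul]
    rw [transpose_mul_mul_apply]
    congr 2
    · exact Finset.sum_congr rfl fun a _ => Finset.sum_congr rfl fun b _ => by ring
    · ring
  have h2 : (Fm x).transpose * (G x)⁻¹ * Fm x
      = (e x).transpose * (f.transpose * (h x)⁻¹ * f) * e x := by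
    rw [hF, ← F.contr_inv hx]
    simp only [Matrix.transpose_mul, Matrix.transpose_transpose, Matrix.mul_assoc]
  rw [h1, h2, F.sum_mul_raise hx hF, F.metric x hx]
  simp only [Matrix.mul_smul, Matrix.smul_mul, Matrix.mul_sub, Matrix.sub_mul]

/-- The Einstein–Maxwell equation in the frame. -/
theorem einstein_of_frame (F : IsFrame U G e h γ D) (hx : x ∈ U) {Λ : ℝ} {Fm : Coord → Mat}
    {f : Mat} (hF : Fm x = (e x).transpose * f * e x)
    (htrace : ∑ a, ∑ b, (h x)⁻¹ a b *
      ricciContr (frameCurv (fun k => γ k x) (fun k l => D k l x)) a b = 4 * Λ)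
    (hric : ricciContr (frameCurv (fun k => γ k x) (fun k l => D k l x))
      = Λ • h x + (2 : ℝ) • (f.transpose * (h x)⁻¹ * f
      - ((1 / 4) * ∑ a, ∑ b, ((h x)⁻¹ * f * ((h x)⁻¹).transpose) a b * f a b) • h x)) :
    einstein G x + Λ • G x = (8 * Real.pi) • stressEnergy G Fm x := by
  have hR := F.ricci_eq hx
  rw [F.stressEnergy_eq hx hF, einstein, F.scalarCurv_eq hx hR, htrace, hR, hric, F.metric x hx]
  have hπ : 8 * Real.pi * (1 / (4 * Real.pi)) = 2 := by
    field_simp; norm_num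
  simp only [Matrix.mul_add, Matrix.add_mul, Matrix.mul_smul, Matrix.smul_mul, smul_smul, hπ]
  -- The scalar curvature is `4Λ` since the stress is trace-free. Hence `-R/2 + Λ = -Λ`, which
  -- cancels the `Λ h` in the Ricci tensor.
  rw [show (4 * Λ / 2 : ℝ) = Λ + Λ by ring, add_smul]
  abel

/-- The divergence of an antisymmetric tensor vanishes if it does so in the frame. -/
theorem divergence_of_frame (F : IsFrame U G e h γ D) (hx : x ∈ U) {Fm f : Coord → Mat}
    (hsm : SmoothMat U Fm)
    (hF : ∀ y ∈ U, Fm y = (e y).transpose * f y * e y) (hanti : (f x).transpose = -f x)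
    {φ : Coord → Mat} (hφ : ∀ y ∈ U, (h y)⁻¹ * f y * ((h y)⁻¹).transpose = φ y)
    {Dφ : Fin 4 → Mat} (hDφ : ∀ m, pdM m φ x = ∑ l, e x l m • Dφ l)
    (hdiv : ∀ b, ∑ l, (Dφ l + γ l x * φ x + φ x * (γ l x).transpose) l b = 0) (n : Fin 4) :
    divergence G Fm n x = 0 := by
  have hinv : SmoothMat U (fun y => (G y)⁻¹) := F.smooth_metric.inv fun y hy => F.det_metric hy
  have hrs : SmoothMat U (raise G Fm) := by
    intro i j
    simp only [raise, Matrix.of_apply]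
    exact ContDiffOn.sum fun a _ => ContDiffOn.sum fun b _ =>
      ((hinv i a).mul (hinv j b)).mul (hsm a b)
  have hr : ∀ y ∈ U, e y * raise G Fm y * (e y).transpose = φ y := fun y hy => by
    rw [F.raise_eq hy (hF y hy), hφ y hy]
  -- `S m` is the full covariant derivative of the contravariant tensor in direction `m`; the
  -- divergence is its contraction.
  set S : Fin 4 → Mat := fun m => pdM m (raise G Fm) x + chr G m x * raise G Fm x
    + raise G Fm x * (chr G m x).transpose with hS
  have hanti' : ∀ m s, raise G Fm x m s = -raise G Fm x s m := by
    intro m s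
    have hFa : ∀ a b, Fm x a b = -Fm x b a := by
      intro a b
      have : (Fm x).transpose = -Fm x := by
        rw [hF x hx, Matrix.transpose_mul, Matrix.transpose_mul, hanti]
        simp [Matrix.mul_assoc]
      simpa using congrFun (congrFun this b) a
    simp only [raise, Matrix.of_apply]
    rw [Finset.sum_comm, ← Finset.sum_neg_distrib]
    refine Finset.sum_congr rfl fun a _ => ?_
    rw [← Finset.sum_neg_distrib]
    refine Finset.sum_congr rfl fun b _ => ?_
    rw [hFa b a]; ring
  -- A symmetric pair of indices contracted with an antisymmetric one.
  have hzero : ∀ n, ∑ m, ∑ s, christoffel G n m s x * raise G Fm x m s = 0 := by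
    intro n
    have h1 : ∑ m, ∑ s, christoffel G n m s x * raise G Fm x m s
        = -∑ m, ∑ s, christoffel G n m s x * raise G Fm x m s := by
      conv_lhs => rw [Finset.sum_comm]
      simp only [← Finset.sum_neg_distrib]
      refine Finset.sum_congr rfl fun m _ => Finset.sum_congr rfl fun s _ => ?_
      rw [hanti' s m, show christoffel G n s m x = christoffel G n m s x from F.chr_symm hx s n m]
      ring
    linarith
  have hdivS : ∀ n, divergence G Fm n x = ∑ m, S m m n := by
    intro n
    have e1 : ∑ m, (raise G Fm x * (chr G m x).transpose) m n = 0 := by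
      rw [← hzero n]
      simp only [Matrix.mul_apply, Matrix.transpose_apply]
      exact Finset.sum_congr rfl fun m _ => Finset.sum_congr rfl fun s _ => mul_comm _ _
    simp only [divergence, Finset.sum_add_distrib, hzero, hS, Matrix.add_apply, e1, pdM_apply,
      add_zero]
    simp only [Matrix.mul_apply]
    rfl
  -- The covariant derivative is tensorial: replacing `∂e` by `e Γ - A e` removes all derivatives of
  -- the coframe, and the frame connection remains.
  have hSe : ∀ m, e x * S m * (e x).transpose
      = ∑ l, e x l m • (Dφ l + γ l x * φ x + φ x * (γ l x).transpose) := by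
    intro m
    have h1 : pdM m φ x = pdM m e x * raise G Fm x * (e x).transpose
        + e x * pdM m (raise G Fm) x * (e x).transpose
        + e x * raise G Fm x * (pdM m e x).transpose := by
      rw [← pdM_congr F.isOpen hx hr, pdM_mul F.isOpen hx (F.smooth_e.mul hrs) F.smooth_e.transpose,
        pdM_mul F.isOpen hx F.smooth_e hrs, pdM_transpose, Matrix.add_mul]
    have h2 : pdM m e x = e x * chr G m x - conn e γ m x * e x := by
      rw [F.chr_eq hx, ← Matrix.mul_assoc, F.mul_inv_cancel hx, Matrix.one_mul]; abel
    have h3 : pdM m φ x + conn e γ m x * φ x + φ x * (conn e γ m x).transpose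
        = ∑ l, e x l m • (Dφ l + γ l x * φ x + φ x * (γ l x).transpose) := by
      simp only [hDφ, conn, Finset.sum_mul, Matrix.transpose_sum, Finset.mul_sum, smul_add,
        Finset.sum_add_distrib, Matrix.smul_mul, Matrix.transpose_smul, Matrix.mul_smul]
    rw [← h3, h1, ← hr x hx, h2, hS]
    simp only [Matrix.mul_add, Matrix.add_mul, Matrix.mul_sub, Matrix.sub_mul,
      Matrix.transpose_sub, Matrix.transpose_mul, Matrix.mul_assoc]
    abel
  -- In the frame the contraction is the one assumed to vanish, since `e` and `e⁻¹` cancel in the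
  -- summed index. As `e` is invertible, the coordinate components vanish too.
  have hb : ∀ b, ∑ n, e x b n * divergence G Fm n x = 0 := by
    intro b
    rw [← hdiv b]
    set N : Fin 4 → Mat := fun l => Dφ l + γ l x * φ x + φ x * (γ l x).transpose with hN
    have h4 : ∀ m, (S m * (e x).transpose) m b = ∑ i, ∑ l, (e x)⁻¹ m i * (e x l m * N l i b) := by
      intro m
      have : S m * (e x).transpose = (e x)⁻¹ * ∑ l, e x l m • N l := by
        rw [← hSe, ← Matrix.mul_assoc, ← Matrix.mul_assoc, F.inv_mul_cancel hx, Matrix.one_mul]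
      rw [this, Matrix.mul_apply]
      simp only [Matrix.sum_apply, Matrix.smul_apply, smul_eq_mul, Finset.mul_sum]
    calc ∑ n, e x b n * divergence G Fm n x = ∑ m, (S m * (e x).transpose) m b := by
          simp only [hdivS, Matrix.mul_apply, Matrix.transpose_apply, Finset.mul_sum]
          rw [Finset.sum_comm]
          exact Finset.sum_congr rfl fun m _ => Finset.sum_congr rfl fun s _ => mul_comm _ _
      _ = ∑ l, ∑ i, (∑ m, e x l m * (e x)⁻¹ m i) * N l i b := by
          simp only [h4, Finset.sum_mul]
          calc _ = ∑ m, ∑ l, ∑ i, _ := Finset.sum_congr rfl fun m _ => Finset.sum_comm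
            _ = ∑ l, ∑ m, ∑ i, _ := Finset.sum_comm
            _ = ∑ l, ∑ i, ∑ m, _ := Finset.sum_congr rfl fun l _ => Finset.sum_comm
            _ = _ := Finset.sum_congr rfl fun l _ => Finset.sum_congr rfl fun i _ =>
                Finset.sum_congr rfl fun m _ => by ring
      _ = ∑ l, N l l b := by
          refine Finset.sum_congr rfl fun l _ => ?_
          simp only [← Matrix.mul_apply, F.mul_inv_cancel hx, Matrix.one_apply, ite_mul, one_mul,
            zero_mul, Finset.sum_ite_eq, Finset.mem_univ, if_true]
  have hmv : (e x).mulVec (fun n => divergence G Fm n x) = 0 := by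
    ext b
    simpa [Matrix.mulVec, dotProduct] using hb b
  have := Matrix.eq_zero_of_mulVec_eq_zero (F.det_e x hx) hmv
  exact congrFun this n

end IsFrame

/-! ### The connection of the Kerr–Newman–(anti) de Sitter metric

The coframe is `α/χ, dr, dc, β/χ` with `c = cos θ`, `α = dv - a sin² θ dφ̄`,
`β = a dv - (r² + a²) dφ̄`. The arguments `u, w, D, P` stand for `1/Σ, 1/P, Δ_r` and
`P = Δ_θ sin² θ`, and `D₁, D₂, P₁, P₂` for the derivatives of `D` and `P`. -/

/-- The metric in the frame. -/
def frameMetric (S u w D P : ℝ) : Mat :=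
  !![-(D * u), 1, 0, 0; 1, 0, 0, 0; 0, 0, S * w, 0; 0, 0, 0, P * u]

/-- The inverse metric in the frame. -/
def frameMetricInv (S u w D P : ℝ) : Mat :=
  !![0, 1, 0, 0; 1, D * u, 0, 0; 0, 0, P * u, 0; 0, 0, 0, S * w]

/-- The `α/χ` component of the connection in the frame. -/
def connA (a r c u w D D1 P : ℝ) : Mat :=
  !![-(r * u ^ 2 * D) + (1 / 2) * u * D1, 0, a ^ 2 * c * u, a * r * u ^ 2 * P;
       -(r * u ^ 3 * D ^ 2) + (1 / 2) * u ^ 2 * D * D1, r * u ^ 2 * D - (1 / 2) * u * D1, 0, a * r * u ^ 3 * P * D;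
       a ^ 2 * c * u ^ 3 * P * D, -(a ^ 2 * c * u ^ 2 * P), 0, -(a * c * u ^ 3 * P * D);
       0, -(a * r * u), a * c * u * w * D, 0]

/-- The `dr` component of the connection in the frame. -/
def connR (a r c u w D D1 P : ℝ) : Mat :=
  !![0, 0, 0, 0;
       r * u ^ 2 * D - (1 / 2) * u * D1, 0, a ^ 2 * c * u, -(a * r * u ^ 2 * P);
       -(a ^ 2 * c * u ^ 2 * P), 0, r * u, a * c * u ^ 2 * P;
       a * r * u, 0, -(a * c * w), -(r * u)]

/-- The `dc` component of the connection in the frame. -/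
def connC (a r c u w D P1 : ℝ) : Mat :=
  !![-(a ^ 2 * c * u), 0, -(r * w), a * c * u;
       0, a ^ 2 * c * u, -(r * u * w * D), 0;
       0, r * u, a ^ 2 * c * u - (1 / 2) * w * P1, 0;
       a * c * u * w * D, -(a * c * w), 0, -(a ^ 2 * c * u) + (1 / 2) * w * P1]

/-- The `β/χ` component of the connection in the frame. -/
def connB (a r c u w D P P1 : ℝ) : Mat :=
  !![a * r * u ^ 2 * P, 0, -(a * c * u), -(r * u ^ 2 * P);
       a * r * u ^ 3 * P * D, -(a * r * u ^ 2 * P), 0, -(r * u ^ 3 * P * D);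
       -(a * c * u ^ 3 * P * D), a * c * u ^ 2 * P, 0, a ^ 2 * c * u ^ 3 * P ^ 2 - (1 / 2) * u ^ 2 * P * P1;
       0, r * u, -(a ^ 2 * c * u) + (1 / 2) * w * P1, 0]

/-- The connection in the frame. -/
def frameConn (a r c u w D D1 P P1 : ℝ) : Fin 4 → Mat :=
  ![connA a r c u w D D1 P,
    connR a r c u w D D1 P,
    connC a r c u w D P1,
    connB a r c u w D P P1]

/-- The `α/χ` component of the derivative of the connection with respect to `r`. -/
def connADr (a r c u w D D1 D2 P : ℝ) : Mat :=
  !![4 * r ^ 2 * u ^ 3 * D - 2 * r * u ^ 2 * D1 + (1 / 2) * u * D2 - u ^ 2 * D, 0, -(2 * a ^ 2 * c * r * u ^ 2), -(4 * a * r ^ 2 * u ^ 3 * P) + a * u ^ 2 * P;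
       6 * r ^ 2 * u ^ 4 * D ^ 2 - 4 * r * u ^ 3 * D * D1 + (1 / 2) * u ^ 2 * D * D2 + (1 / 2) * u ^ 2 * D1 ^ 2 - u ^ 3 * D ^ 2, -(4 * r ^ 2 * u ^ 3 * D) + 2 * r * u ^ 2 * D1 - (1 / 2) * u * D2 + u ^ 2 * D, 0, -(6 * a * r ^ 2 * u ^ 4 * P * D) + a * r * u ^ 3 * P * D1 + a * u ^ 3 * P * D;
       -(6 * a ^ 2 * c * r * u ^ 4 * P * D) + a ^ 2 * c * u ^ 3 * P * D1, 4 * a ^ 2 * c * r * u ^ 3 * P, 0, 6 * a * c * r * u ^ 4 * P * D - a * c * u ^ 3 * P * D1;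
       0, 2 * a * r ^ 2 * u ^ 2 - a * u, -(2 * a * c * r * u ^ 2 * w * D) + a * c * u * w * D1, 0]

/-- The `dr` component of the derivative of the connection with respect to `r`. -/
def connRDr (a r c u D D1 D2 P : ℝ) : Mat :=
  !![0, 0, 0, 0;
       -(4 * r ^ 2 * u ^ 3 * D) + 2 * r * u ^ 2 * D1 - (1 / 2) * u * D2 + u ^ 2 * D, 0, -(2 * a ^ 2 * c * r * u ^ 2), 4 * a * r ^ 2 * u ^ 3 * P - a * u ^ 2 * P;
       4 * a ^ 2 * c * r * u ^ 3 * P, 0, -(2 * r ^ 2 * u ^ 2) + u, -(4 * a * c * r * u ^ 3 * P);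
       -(2 * a * r ^ 2 * u ^ 2) + a * u, 0, 0, 2 * r ^ 2 * u ^ 2 - u]

/-- The `dc` component of the derivative of the connection with respect to `r`. -/
def connCDr (a r c u w D D1 : ℝ) : Mat :=
  !![2 * a ^ 2 * c * r * u ^ 2, 0, -w, -(2 * a * c * r * u ^ 2);
       0, -(2 * a ^ 2 * c * r * u ^ 2), 2 * r ^ 2 * u ^ 2 * w * D - r * u * w * D1 - u * w * D, 0;
       0, -(2 * r ^ 2 * u ^ 2) + u, -(2 * a ^ 2 * c * r * u ^ 2), 0;
       -(2 * a * c * r * u ^ 2 * w * D) + a * c * u * w * D1, 0, 0, 2 * a ^ 2 * c * r * u ^ 2]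

/-- The `β/χ` component of the derivative of the connection with respect to `r`. -/
def connBDr (a r c u D D1 P P1 : ℝ) : Mat :=
  !![-(4 * a * r ^ 2 * u ^ 3 * P) + a * u ^ 2 * P, 0, 2 * a * c * r * u ^ 2, 4 * r ^ 2 * u ^ 3 * P - u ^ 2 * P;
       -(6 * a * r ^ 2 * u ^ 4 * P * D) + a * r * u ^ 3 * P * D1 + a * u ^ 3 * P * D, 4 * a * r ^ 2 * u ^ 3 * P - a * u ^ 2 * P, 0, 6 * r ^ 2 * u ^ 4 * P * D - r * u ^ 3 * P * D1 - u ^ 3 * P * D;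
       6 * a * c * r * u ^ 4 * P * D - a * c * u ^ 3 * P * D1, -(4 * a * c * r * u ^ 3 * P), 0, -(6 * a ^ 2 * c * r * u ^ 4 * P ^ 2) + 2 * r * u ^ 3 * P * P1;
       0, -(2 * r ^ 2 * u ^ 2) + u, 2 * a ^ 2 * c * r * u ^ 2, 0]

/-- The derivative of the connection with respect to `r`. -/
def frameConnDr (a r c u w D D1 D2 P P1 : ℝ) : Fin 4 → Mat :=
  ![connADr a r c u w D D1 D2 P,
    connRDr a r c u D D1 D2 P,
    connCDr a r c u w D D1,
    connBDr a r c u D D1 P P1]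

/-- The `α/χ` component of the derivative of the connection with respect to `c`. -/
def connADc (a r c u w D D1 P P1 : ℝ) : Mat :=
  !![4 * a ^ 2 * c * r * u ^ 3 * D - a ^ 2 * c * u ^ 2 * D1, 0, -(2 * a ^ 4 * c ^ 2 * u ^ 2) + a ^ 2 * u, -(4 * a ^ 3 * c * r * u ^ 3 * P) + a * r * u ^ 2 * P1;
       6 * a ^ 2 * c * r * u ^ 4 * D ^ 2 - 2 * a ^ 2 * c * u ^ 3 * D * D1, -(4 * a ^ 2 * c * r * u ^ 3 * D) + a ^ 2 * c * u ^ 2 * D1, 0, -(6 * a ^ 3 * c * r * u ^ 4 * P * D) + a * r * u ^ 3 * P1 * D;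
       -(6 * a ^ 4 * c ^ 2 * u ^ 4 * P * D) + a ^ 2 * c * u ^ 3 * P1 * D + a ^ 2 * u ^ 3 * P * D, 4 * a ^ 4 * c ^ 2 * u ^ 3 * P - a ^ 2 * c * u ^ 2 * P1 - a ^ 2 * u ^ 2 * P, 0, 6 * a ^ 3 * c ^ 2 * u ^ 4 * P * D - a * c * u ^ 3 * P1 * D - a * u ^ 3 * P * D;
       0, 2 * a ^ 3 * c * r * u ^ 2, -(2 * a ^ 3 * c ^ 2 * u ^ 2 * w * D) - a * c * u * w ^ 2 * P1 * D + a * u * w * D, 0]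

/-- The `dr` component of the derivative of the connection with respect to `c`. -/
def connRDc (a r c u w D D1 P P1 : ℝ) : Mat :=
  !![0, 0, 0, 0;
       -(4 * a ^ 2 * c * r * u ^ 3 * D) + a ^ 2 * c * u ^ 2 * D1, 0, -(2 * a ^ 4 * c ^ 2 * u ^ 2) + a ^ 2 * u, 4 * a ^ 3 * c * r * u ^ 3 * P - a * r * u ^ 2 * P1;
       4 * a ^ 4 * c ^ 2 * u ^ 3 * P - a ^ 2 * c * u ^ 2 * P1 - a ^ 2 * u ^ 2 * P, 0, -(2 * a ^ 2 * c * r * u ^ 2), -(4 * a ^ 3 * c ^ 2 * u ^ 3 * P) + a * c * u ^ 2 * P1 + a * u ^ 2 * P;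
       -(2 * a ^ 3 * c * r * u ^ 2), 0, a * c * w ^ 2 * P1 - a * w, 2 * a ^ 2 * c * r * u ^ 2]

/-- The `dc` component of the derivative of the connection with respect to `c`. -/
def connCDc (a r c u w D P1 P2 : ℝ) : Mat :=
  !![2 * a ^ 4 * c ^ 2 * u ^ 2 - a ^ 2 * u, 0, r * w ^ 2 * P1, -(2 * a ^ 3 * c ^ 2 * u ^ 2) + a * u;
       0, -(2 * a ^ 4 * c ^ 2 * u ^ 2) + a ^ 2 * u, 2 * a ^ 2 * c * r * u ^ 2 * w * D + r * u * w ^ 2 * P1 * D, 0;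
       0, -(2 * a ^ 2 * c * r * u ^ 2), -(2 * a ^ 4 * c ^ 2 * u ^ 2) + a ^ 2 * u - (1 / 2) * w * P2 + (1 / 2) * w ^ 2 * P1 ^ 2, 0;
       -(2 * a ^ 3 * c ^ 2 * u ^ 2 * w * D) - a * c * u * w ^ 2 * P1 * D + a * u * w * D, a * c * w ^ 2 * P1 - a * w, 0, 2 * a ^ 4 * c ^ 2 * u ^ 2 - a ^ 2 * u + (1 / 2) * w * P2 - (1 / 2) * w ^ 2 * P1 ^ 2]

/-- The `β/χ` component of the derivative of the connection with respect to `c`. -/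
def connBDc (a r c u w D P P1 P2 : ℝ) : Mat :=
  !![-(4 * a ^ 3 * c * r * u ^ 3 * P) + a * r * u ^ 2 * P1, 0, 2 * a ^ 3 * c ^ 2 * u ^ 2 - a * u, 4 * a ^ 2 * c * r * u ^ 3 * P - r * u ^ 2 * P1;
       -(6 * a ^ 3 * c * r * u ^ 4 * P * D) + a * r * u ^ 3 * P1 * D, 4 * a ^ 3 * c * r * u ^ 3 * P - a * r * u ^ 2 * P1, 0, 6 * a ^ 2 * c * r * u ^ 4 * P * D - r * u ^ 3 * P1 * D;
       6 * a ^ 3 * c ^ 2 * u ^ 4 * P * D - a * c * u ^ 3 * P1 * D - a * u ^ 3 * P * D, -(4 * a ^ 3 * c ^ 2 * u ^ 3 * P) + a * c * u ^ 2 * P1 + a * u ^ 2 * P, 0, -(6 * a ^ 4 * c ^ 2 * u ^ 4 * P ^ 2) + 4 * a ^ 2 * c * u ^ 3 * P * P1 + a ^ 2 * u ^ 3 * P ^ 2 - (1 / 2) * u ^ 2 * P * P2 - (1 / 2) * u ^ 2 * P1 ^ 2;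
       0, -(2 * a ^ 2 * c * r * u ^ 2), 2 * a ^ 4 * c ^ 2 * u ^ 2 - a ^ 2 * u + (1 / 2) * w * P2 - (1 / 2) * w ^ 2 * P1 ^ 2, 0]

/-- The derivative of the connection with respect to `c`. -/
def frameConnDc (a r c u w D D1 P P1 P2 : ℝ) : Fin 4 → Mat :=
  ![connADc a r c u w D D1 P P1,
    connRDc a r c u w D D1 P P1,
    connCDc a r c u w D P1 P2,
    connBDc a r c u w D P P1 P2]



/-- The derivatives of the connection along the frame. -/
def frameConnD (a r c u w D D1 D2 P P1 P2 : ℝ) (l k : Fin 4) : Mat :=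
  (![0, frameConnDr a r c u w D D1 D2 P P1 k, frameConnDc a r c u w D D1 P P1 P2 k, 0] :
    Fin 4 → Mat) l

/-- The electromagnetic field in the frame. -/
def frameField (a r c u Q : ℝ) : Mat :=
  !![0, Q * (r ^ 2 - a ^ 2 * c ^ 2) * u ^ 2, 0, 0;
     -(Q * (r ^ 2 - a ^ 2 * c ^ 2) * u ^ 2), 0, 0, 0;
     0, 0, 0, -(2 * a * c * Q * r * u ^ 2);
     0, 0, 2 * a * c * Q * r * u ^ 2, 0]

/-! ### The Ricci tensor in the Kerr frame -/

section Algebra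

variable {a r c lam M Q S u w D D1 D2 P P1 P2 : ℝ}

set_option maxHeartbeats 4000000 in
-- The cosmological and charge terms come from the explicit forms of `Δ_r` and `P`; the mass drops
-- out. The second summand is trace-free and will be recognised as the Maxwell stress.
theorem frame_ricci (hS : S = r ^ 2 + a ^ 2 * c ^ 2)
    (hu : S * u = 1) (hw : P * w = 1)
    (hD : D = (1 - lam * r ^ 2) * (r ^ 2 + a ^ 2) - 2 * M * r + Q ^ 2)
    (hD1 : D1 = -(2 * lam * r * (r ^ 2 + a ^ 2)) + (1 - lam * r ^ 2) * (2 * r) - 2 * M)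
    (hD2 : D2 = 2 - 2 * lam * a ^ 2 - 12 * lam * r ^ 2)
    (hP : P = (1 + lam * a ^ 2 * c ^ 2) * (1 - c ^ 2))
    (hP1 : P1 = 2 * lam * a ^ 2 * c * (1 - c ^ 2) - 2 * c * (1 + lam * a ^ 2 * c ^ 2))
    (hP2 : P2 = 2 * lam * a ^ 2 - 2 - 12 * lam * a ^ 2 * c ^ 2) :
    ricciContr (frameCurv (frameConn a r c u w D D1 P P1)
      (frameConnD a r c u w D D1 D2 P P1 P2))
      = (3 * lam) • frameMetric S u w D P +
        (Q ^ 2 * u ^ 2) • !![D * u, -1, 0, 0; -1, 0, 0, 0; 0, 0, S * w, 0; 0, 0, 0, P * u] := by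
  have hS0 : S ≠ 0 := left_ne_zero_of_mul_eq_one hu
  have hP0 : P ≠ 0 := left_ne_zero_of_mul_eq_one hw
  -- Only the reciprocals are eliminated now. `S`, `P`, `D` and the derivatives stay letters while
  -- denominators are cleared; the explicit polynomials enter just before the final ring identity.
  obtain rfl : u = 1 / S := by field_simp; linarith
  obtain rfl : w = 1 / P := by field_simp; linarith
  ext j q
  fin_cases j <;> fin_cases q <;>
    simp only [ricciContr, frameCurv, Matrix.mul_apply, Fin.sum_univ_four, Matrix.of_apply,
      Matrix.add_apply, Matrix.sub_apply, Matrix.smul_apply, smul_eq_mul, Fin.zero_eta, Fin.mk_one,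
      Fin.reduceFinMk] <;>
    simp only [frameMetric, frameConnD, frameConn, frameConnDr, frameConnDc, connA, connR, connC,
      connB, connADr, connRDr, connCDr, connBDr, connADc, connRDc, connCDc, connBDc,
      Matrix.cons_val, Matrix.of_apply, Matrix.zero_apply, mul_zero, zero_mul, add_zero, zero_add,
      sub_zero, zero_sub] <;>
    field_simp <;> subst hS hD hD1 hD2 hP hP1 hP2 <;> ring
end Algebra
-- The curvature where `a cos θ = 0`
section Kretschmann

theorem frameCurv_swap (γ : Fin 4 → Mat) (D : Fin 4 → Fin 4 → Mat) (p q : Fin 4) :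
    frameCurv γ D q p = -frameCurv γ D p q := by
  have : ∑ k, (γ p k q - γ q k p) • γ k = -∑ k, (γ q k p - γ p k q) • γ k := by
    rw [← Finset.sum_neg_distrib]
    exact Finset.sum_congr rfl fun k _ => by rw [← neg_smul, neg_sub]
  rw [frameCurv, frameCurv, this]
  abel

variable {a r c lam M Q S u w D D1 D2 P P1 P2 : ℝ}

set_option maxHeartbeats 4000000 in
/-- The curvature where `a cos θ = 0`. -/
theorem frameCurv_of_mul_eq_zero (hac : a * c = 0) (hS : S = r ^ 2 + a ^ 2 * c ^ 2)
    (hu : S * u = 1) (hw : P * w = 1)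
    (hD : D = (1 - lam * r ^ 2) * (r ^ 2 + a ^ 2) - 2 * M * r + Q ^ 2)
    (hD1 : D1 = -(2 * lam * r * (r ^ 2 + a ^ 2)) + (1 - lam * r ^ 2) * (2 * r) - 2 * M)
    (hD2 : D2 = 2 - 2 * lam * a ^ 2 - 12 * lam * r ^ 2)
    (hP : P = (1 + lam * a ^ 2 * c ^ 2) * (1 - c ^ 2))
    (hP1 : P1 = 2 * lam * a ^ 2 * c * (1 - c ^ 2) - 2 * c * (1 + lam * a ^ 2 * c ^ 2))
    (hP2 : P2 = 2 * lam * a ^ 2 - 2 - 12 * lam * a ^ 2 * c ^ 2)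
    {α E β : ℝ} (hα : α = 2 * M / r ^ 3 - 3 * Q ^ 2 / r ^ 4 + lam)
    (hE : E = -(M / r ^ 3) + Q ^ 2 / r ^ 4 + lam) (hβ : β = 2 * M / r ^ 3 - Q ^ 2 / r ^ 4 + lam)
    {Ω : Fin 4 → Fin 4 → Mat} (hΩ : Ω = frameCurv (frameConn a r c u w D D1 P P1)
      (frameConnD a r c u w D D1 D2 P P1 P2)) :
    Ω 0 1 = !![α, 0, 0, 0; α * D * u, -α, 0, 0; 0, 0, 0, 0; 0, 0, 0, 0] ∧
    Ω 0 2 = !![0, 0, E * S * w, 0; 0, 0, 0, 0; E * D * u, -E, 0, 0; 0, 0, 0, 0] ∧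
    Ω 0 3 = !![0, 0, 0, E * P * u; 0, 0, 0, 0; 0, 0, 0, 0; E * D * u, -E, 0, 0] ∧
    Ω 1 2 = !![0, 0, 0, 0; 0, 0, E * S * w, 0; -E, 0, 0, 0; 0, 0, 0, 0] ∧
    Ω 1 3 = !![0, 0, 0, 0; 0, 0, 0, E * P * u; 0, 0, 0, 0; -E, 0, 0, 0] ∧
    Ω 2 3 = !![0, 0, 0, 0; 0, 0, 0, 0; 0, 0, 0, β * P * u; 0, 0, -(β * S * w), 0] := by
  have hS0 : S ≠ 0 := left_ne_zero_of_mul_eq_one hu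
  have hP0 : P ≠ 0 := left_ne_zero_of_mul_eq_one hw
  -- With `a c = 0` the function `Σ` is `r²`, so regularity of the point means `r ≠ 0`.
  have hr : r ≠ 0 := by
    rintro rfl
    apply hS0
    rw [hS, ← mul_pow, hac]; norm_num
  obtain rfl : u = 1 / S := by field_simp; linarith
  obtain rfl : w = 1 / P := by field_simp; linarith
  clear hu hw
  obtain rfl : S = r ^ 2 := by rw [hS, ← mul_pow, hac]; ring
  clear hS
  subst hΩ hα hE hβ
  -- Either `a = 0`, where `Δ_θ = 1` and `P = 1 - c²`, or `c = 0`, where `P = 1` and its derivative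
  -- vanishes. In both cases the table reduces to rational identities.
  rcases mul_eq_zero.1 hac with rfl | rfl
  · obtain rfl : P = 1 - c ^ 2 := by rw [hP]; ring
    obtain rfl : P1 = -(2 * c) := by rw [hP1]; ring
    obtain rfl : P2 = -2 := by rw [hP2]; ring
    clear hac hP hP1 hP2
    refine ⟨?_, ?_, ?_, ?_, ?_, ?_⟩ <;> ext i j <;> fin_cases i <;> fin_cases j <;>
      simp only [frameCurv, Matrix.mul_apply, Fin.sum_univ_four, Matrix.of_apply,
        Matrix.add_apply, Matrix.sub_apply, Matrix.smul_apply, smul_eq_mul, Fin.zero_eta,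
        Fin.mk_one, Fin.reduceFinMk] <;>
      simp only [frameConnD, frameConn, frameConnDr, frameConnDc, connA, connR, connC,
        connB, connADr, connRDr, connCDr, connBDr, connADc, connRDc, connCDc, connBDc,
        Matrix.cons_val, Matrix.of_apply, Matrix.zero_apply, mul_zero, zero_mul, add_zero, zero_add,
        sub_zero, zero_sub, neg_zero, ne_eq, OfNat.ofNat_ne_zero, not_false_eq_true, zero_pow,
        sub_self] <;>
      field_simp <;> (try subst hD hD1 hD2) <;> ring
  · obtain rfl : P = 1 := by rw [hP]; ring
    obtain rfl : P1 = 0 := by rw [hP1]; ring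
    clear hac hP hP1
    refine ⟨?_, ?_, ?_, ?_, ?_, ?_⟩ <;> ext i j <;> fin_cases i <;> fin_cases j <;>
      simp only [frameCurv, Matrix.mul_apply, Fin.sum_univ_four, Matrix.of_apply,
        Matrix.add_apply, Matrix.sub_apply, Matrix.smul_apply, smul_eq_mul, Fin.zero_eta,
        Fin.mk_one, Fin.reduceFinMk] <;>
      simp only [frameConnD, frameConn, frameConnDr, frameConnDc, connA, connR, connC,
        connB, connADr, connRDr, connCDr, connBDr, connADc, connRDc, connCDc, connBDc,
        Matrix.cons_val, Matrix.of_apply, Matrix.zero_apply, mul_zero, zero_mul, add_zero, zero_add,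
        sub_zero, zero_sub, neg_zero, ne_eq, OfNat.ofNat_ne_zero, not_false_eq_true, zero_pow,
        sub_self] <;>
      field_simp <;> (try subst hD hD1 hD2 hP2) <;> ring
end Kretschmann

/-! ### Inverse metric, Maxwell stress and the quadratic curvature invariant -/

section Algebra

variable {S u w D P Q a r c : ℝ}

theorem frameMetric_inv (hu : S * u = 1) (hw : P * w = 1) :
    (frameMetric S u w D P)⁻¹ = frameMetricInv S u w D P := by
  apply Matrix.inv_eq_right_inv
  ext i j
  fin_cases i <;> fin_cases j <;>
    simp [frameMetric, frameMetricInv, Matrix.mul_apply, Fin.sum_univ_four]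
  · linear_combination (P * w) * hu + hw
  · linear_combination (P * w) * hu + hw

theorem frameMetric_det (hu : S * u = 1) (hw : P * w = 1) :
    (frameMetric S u w D P).det ≠ 0 := by
  have h : frameMetric S u w D P * frameMetricInv S u w D P = 1 := by
    ext i j
    fin_cases i <;> fin_cases j <;>
      simp [frameMetric, frameMetricInv, Matrix.mul_apply, Fin.sum_univ_four]
    · linear_combination (P * w) * hu + hw
    · linear_combination (P * w) * hu + hw
  intro h0
  have := congrArg Matrix.det h
  rw [Matrix.det_mul, h0, zero_mul, Matrix.det_one] at this
  exact zero_ne_one this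

theorem frameMetric_symm : (frameMetric S u w D P).transpose = frameMetric S u w D P := by
  ext i j
  fin_cases i <;> fin_cases j <;> rfl

/-- The field with raised indices in the frame. -/
def frameFieldRaised (a r c u Q : ℝ) : Mat :=
  !![0, -(Q * (r ^ 2 - a ^ 2 * c ^ 2) * u ^ 2), 0, 0;
     Q * (r ^ 2 - a ^ 2 * c ^ 2) * u ^ 2, 0, 0, 0;
     0, 0, 0, -(2 * a * c * Q * r * u ^ 2);
     0, 0, 2 * a * c * Q * r * u ^ 2, 0]

theorem frameField_raise (hu : S * u = 1) (hw : P * w = 1) :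
    frameMetricInv S u w D P * frameField a r c u Q * (frameMetricInv S u w D P).transpose
      = frameFieldRaised a r c u Q := by
  have hk : S * w * (P * u) = 1 := by linear_combination (P * w) * hu + hw
  ext i j
  fin_cases i <;> fin_cases j <;>
    simp [frameField, frameFieldRaised, frameMetricInv, Matrix.mul_apply, Fin.sum_univ_four]
  · ring
  · linear_combination (2 * a * c * Q * r * u ^ 2) * hk
  · linear_combination (2 * a * c * Q * r * u ^ 2) * hk

/-- The electric part `Q (r² - a²c²)/Σ²` and the magnetic part `2acQr/Σ²` are the real and imaginary
parts of a complex square: the sum of their squares is `Q²/Σ²`, because `(r² - a²c²)² + (2acr)² =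
Σ²`. Only this sum enters the stress. -/
theorem frameField_stress (hS : S = r ^ 2 + a ^ 2 * c ^ 2) (hu : S * u = 1) (hw : P * w = 1) :
    (2 : ℝ) • ((frameField a r c u Q).transpose * frameMetricInv S u w D P * frameField a r c u Q
      - ((1 / 4) * ∑ i, ∑ j, frameFieldRaised a r c u Q i j * frameField a r c u Q i j) •
        frameMetric S u w D P)
    = (Q ^ 2 * u ^ 2) • !![D * u, -1, 0, 0; -1, 0, 0, 0; 0, 0, S * w, 0; 0, 0, 0, P * u] := by
  have hS0 : S ≠ 0 := left_ne_zero_of_mul_eq_one hu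
  have hP0 : P ≠ 0 := left_ne_zero_of_mul_eq_one hw
  obtain rfl : u = 1 / S := by field_simp; linarith
  obtain rfl : w = 1 / P := by field_simp; linarith
  clear hu hw
  ext i j
  fin_cases i <;> fin_cases j <;>
    simp only [frameField, frameFieldRaised, frameMetric, frameMetricInv, Matrix.mul_apply,
      Fin.sum_univ_four, Matrix.smul_apply, Matrix.sub_apply, Matrix.transpose_apply,
      smul_eq_mul, Fin.zero_eta, Fin.mk_one, Fin.reduceFinMk, Matrix.of_apply, Matrix.cons_val,
      mul_zero, zero_mul, add_zero, zero_add, sub_zero] <;>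
    field_simp <;> subst hS <;> ring

theorem kretschmann_of_table (hu : S * u = 1) (hw : P * w = 1) {α E β : ℝ}
    {Ω : Fin 4 → Fin 4 → Mat} (hanti : ∀ p q, Ω q p = -Ω p q)
    (h01 : Ω 0 1 = !![α, 0, 0, 0; α * D * u, -α, 0, 0; 0, 0, 0, 0; 0, 0, 0, 0])
    (h02 : Ω 0 2 = !![0, 0, E * S * w, 0; 0, 0, 0, 0; E * D * u, -E, 0, 0; 0, 0, 0, 0])
    (h03 : Ω 0 3 = !![0, 0, 0, E * P * u; 0, 0, 0, 0; 0, 0, 0, 0; E * D * u, -E, 0, 0])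
    (h12 : Ω 1 2 = !![0, 0, 0, 0; 0, 0, E * S * w, 0; -E, 0, 0, 0; 0, 0, 0, 0])
    (h13 : Ω 1 3 = !![0, 0, 0, 0; 0, 0, 0, E * P * u; 0, 0, 0, 0; -E, 0, 0, 0])
    (h23 : Ω 2 3 = !![0, 0, 0, 0; 0, 0, 0, 0; 0, 0, 0, β * P * u; 0, 0, -(β * S * w), 0]) :
    kretschmann (frameMetric S u w D P) Ω = -(4 * α ^ 2 + 16 * E ^ 2 + 4 * β ^ 2) := by
  have hd : ∀ p, Ω p p = 0 := fun p => by
    have := hanti p p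
    ext i j
    have h := congrFun (congrFun this i) j
    simp only [Matrix.neg_apply] at h
    simp only [Matrix.zero_apply]
    linarith
  -- The two transverse entries `Σ/P` and `P/Σ` of the metric are inverse to each other; this is the
  -- only relation needed to reduce the invariant to `α`, `E`, `β`.
  have hk : S * w * (P * u) = 1 := by linear_combination (P * w) * hu + hw
  unfold kretschmann
  rw [frameMetric_inv hu hw]
  simp only [Fin.sum_univ_four, hd, hanti 0 1, hanti 0 2, hanti 0 3, hanti 1 2, hanti 1 3,
    hanti 2 3, h01, h02, h03, h12, h13, h23]
  simp only [frameMetricInv, Matrix.trace, Matrix.diag, Matrix.mul_apply, Fin.sum_univ_four,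
    Matrix.of_apply, Matrix.cons_val, Matrix.neg_apply, Matrix.zero_apply, mul_zero, zero_mul,
    add_zero, zero_add, neg_zero, mul_neg, neg_mul, neg_neg]
  linear_combination (-16 * E ^ 2 - 4 * β ^ 2 * (S * w * (P * u) + 1)) * hk

end Algebra
/-! ### First derivatives of composite expressions -/

/-- `f` is differentiable at `x` with partial derivatives `d`. -/
structure Jet (f : Coord → ℝ) (d : Fin 4 → ℝ) (x : Coord) : Prop where
  diff : DifferentiableAt ℝ f x
  pd_eq : ∀ m, pd m f x = d m

namespace Jet

variable {f g : Coord → ℝ} {d d' : Fin 4 → ℝ} {x : Coord}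

theorem congr (h : Jet f d x) (hd : ∀ m, d m = d' m) : Jet f d' x :=
  ⟨h.diff, fun m => (h.pd_eq m).trans (hd m)⟩

theorem const (k : ℝ) : Jet (fun _ => k) (fun _ => 0) x :=
  ⟨differentiableAt_const k, fun m => pd_const k m⟩

theorem add (hf : Jet f d x) (hg : Jet g d' x) : Jet (fun y => f y + g y) (fun m => d m + d' m) x :=
  ⟨hf.diff.fun_add hg.diff, fun m => by rw [pd_add hf.diff hg.diff, hf.pd_eq, hg.pd_eq]⟩

theorem sub (hf : Jet f d x) (hg : Jet g d' x) : Jet (fun y => f y - g y) (fun m => d m - d' m) x :=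
  ⟨hf.diff.fun_sub hg.diff, fun m => by rw [pd_sub hf.diff hg.diff, hf.pd_eq, hg.pd_eq]⟩

theorem mul (hf : Jet f d x) (hg : Jet g d' x) :
    Jet (fun y => f y * g y) (fun m => d m * g x + f x * d' m) x :=
  ⟨hf.diff.fun_mul hg.diff, fun m => by rw [pd_mul hf.diff hg.diff, hf.pd_eq, hg.pd_eq]⟩

theorem comp_one {φ : ℝ → ℝ} {φ' : ℝ} (hf : Jet f d x) (hφ : HasDerivAt φ φ' (f x)) :
    Jet (fun y => φ (f y)) (fun m => φ' * d m) x :=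
  ⟨hφ.differentiableAt.comp x hf.diff, fun m => by rw [pd_comp_one hφ hf.diff, hf.pd_eq]⟩

theorem neg (hf : Jet f d x) : Jet (fun y => -f y) (fun m => -d m) x :=
  (hf.comp_one (hasDerivAt_neg (f x))).congr fun m => by ring

theorem pow (hf : Jet f d x) (n : ℕ) :
    Jet (fun y => f y ^ n) (fun m => n * f x ^ (n - 1) * d m) x :=
  hf.comp_one (hasDerivAt_pow n (f x))

theorem inv (hf : Jet f d x) (h : f x ≠ 0) :
    Jet (fun y => (f y)⁻¹) (fun m => -(d m) * (f x)⁻¹ ^ 2) x :=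
  (hf.comp_one (hasDerivAt_inv h)).congr fun m => by field_simp

theorem of_contDiffOn {U : Set Coord} (hU : IsOpen U) (hx : x ∈ U) (hf : ContDiffOn ℝ ∞ f U) :
    Jet f (fun m => pd m f x) x :=
  ⟨diffAt hU hx hf, fun _ => rfl⟩

end Jet

set_option maxHeartbeats 4000000 in
-- The chain rule for the connection, checking the tables `frameConnDr` and `frameConnDc`. The
-- hypotheses on `u` and `w` are the derivatives of `1/Σ` and `1/P`.
theorem jet_frameConn (a : ℝ) {r c u w D D1 P P1 : Coord → ℝ} {D2 P2 : ℝ} {dr dc : Fin 4 → ℝ}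
    {x : Coord} (hr : Jet r dr x) (hc : Jet c dc x)
    (hu : Jet u (fun m => -(2 * r x * dr m + 2 * a ^ 2 * c x * dc m) * u x ^ 2) x)
    (hw : Jet w (fun m => -(P1 x * dc m) * w x ^ 2) x)
    (hD : Jet D (fun m => D1 x * dr m) x) (hD1 : Jet D1 (fun m => D2 * dr m) x)
    (hP : Jet P (fun m => P1 x * dc m) x) (hP1 : Jet P1 (fun m => P2 * dc m) x)
    (k i j : Fin 4) :
    Jet (fun y => frameConn a (r y) (c y) (u y) (w y) (D y) (D1 y) (P y) (P1 y) k i j)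
      (fun m => dr m * frameConnDr a (r x) (c x) (u x) (w x) (D x) (D1 x) D2 (P x) (P1 x) k i j
        + dc m * frameConnDc a (r x) (c x) (u x) (w x) (D x) (D1 x) (P x) (P1 x) P2 k i j) x := by
  fin_cases k <;> fin_cases i <;> fin_cases j <;>
    simp only [Fin.zero_eta, Fin.mk_one, Fin.reduceFinMk, frameConn, frameConnDr, frameConnDc,
      connA, connR, connC, connB, connADr, connRDr, connCDr, connBDr, connADc, connRDc, connCDc,
      connBDc, Matrix.of_apply, Matrix.cons_val] <;>
    refine Jet.congr (by
      repeat' first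
        | exact hr | exact hc | exact hu | exact hw | exact hD | exact hD1 | exact hP | exact hP1
        | exact Jet.const _ | apply Jet.neg | apply Jet.sub | apply Jet.add | apply Jet.pow
        | apply Jet.mul) (fun m => ?_) <;>
    (try simp only [Nat.add_one_sub_one, Nat.cast_ofNat]) <;> ring

set_option maxHeartbeats 4000000 in
theorem smooth_frameConn (a : ℝ) {r c u w D D1 P P1 : Coord → ℝ} {U : Set Coord}
    (hr : ContDiffOn ℝ ∞ r U) (hc : ContDiffOn ℝ ∞ c U)
    (hu : ContDiffOn ℝ ∞ u U) (hw : ContDiffOn ℝ ∞ w U)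
    (hD : ContDiffOn ℝ ∞ D U) (hD1 : ContDiffOn ℝ ∞ D1 U)
    (hP : ContDiffOn ℝ ∞ P U) (hP1 : ContDiffOn ℝ ∞ P1 U) (k : Fin 4) :
    SmoothMat U fun y => frameConn a (r y) (c y) (u y) (w y) (D y) (D1 y) (P y) (P1 y) k := by
  intro i j
  fin_cases k <;> fin_cases i <;> fin_cases j <;>
    simp only [Fin.zero_eta, Fin.mk_one, Fin.reduceFinMk, frameConn, connA, connR, connC, connB,
      Matrix.of_apply, Matrix.cons_val] <;>
    fun_prop

/-! ### The radial and angular polynomials and their derivatives -/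

namespace Params

variable (p : Params)

/-- The derivative of `Δ_r`. -/
def deltaR' (r : ℝ) : ℝ :=
  -(2 * p.lam * r * (r ^ 2 + p.a ^ 2)) + (1 - p.lam * r ^ 2) * (2 * r) - 2 * p.M

/-- The second derivative of `Δ_r`. -/
def deltaR'' (r : ℝ) : ℝ := 2 - 2 * p.lam * p.a ^ 2 - 12 * p.lam * r ^ 2

/-- `Δ_θ sin² θ` as a function of `c = cos θ`. -/
def pTheta (c : ℝ) : ℝ := (1 + p.lam * p.a ^ 2 * c ^ 2) * (1 - c ^ 2)

/-- The derivative of `pTheta`. -/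
def pTheta' (c : ℝ) : ℝ :=
  2 * p.lam * p.a ^ 2 * c * (1 - c ^ 2) - 2 * c * (1 + p.lam * p.a ^ 2 * c ^ 2)

/-- The second derivative of `pTheta`. -/
def pTheta'' (c : ℝ) : ℝ := 2 * p.lam * p.a ^ 2 - 2 - 12 * p.lam * p.a ^ 2 * c ^ 2

end Params

/-! ### The structure equations and the Maxwell equations in the Kerr frame -/

section Algebra

variable {a r c S u w D D1 P P1 : ℝ}

/-- The right-hand side lists the derivatives of the frame metric along the dual frame: the `r`- and
`c`-derivatives of its entries, and zero in the other two directions since the entries depend on `r`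
and `c` only. -/
theorem frameConn_compat (hS : S * u = 1) (hw : P * w = 1) (k : Fin 4) :
    frameMetric S u w D P * frameConn a r c u w D D1 P P1 k
      + (frameConn a r c u w D D1 P P1 k).transpose * frameMetric S u w D P
    = (![0, !![-(D1 * u) + 2 * r * D * u ^ 2, 0, 0, 0; 0, 0, 0, 0; 0, 0, 2 * r * w, 0;
          0, 0, 0, -(2 * r * P * u ^ 2)],
        !![2 * a ^ 2 * c * D * u ^ 2, 0, 0, 0; 0, 0, 0, 0;
          0, 0, 2 * a ^ 2 * c * w - S * P1 * w ^ 2, 0;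
          0, 0, 0, P1 * u - 2 * a ^ 2 * c * P * u ^ 2], 0] : Fin 4 → Mat) k := by
  have hS0 : S ≠ 0 := left_ne_zero_of_mul_eq_one hS
  have hP0 : P ≠ 0 := left_ne_zero_of_mul_eq_one hw
  obtain rfl : u = 1 / S := by field_simp; linarith
  obtain rfl : w = 1 / P := by field_simp; linarith
  clear hS hw
  ext i j
  fin_cases k <;> fin_cases i <;> fin_cases j <;>
    simp only [Fin.zero_eta, Fin.mk_one, Fin.reduceFinMk, frameConn, connA, connR, connC, connB,
      frameMetric, Matrix.add_apply, Matrix.transpose_apply, Matrix.mul_apply, Fin.sum_univ_four,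
      Matrix.of_apply, Matrix.cons_val, Matrix.zero_apply, mul_zero, zero_mul, add_zero, zero_add,
      mul_one, one_mul] <;>
    field_simp <;> ring

/-- The right-hand side is the exterior derivative of the coframe: `dα = 2ac dc ∧ dφ̄` and `dβ = -2r
dr ∧ dφ̄`, with `dφ̄` expressed through `aα - β = Σ dφ̄`. -/
theorem frameConn_torsion (hS : S * u = 1) (hw : P * w = 1) (k : Fin 4) (v v' : Fin 4 → ℝ) :
    ∑ p, ∑ q, v p * v' q * (frameConn a r c u w D D1 P P1 q k p
      - frameConn a r c u w D D1 P P1 p k q)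
    = (![2 * a * c * u * (v 2 * (a * v' 0 - v' 3) - v' 2 * (a * v 0 - v 3)), 0, 0,
        -(2 * r * u * (v 1 * (a * v' 0 - v' 3) - v' 1 * (a * v 0 - v 3)))] : Fin 4 → ℝ) k := by
  have hS0 : S ≠ 0 := left_ne_zero_of_mul_eq_one hS
  have hP0 : P ≠ 0 := left_ne_zero_of_mul_eq_one hw
  obtain rfl : u = 1 / S := by field_simp; linarith
  obtain rfl : w = 1 / P := by field_simp; linarith
  clear hS hw
  fin_cases k <;>
    simp only [Fin.zero_eta, Fin.mk_one, Fin.reduceFinMk, frameConn, connA, connR, connC, connB,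
      Fin.sum_univ_four, Matrix.of_apply, Matrix.cons_val] <;>
    field_simp <;> ring

/-- The derivative of `frameFieldRaised` with respect to `r`. -/
def frameFieldRaisedDr (a r c u Q : ℝ) : Mat :=
  let q := Q * (2 * r * u ^ 2 - 4 * r * (r ^ 2 - a ^ 2 * c ^ 2) * u ^ 3)
  let k := 2 * a * c * Q * (u ^ 2 - 4 * r ^ 2 * u ^ 3)
  !![0, -q, 0, 0; q, 0, 0, 0; 0, 0, 0, -k; 0, 0, k, 0]

/-- The derivative of `frameFieldRaised` with respect to `c`. -/
def frameFieldRaisedDc (a r c u Q : ℝ) : Mat :=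
  let q := Q * (-(2 * a ^ 2 * c * u ^ 2) - 4 * a ^ 2 * c * (r ^ 2 - a ^ 2 * c ^ 2) * u ^ 3)
  let k := 2 * a * Q * r * (u ^ 2 - 4 * a ^ 2 * c ^ 2 * u ^ 3)
  !![0, -q, 0, 0; q, 0, 0, 0; 0, 0, 0, -k; 0, 0, k, 0]

theorem frameField_div (hS : S = r ^ 2 + a ^ 2 * c ^ 2) (hu : S * u = 1) (hw : P * w = 1) (Q : ℝ)
    (b : Fin 4) :
    ∑ l, ((![0, frameFieldRaisedDr a r c u Q, frameFieldRaisedDc a r c u Q, 0] : Fin 4 → Mat) l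
      + frameConn a r c u w D D1 P P1 l * frameFieldRaised a r c u Q
      + frameFieldRaised a r c u Q * (frameConn a r c u w D D1 P P1 l).transpose) l b = 0 := by
  have hS0 : S ≠ 0 := left_ne_zero_of_mul_eq_one hu
  have hP0 : P ≠ 0 := left_ne_zero_of_mul_eq_one hw
  obtain rfl : u = 1 / S := by field_simp; linarith
  obtain rfl : w = 1 / P := by field_simp; linarith
  clear hu hw
  fin_cases b <;>
    simp only [Fin.zero_eta, Fin.mk_one, Fin.reduceFinMk, frameConn, connA, connR, connC, connB,
      frameFieldRaised, frameFieldRaisedDr, frameFieldRaisedDc, Matrix.add_apply,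
      Matrix.transpose_apply, Matrix.mul_apply, Fin.sum_univ_four,
      Matrix.of_apply, Matrix.cons_val, Matrix.zero_apply, mul_zero, zero_mul, add_zero, zero_add] <;>
    field_simp <;> subst hS <;> ring

end Algebra

theorem jet_frameFieldRaised (a Q : ℝ) {r c u : Coord → ℝ} {dr dc : Fin 4 → ℝ}
    {x : Coord} (hr : Jet r dr x) (hc : Jet c dc x)
    (hu : Jet u (fun m => -(2 * r x * dr m + 2 * a ^ 2 * c x * dc m) * u x ^ 2) x) (i j : Fin 4) :
    Jet (fun y => frameFieldRaised a (r y) (c y) (u y) Q i j)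
      (fun m => dr m * frameFieldRaisedDr a (r x) (c x) (u x) Q i j
        + dc m * frameFieldRaisedDc a (r x) (c x) (u x) Q i j) x := by
  fin_cases i <;> fin_cases j <;>
    simp only [Fin.zero_eta, Fin.mk_one, Fin.reduceFinMk, frameFieldRaised, frameFieldRaisedDr,
      frameFieldRaisedDc, Matrix.of_apply, Matrix.cons_val] <;>
    refine Jet.congr (by
      repeat' first
        | exact hr | exact hc | exact hu
        | exact Jet.const _ | apply Jet.neg | apply Jet.sub | apply Jet.add | apply Jet.pow
        | apply Jet.mul) (fun m => ?_) <;>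
    (try simp only [Nat.add_one_sub_one, Nat.cast_ofNat]) <;> ring

/-! ### The field equations for a coframe of Kerr type -/

/-- The rows of `e` are a coframe on `U` with the exterior derivatives of the coframe
`α/χ, dr, dc, β/χ` of the Kerr–Newman–(anti) de Sitter metric. -/
structure KerrCoframe (p : Params) (U : Set Coord) (r c : Coord → ℝ) (e : Coord → Mat) : Prop where
  isOpen : IsOpen U
  smooth_r : ContDiffOn ℝ ∞ r U
  smooth_c : ContDiffOn ℝ ∞ c U
  smooth_e : SmoothMat U e
  sigma_ne : ∀ y ∈ U, p.sigma (r y) (c y) ≠ 0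
  pTheta_ne : ∀ y ∈ U, p.pTheta (c y) ≠ 0
  det_e : ∀ y ∈ U, (e y).det ≠ 0
  row_one : ∀ y ∈ U, ∀ m, e y 1 m = pd m r y
  row_two : ∀ y ∈ U, ∀ m, e y 2 m = pd m c y
  d_zero : ∀ y ∈ U, ∀ m n, pd m (fun z => e z 0 n) y - pd n (fun z => e z 0 m) y
    = 2 * p.a * c y * (p.sigma (r y) (c y))⁻¹ * (e y 2 m * (p.a * e y 0 n - e y 3 n)
      - e y 2 n * (p.a * e y 0 m - e y 3 m))
  d_three : ∀ y ∈ U, ∀ m n, pd m (fun z => e z 3 n) y - pd n (fun z => e z 3 m) y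
    = -(2 * r y * (p.sigma (r y) (c y))⁻¹ * (e y 1 m * (p.a * e y 0 n - e y 3 n)
      - e y 1 n * (p.a * e y 0 m - e y 3 m)))

namespace Params

variable (p : Params)

/-- The metric in the frame, as a function of `r` and `c = cos θ`. -/
def hFrame (r c : ℝ) : Mat :=
  frameMetric (p.sigma r c) (p.sigma r c)⁻¹ (p.pTheta c)⁻¹ (p.deltaR r) (p.pTheta c)

/-- The connection in the frame, as a function of `r` and `c = cos θ`. -/
def gammaFrame (k : Fin 4) (r c : ℝ) : Mat :=
  frameConn p.a r c (p.sigma r c)⁻¹ (p.pTheta c)⁻¹ (p.deltaR r) (p.deltaR' r) (p.pTheta c)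
    (p.pTheta' c) k

/-- The derivative of the connection in the frame along the frame. -/
def gammaFrameD (l k : Fin 4) (r c : ℝ) : Mat :=
  frameConnD p.a r c (p.sigma r c)⁻¹ (p.pTheta c)⁻¹ (p.deltaR r) (p.deltaR' r) (p.deltaR'' r)
    (p.pTheta c) (p.pTheta' c) (p.pTheta'' c) l k

/-- The electromagnetic field in the frame. -/
def fieldFrame (r c : ℝ) : Mat := frameField p.a r c (p.sigma r c)⁻¹ p.Q

theorem hasDerivAt_deltaR (r : ℝ) : HasDerivAt p.deltaR (p.deltaR' r) r := by
  have h := ((((hasDerivAt_pow 2 r).const_mul p.lam).const_sub 1).mul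
    ((hasDerivAt_pow 2 r).add_const (p.a ^ 2))).sub ((hasDerivAt_id r).const_mul (2 * p.M))
  refine (h.add_const (p.Q ^ 2)).congr_deriv ?_
  simp only [deltaR', Nat.cast_ofNat, Nat.add_one_sub_one, pow_one]; ring

theorem hasDerivAt_deltaR' (r : ℝ) : HasDerivAt p.deltaR' (p.deltaR'' r) r := by
  have h := ((((hasDerivAt_id r).const_mul (2 * p.lam)).mul
    ((hasDerivAt_pow 2 r).add_const (p.a ^ 2))).neg).add
    ((((hasDerivAt_pow 2 r).const_mul p.lam).const_sub 1).mul ((hasDerivAt_id r).const_mul 2))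
  refine (h.sub_const (2 * p.M)).congr_deriv ?_
  simp [deltaR'']; ring

theorem hasDerivAt_pTheta (c : ℝ) : HasDerivAt p.pTheta (p.pTheta' c) c := by
  have h := (((hasDerivAt_pow 2 c).const_mul (p.lam * p.a ^ 2)).const_add 1).mul
    ((hasDerivAt_pow 2 c).const_sub 1)
  refine h.congr_deriv ?_
  simp [pTheta']; ring

theorem hasDerivAt_pTheta' (c : ℝ) : HasDerivAt p.pTheta' (p.pTheta'' c) c := by
  have h := (((hasDerivAt_id c).const_mul (2 * p.lam * p.a ^ 2)).mul
    ((hasDerivAt_pow 2 c).const_sub 1)).sub (((hasDerivAt_id c).const_mul 2).mul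
    (((hasDerivAt_pow 2 c).const_mul (p.lam * p.a ^ 2)).const_add 1))
  refine h.congr_deriv ?_
  simp [pTheta'']; ring

end Params

namespace Params

variable (p : Params) {r c : ℝ}

theorem ricci_frame' (hσ : p.sigma r c ≠ 0) (hP : p.pTheta c ≠ 0) :
    ricciContr (frameCurv (fun k => p.gammaFrame k r c) (fun k l => p.gammaFrameD k l r c))
      = p.Λ • p.hFrame r c + (p.Q ^ 2 * (p.sigma r c)⁻¹ ^ 2) •
        !![p.deltaR r * (p.sigma r c)⁻¹, -1, 0, 0; -1, 0, 0, 0;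
          0, 0, p.sigma r c * (p.pTheta c)⁻¹, 0; 0, 0, 0, p.pTheta c * (p.sigma r c)⁻¹] := by
  have hΛ : p.Λ = 3 * p.lam := by simp [Params.lam]; ring
  rw [hΛ]
  exact frame_ricci rfl (mul_inv_cancel₀ hσ) (mul_inv_cancel₀ hP) rfl rfl rfl rfl rfl rfl

theorem ricci_frame (hσ : p.sigma r c ≠ 0) (hP : p.pTheta c ≠ 0) :
    ricciContr (frameCurv (fun k => p.gammaFrame k r c) (fun k l => p.gammaFrameD k l r c))
      = p.Λ • p.hFrame r c + (2 : ℝ) •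
        ((p.fieldFrame r c).transpose * (p.hFrame r c)⁻¹ * p.fieldFrame r c
        - ((1 / 4) * ∑ i, ∑ j, ((p.hFrame r c)⁻¹ * p.fieldFrame r c *
          ((p.hFrame r c)⁻¹).transpose) i j * p.fieldFrame r c i j) • p.hFrame r c) := by
  have hu := mul_inv_cancel₀ hσ
  have hw := mul_inv_cancel₀ hP
  rw [p.ricci_frame' hσ hP, hFrame, frameMetric_inv hu hw, fieldFrame, frameField_raise hu hw,
    frameField_stress (S := p.sigma r c) rfl hu hw]

/-- The charge term is trace-free: its null block contributes `-2` and each of the two transverse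
entries contributes `1`. -/
theorem trace_ricci_frame (hσ : p.sigma r c ≠ 0) (hP : p.pTheta c ≠ 0) :
    ∑ i, ∑ j, (p.hFrame r c)⁻¹ i j * ricciContr (frameCurv (fun k => p.gammaFrame k r c)
      (fun k l => p.gammaFrameD k l r c)) i j = 4 * p.Λ := by
  rw [p.ricci_frame' hσ hP, hFrame, frameMetric_inv (mul_inv_cancel₀ hσ) (mul_inv_cancel₀ hP)]
  simp only [frameMetric, frameMetricInv, Fin.sum_univ_four, Matrix.of_apply, Matrix.cons_val,
    Matrix.add_apply, Matrix.smul_apply, smul_eq_mul]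
  field_simp
  ring

end Params

namespace KerrCoframe

variable {p : Params} {U : Set Coord} {r c : Coord → ℝ} {e : Coord → Mat} {x : Coord}

theorem smooth_sigma (K : KerrCoframe p U r c e) :
    ContDiffOn ℝ ∞ (fun y => p.sigma (r y) (c y)) U := by
  have := K.smooth_r; have := K.smooth_c
  unfold Params.sigma; fun_prop

theorem smooth_pTheta (K : KerrCoframe p U r c e) :
    ContDiffOn ℝ ∞ (fun y => p.pTheta (c y)) U := by
  have := K.smooth_c
  unfold Params.pTheta; fun_prop

theorem smooth_deltaR (K : KerrCoframe p U r c e) :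
    ContDiffOn ℝ ∞ (fun y => p.deltaR (r y)) U := by
  have := K.smooth_r
  unfold Params.deltaR; fun_prop

theorem smooth_gamma (K : KerrCoframe p U r c e) (k : Fin 4) :
    SmoothMat U (fun y => p.gammaFrame k (r y) (c y)) := by
  have := K.smooth_r; have := K.smooth_c
  refine smooth_frameConn p.a K.smooth_r K.smooth_c (K.smooth_sigma.inv K.sigma_ne)
    (K.smooth_pTheta.inv K.pTheta_ne) K.smooth_deltaR ?_ K.smooth_pTheta ?_ k
  · unfold Params.deltaR'; fun_prop
  · unfold Params.pTheta'; fun_prop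

theorem smooth_h (K : KerrCoframe p U r c e) :
    SmoothMat U (fun y => p.hFrame (r y) (c y)) := by
  have h1 := K.smooth_sigma; have h2 := K.smooth_sigma.inv K.sigma_ne
  have h3 := K.smooth_pTheta; have h4 := K.smooth_pTheta.inv K.pTheta_ne
  have h5 := K.smooth_deltaR
  intro i j
  fin_cases i <;> fin_cases j <;>
    simp only [Fin.zero_eta, Fin.mk_one, Fin.reduceFinMk, Params.hFrame, frameMetric,
      Matrix.of_apply, Matrix.cons_val] <;>
    first
      | exact contDiffOn_const
      | exact (h5.mul h2).neg
      | exact h1.mul h4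
      | exact h3.mul h2

theorem jet_r (K : KerrCoframe p U r c e) (hx : x ∈ U) : Jet r (fun m => e x 1 m) x :=
  (Jet.of_contDiffOn K.isOpen hx K.smooth_r).congr fun m => (K.row_one x hx m).symm

theorem jet_c (K : KerrCoframe p U r c e) (hx : x ∈ U) : Jet c (fun m => e x 2 m) x :=
  (Jet.of_contDiffOn K.isOpen hx K.smooth_c).congr fun m => (K.row_two x hx m).symm

theorem jet_sigma (K : KerrCoframe p U r c e) (hx : x ∈ U) :
    Jet (fun y => p.sigma (r y) (c y))
      (fun m => 2 * r x * e x 1 m + 2 * p.a ^ 2 * c x * e x 2 m) x := by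
  refine (((K.jet_r hx).pow 2).add ((Jet.const (p.a ^ 2)).mul ((K.jet_c hx).pow 2))).congr
    fun m => ?_
  simp; ring

theorem jet_sigma_inv (K : KerrCoframe p U r c e) (hx : x ∈ U) :
    Jet (fun y => (p.sigma (r y) (c y))⁻¹)
      (fun m => -(2 * r x * e x 1 m + 2 * p.a ^ 2 * c x * e x 2 m)
        * (p.sigma (r x) (c x))⁻¹ ^ 2) x :=
  (K.jet_sigma hx).inv (K.sigma_ne x hx)

theorem jet_pTheta (K : KerrCoframe p U r c e) (hx : x ∈ U) :
    Jet (fun y => p.pTheta (c y)) (fun m => p.pTheta' (c x) * e x 2 m) x :=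
  (K.jet_c hx).comp_one (p.hasDerivAt_pTheta _)

theorem jet_pTheta_inv (K : KerrCoframe p U r c e) (hx : x ∈ U) :
    Jet (fun y => (p.pTheta (c y))⁻¹)
      (fun m => -(p.pTheta' (c x) * e x 2 m) * (p.pTheta (c x))⁻¹ ^ 2) x :=
  (K.jet_pTheta hx).inv (K.pTheta_ne x hx)

theorem jet_deltaR (K : KerrCoframe p U r c e) (hx : x ∈ U) :
    Jet (fun y => p.deltaR (r y)) (fun m => p.deltaR' (r x) * e x 1 m) x :=
  (K.jet_r hx).comp_one (p.hasDerivAt_deltaR _)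

/-- The connection of the metric in the coframe. -/
theorem isFrame (K : KerrCoframe p U r c e) {G : Coord → Mat}
    (hG : ∀ y ∈ U, G y = (e y).transpose * p.hFrame (r y) (c y) * e y) :
    IsFrame U G e (fun y => p.hFrame (r y) (c y)) (fun k y => p.gammaFrame k (r y) (c y))
      (fun l k y => p.gammaFrameD l k (r y) (c y)) where
  isOpen := K.isOpen
  smooth_e := K.smooth_e
  smooth_h := K.smooth_h
  smooth_γ := K.smooth_gamma
  det_e := K.det_e
  det_h y hy := frameMetric_det (mul_inv_cancel₀ (K.sigma_ne y hy))
    (mul_inv_cancel₀ (K.pTheta_ne y hy))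
  symm y _ := frameMetric_symm
  metric := hG
  compat y hy m := by
    simp only [Params.hFrame, Params.gammaFrame]
    simp only [frameConn_compat (mul_inv_cancel₀ (K.sigma_ne y hy))
      (mul_inv_cancel₀ (K.pTheta_ne y hy)), Fin.sum_univ_four]
    have hS := K.jet_sigma hy
    have hu := K.jet_sigma_inv hy
    have hP := K.jet_pTheta hy
    have hw := K.jet_pTheta_inv hy
    have hD := K.jet_deltaR hy
    ext i j
    fin_cases i <;> fin_cases j <;>
      simp only [Fin.zero_eta, Fin.mk_one, Fin.reduceFinMk, pdM_apply, frameMetric,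
        Matrix.add_apply, Matrix.smul_apply, smul_eq_mul, Matrix.of_apply, Matrix.cons_val,
        Matrix.zero_apply, mul_zero, add_zero, zero_add, pd_const]
    · rw [(hD.mul hu).neg.pd_eq]; ring
    · rw [(hS.mul hw).pd_eq]; ring
    · rw [(hP.mul hu).pd_eq]; ring
  torsion y hy m n k := by
    have h := frameConn_torsion (a := p.a) (r := r y) (c := c y) (D := p.deltaR (r y))
      (D1 := p.deltaR' (r y)) (P1 := p.pTheta' (c y)) (mul_inv_cancel₀ (K.sigma_ne y hy))
      (mul_inv_cancel₀ (K.pTheta_ne y hy)) k (fun k => e y k m) (fun k => e y k n)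
    refine Eq.trans ?_ h.symm
    fin_cases k <;> simp only [Fin.zero_eta, Fin.mk_one, Fin.reduceFinMk, Matrix.cons_val]
    · exact K.d_zero y hy m n
    -- The rows `dr` and `dc` are differentials, hence closed by the symmetry of second derivatives.
    · have h1 : ∀ m n, pd m (fun z => e z 1 n) y = pd m (fun z => pd n r z) y := fun m n =>
        pd_congr K.isOpen hy (fun z hz => K.row_one z hz n) m
      rw [h1, h1, pd_comm K.isOpen hy K.smooth_r, sub_self]
    · have h1 : ∀ m n, pd m (fun z => e z 2 n) y = pd m (fun z => pd n c z) y := fun m n =>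
        pd_congr K.isOpen hy (fun z hz => K.row_two z hz n) m
      rw [h1, h1, pd_comm K.isOpen hy K.smooth_c, sub_self]
    · exact K.d_three y hy m n
  deriv y hy m k := by
    ext i j
    rw [pdM_apply]
    refine ((jet_frameConn p.a (K.jet_r hy) (K.jet_c hy) (K.jet_sigma_inv hy) (K.jet_pTheta_inv hy)
      (K.jet_deltaR hy) ((K.jet_r hy).comp_one (p.hasDerivAt_deltaR' _)) (K.jet_pTheta hy)
      ((K.jet_c hy).comp_one (p.hasDerivAt_pTheta' _)) k i j).pd_eq m).trans ?_
    simp [Fin.sum_univ_four, Params.gammaFrameD, frameConnD, Matrix.add_apply, Matrix.smul_apply]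

theorem einsteinMaxwell (K : KerrCoframe p U r c e) {G Fm : Coord → Mat}
    (hG : ∀ y ∈ U, G y = (e y).transpose * p.hFrame (r y) (c y) * e y)
    (hF : ∀ y ∈ U, Fm y = (e y).transpose * p.fieldFrame (r y) (c y) * e y) (hx : x ∈ U) :
    einstein G x + p.Λ • G x = (8 * Real.pi) • stressEnergy G Fm x :=
  (K.isFrame hG).einstein_of_frame hx (hF x hx)
    (p.trace_ricci_frame (K.sigma_ne x hx) (K.pTheta_ne x hx))
    (p.ricci_frame (K.sigma_ne x hx) (K.pTheta_ne x hx))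

theorem divergence_eq_zero (K : KerrCoframe p U r c e) {G Fm : Coord → Mat}
    (hG : ∀ y ∈ U, G y = (e y).transpose * p.hFrame (r y) (c y) * e y)
    (hF : ∀ y ∈ U, Fm y = (e y).transpose * p.fieldFrame (r y) (c y) * e y)
    (hFs : SmoothMat U Fm) (hx : x ∈ U) (n : Fin 4) : divergence G Fm n x = 0 := by
  refine (K.isFrame hG).divergence_of_frame hx hFs hF ?_
    (φ := fun y => frameFieldRaised p.a (r y) (c y) (p.sigma (r y) (c y))⁻¹ p.Q) ?_
    (Dφ := ![0, frameFieldRaisedDr p.a (r x) (c x) (p.sigma (r x) (c x))⁻¹ p.Q,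
      frameFieldRaisedDc p.a (r x) (c x) (p.sigma (r x) (c x))⁻¹ p.Q, 0]) ?_ ?_ n
  · ext i j
    fin_cases i <;> fin_cases j <;> simp [Params.fieldFrame, frameField]
  · intro y hy
    have hu := mul_inv_cancel₀ (K.sigma_ne y hy)
    have hw := mul_inv_cancel₀ (K.pTheta_ne y hy)
    rw [Params.hFrame, frameMetric_inv hu hw, Params.fieldFrame, frameField_raise hu hw]
  · intro m
    ext i j
    rw [pdM_apply, (jet_frameFieldRaised p.a p.Q (K.jet_r hx) (K.jet_c hx)
      (K.jet_sigma_inv hx) i j).pd_eq]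
    simp [Fin.sum_univ_four, Matrix.add_apply, Matrix.smul_apply]
  · exact frameField_div rfl (mul_inv_cancel₀ (K.sigma_ne x hx))
      (mul_inv_cancel₀ (K.pTheta_ne x hx)) p.Q

/-- The Kretschmann scalar is at least `4 (2 M / r³ - Q² / r⁴ + λ)²` where `a cos θ = 0`. -/
theorem kretschmann_le (K : KerrCoframe p U r c e) {G : Coord → Mat}
    (hG : ∀ y ∈ U, G y = (e y).transpose * p.hFrame (r y) (c y) * e y) (hx : x ∈ U)
    (hac : p.a * c x = 0) :
    kretschmann (G x) (fun m n => curv G m n x)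
      ≤ -(4 * (2 * p.M / r x ^ 3 - p.Q ^ 2 / r x ^ 4 + p.lam) ^ 2) := by
  have hu := mul_inv_cancel₀ (K.sigma_ne x hx)
  have hw := mul_inv_cancel₀ (K.pTheta_ne x hx)
  rw [(K.isFrame hG).kretschmann_eq hx]
  obtain ⟨h01, h02, h03, h12, h13, h23⟩ := frameCurv_of_mul_eq_zero (lam := p.lam) (M := p.M)
    (Q := p.Q) hac rfl hu hw rfl rfl rfl rfl rfl rfl rfl rfl rfl rfl
  have := kretschmann_of_table (D := p.deltaR (r x)) hu hw
    (fun i j => frameCurv_swap _ _ i j) h01 h02 h03 h12 h13 h23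
  refine (le_of_eq this).trans ?_
  -- Of the three squares in the Kretschmann scalar only the last is kept; its bracket has no zero
  -- near `r = 0` on the side `r < 0` when `M ≥ 0` and `(M, Q) ≠ (0, 0)`.
  rw [neg_le_neg_iff]
  have h1 := sq_nonneg (2 * p.M / r x ^ 3 - 3 * p.Q ^ 2 / r x ^ 4 + p.lam)
  have h2 := sq_nonneg (-(p.M / r x ^ 3) + p.Q ^ 2 / r x ^ 4 + p.lam)
  linarith

end KerrCoframe

/-! ### The tensor fields in the ambient space `ℝ² × ℝ³`

Points and vectors of `ℝ² × ℝ³` are written `(t̄, r, x, y, z)`. -/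

namespace Params

variable (p : Params)

/-- The covector `τ = x dy - y dx`. -/
def tau (q v : Fin 5 → ℝ) : ℝ := q 2 * v 3 - q 3 * v 2

/-- The covector `α = dv - a τ`, where `v = t̄ + r`. -/
def alpha (q v : Fin 5 → ℝ) : ℝ := v 0 + v 1 - p.a * tau q v

/-- The metric. -/
def metricForm (q v w : Fin 5 → ℝ) : ℝ :=
  -(p.deltaR (q 1) * (p.sigma (q 1) (q 4))⁻¹ * p.chi⁻¹ ^ 2) * p.alpha q v * p.alpha q w
  + p.chi⁻¹ * (p.alpha q v * w 1 + v 1 * p.alpha q w)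
  + p.deltaTheta (q 4) * (p.sigma (q 1) (q 4))⁻¹ * p.chi⁻¹ ^ 2 *
    (p.a ^ 2 * (1 - q 4 ^ 2) * (v 0 + v 1) * (w 0 + w 1)
      - p.a * (q 1 ^ 2 + p.a ^ 2) * ((v 0 + v 1) * tau q w + tau q v * (w 0 + w 1)))
  + p.sigma (q 1) (q 4) * (p.deltaTheta (q 4))⁻¹ * (v 2 * w 2 + v 3 * w 3 + v 4 * w 4)
  + p.a ^ 2 * (1 - p.lam * q 1 ^ 2) *
    (p.deltaTheta (q 4) * (q 1 ^ 2 + p.a ^ 2) + p.chi * p.sigma (q 1) (q 4)) *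
    (p.sigma (q 1) (q 4))⁻¹ * (p.deltaTheta (q 4))⁻¹ * p.chi⁻¹ ^ 2 * tau q v * tau q w

/-- The function `Q r / (χ Σ)`. -/
def potFun (q : Fin 5 → ℝ) : ℝ := p.Q * q 1 * (p.sigma (q 1) (q 4))⁻¹ * p.chi⁻¹

/-- The differential of `potFun`. -/
def dPotFun (q v : Fin 5 → ℝ) : ℝ :=
  p.Q * p.chi⁻¹ * (v 1 * (p.sigma (q 1) (q 4))⁻¹
    - q 1 * (2 * q 1 * v 1 + 2 * p.a ^ 2 * q 4 * v 4) * (p.sigma (q 1) (q 4))⁻¹ ^ 2)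

/-- The potential. -/
def potForm (q v : Fin 5 → ℝ) : ℝ := p.potFun q * p.alpha q v

/-- The electromagnetic field. -/
def fieldForm (q v w : Fin 5 → ℝ) : ℝ :=
  p.dPotFun q v * p.alpha q w - p.dPotFun q w * p.alpha q v
    - 2 * p.a * p.potFun q * (v 2 * w 3 - v 3 * w 2)

/-- The Kerr coframe `α/χ, dr, dc, β/χ` away from the axis. -/
def coframe (q v : Fin 5 → ℝ) : Fin 4 → ℝ :=
  ![p.alpha q v * p.chi⁻¹, v 1, v 4,
    (p.a * (v 0 + v 1) - (q 1 ^ 2 + p.a ^ 2) * (tau q v * (1 - q 4 ^ 2)⁻¹)) * p.chi⁻¹]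

/-- The vector `v` at the point `q` is tangent to `ℝ² × S²`. -/
def IsTangent (q v : Fin 5 → ℝ) : Prop := q 2 * v 2 + q 3 * v 3 + q 4 * v 4 = 0

/-- The point `q` lies on `ℝ² × S²`. -/
def OnSphere (q : Fin 5 → ℝ) : Prop := q 2 ^ 2 + q 3 ^ 2 + q 4 ^ 2 = 1

variable {p} {q v w : Fin 5 → ℝ}

/-- `Δ_θ` is the convex combination of `χ` and `1` with weights `cos² θ` and `sin² θ`. -/
theorem deltaTheta_pos (hχ : 0 < p.chi) {c : ℝ} (hc : c ^ 2 ≤ 1) : 0 < p.deltaTheta c := by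
  have h : p.deltaTheta c = p.chi * c ^ 2 + (1 - c ^ 2) := by
    simp only [deltaTheta, chi]; ring
  rw [h]
  rcases hc.lt_or_eq with h1 | h1
  · nlinarith [mul_nonneg hχ.le (sq_nonneg c)]
  · rw [h1]; linarith

theorem OnSphere.sq_le (hq : OnSphere q) : q 4 ^ 2 ≤ 1 := by
  unfold OnSphere at hq
  nlinarith [sq_nonneg (q 2), sq_nonneg (q 3)]

/-- Lagrange's identity in the `(x, y)`-plane, with `x dx + y dy = -z dz` on tangent vectors. It
splits the round metric into its parts along `dz` and along `τ`. -/
theorem dot_eq (hq : OnSphere q) (hv : IsTangent q v) (hw : IsTangent q w) :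
    (1 - q 4 ^ 2) * (v 2 * w 2 + v 3 * w 3) = q 4 ^ 2 * (v 4 * w 4) + tau q v * tau q w := by
  unfold OnSphere at hq; unfold IsTangent at hv hw; unfold tau
  linear_combination -(v 2 * w 2 + v 3 * w 3) * hq + (q 2 * w 2 + q 3 * w 3 + q 4 * w 4) * hv
    - q 4 * w 4 * hv - q 4 * v 4 * hw

/-- The companion of `dot_eq` for the area form: `sin² θ dx ∧ dy = -z dz ∧ τ` on the sphere. It
expresses `dα = -2a dx ∧ dy` in the Kerr coframe. -/
theorem area_eq (hq : OnSphere q) (hv : IsTangent q v) (hw : IsTangent q w) :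
    (1 - q 4 ^ 2) * (v 2 * w 3 - v 3 * w 2) = -(q 4 * (v 4 * tau q w - w 4 * tau q v)) := by
  unfold OnSphere at hq; unfold IsTangent at hv hw; unfold tau
  linear_combination -(v 2 * w 3 - v 3 * w 2) * hq + (q 2 * w 3 - q 3 * w 2) * hv
    - (q 2 * v 3 - q 3 * v 2) * hw

/-- Here the ambient formula, smooth on the axis, meets the coframe form, singular there. The terms
in `τ²/sin² θ` have total coefficient `(Δ_θ² (r² + a²)² - χ²Σ²)/(ΣΔ_θχ²)`. The difference of squares
factors, and `Δ_θ (r² + a²) - χΣ = a² sin² θ (1 - λ r²)` cancels the `sin² θ`. -/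
theorem metricForm_eq_coframe (hχ : 0 < p.chi) (hσ : p.sigma (q 1) (q 4) ≠ 0)
    (hq : OnSphere q) (hv : IsTangent q v) (hw : IsTangent q w) (hs : 1 - q 4 ^ 2 ≠ 0) :
    p.metricForm q v w
      = ∑ i, ∑ j, p.coframe q v i * p.coframe q w j * p.hFrame (q 1) (q 4) i j := by
  have hd := (deltaTheta_pos hχ hq.sq_le).ne'
  have hP : p.pTheta (q 4) = p.deltaTheta (q 4) * (1 - q 4 ^ 2) := rfl
  have hdot : v 2 * w 2 + v 3 * w 3
      = (q 4 ^ 2 * (v 4 * w 4) + tau q v * tau q w) * (1 - q 4 ^ 2)⁻¹ := by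
    rw [← dot_eq hq hv hw]; field_simp
  have hχ0 := hχ.ne'
  have hσ' : p.sigma (q 1) (q 4) = q 1 ^ 2 + p.a ^ 2 * q 4 ^ 2 := rfl
  have hd' : p.deltaTheta (q 4) = 1 + p.lam * p.a ^ 2 * q 4 ^ 2 := rfl
  have hχ' : p.chi = 1 + p.lam * p.a ^ 2 := rfl
  simp only [metricForm, coframe, hFrame, frameMetric, Fin.sum_univ_four, Matrix.of_apply,
    Matrix.cons_val, hP, hdot, alpha, mul_zero, add_zero, zero_add, mul_one]
  generalize tau q v = τ
  generalize tau q w = τ'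
  generalize p.deltaR (q 1) = D
  field_simp
  rw [hσ', hd', hχ']
  ring

theorem fieldForm_eq_coframe (hχ : 0 < p.chi) (hσ : p.sigma (q 1) (q 4) ≠ 0)
    (hq : OnSphere q) (hv : IsTangent q v) (hw : IsTangent q w) (hs : 1 - q 4 ^ 2 ≠ 0) :
    p.fieldForm q v w
      = ∑ i, ∑ j, p.coframe q v i * p.coframe q w j * p.fieldFrame (q 1) (q 4) i j := by
  have harea : v 2 * w 3 - v 3 * w 2
      = -(q 4 * (v 4 * tau q w - w 4 * tau q v)) * (1 - q 4 ^ 2)⁻¹ := by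
    rw [← area_eq hq hv hw]; field_simp
  have hχ0 := hχ.ne'
  have hσ' : p.sigma (q 1) (q 4) = q 1 ^ 2 + p.a ^ 2 * q 4 ^ 2 := rfl
  simp only [fieldForm, dPotFun, potFun, coframe, fieldFrame, frameField, Fin.sum_univ_four,
    Matrix.of_apply, Matrix.cons_val, harea, alpha, mul_zero, add_zero, zero_add]
  generalize tau q v = τ
  generalize tau q w = τ'
  field_simp
  rw [hσ']
  ring

end Params
-- Arbitrary local coordinates seen from the ambient space
/-- Smooth coordinates on a part of `ℝ² × S²`, given by the five ambient coordinate functions. -/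
structure EmbCoord (Ω : Set Coord) (q : Coord → Fin 5 → ℝ) : Prop where
  isOpen : IsOpen Ω
  smooth : ∀ i, ContDiffOn ℝ ∞ (fun y => q y i) Ω
  onSphere : ∀ y ∈ Ω, Params.OnSphere (q y)
  inj : ∀ y ∈ Ω, ∀ k : Fin 4 → ℝ, (∀ i, ∑ m, pd m (fun z => q z i) y * k m = 0) → k = 0

/-- The ambient components of the coordinate vector `∂_m`. -/
def tanVec (q : Coord → Fin 5 → ℝ) (y : Coord) (m : Fin 4) : Fin 5 → ℝ :=
  fun i => pd m (fun z => q z i) y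

/-- The metric with two equal null directions removed: a normal form of the metrics below. -/
def blockMetric (A k l : ℝ) : Mat := !![-A, 1, 0, 0; 1, 0, 0, 0; 0, 0, k, 0; 0, 0, 0, l]

theorem mem_of_dense {Ω Ω' : Set Coord} (hΩ : IsOpen Ω) (hd : Ω ⊆ closure Ω') {f : Coord → ℝ}
    (hf : ContinuousOn f Ω) (h0 : ∀ y ∈ Ω', f y = 0) : ∀ y ∈ Ω, f y = 0 := by
  intro y hy
  by_contra hne
  have ho : IsOpen (Ω ∩ f ⁻¹' {0}ᶜ) := hf.isOpen_inter_preimage hΩ isOpen_compl_singleton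
  obtain ⟨z, hz, hz'⟩ := mem_closure_iff.1 (hd hy) _ ho ⟨hy, hne⟩
  exact hz.2 (h0 z hz')

namespace EmbCoord

variable {Ω : Set Coord} {q : Coord → Fin 5 → ℝ} {p : Params} {x : Coord}

theorem smooth_tanVec (C : EmbCoord Ω q) (m : Fin 4) (i : Fin 5) :
    ContDiffOn ℝ ∞ (fun y => tanVec q y m i) Ω :=
  contDiffOn_pd C.isOpen (C.smooth i) m

theorem isTangent (C : EmbCoord Ω q) (hx : x ∈ Ω) (m : Fin 4) :
    Params.IsTangent (q x) (tanVec q x m) := by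
  have j : ∀ i, Jet (fun y => q y i) (fun m => tanVec q x m i) x := fun i =>
    Jet.of_contDiffOn C.isOpen hx (C.smooth i)
  have h := ((((j 2).pow 2).add ((j 3).pow 2)).add ((j 4).pow 2)).pd_eq m
  rw [pd_congr C.isOpen hx (g := fun _ => 1) (fun y hy => C.onSphere y hy), pd_const] at h
  unfold Params.IsTangent
  simp only [Nat.cast_ofNat, Nat.add_one_sub_one, pow_one] at h
  linarith

/-- The part of the coordinate domain away from the axis. -/
def offAxis (Ω : Set Coord) (q : Coord → Fin 5 → ℝ) : Set Coord := {y ∈ Ω | 1 - q y 4 ^ 2 ≠ 0}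

theorem offAxis_isOpen (C : EmbCoord Ω q) : IsOpen (offAxis Ω q) :=
  (contDiffOn_const.sub ((C.smooth 4).pow 2)).continuousOn.isOpen_inter_preimage C.isOpen
    isOpen_compl_singleton

theorem eq_zero_of_axis {y : Fin 5 → ℝ} (hy : Params.OnSphere y) (h : 1 - y 4 ^ 2 = 0) :
    y 2 = 0 ∧ y 3 = 0 := by
  unfold Params.OnSphere at hy
  constructor <;> nlinarith [sq_nonneg (y 2), sq_nonneg (y 3)]

/-- On an open piece of the axis `x` and `y` would vanish identically and the differential of `z`
would vanish as well. Only `t̄` and `r` could then vary, which contradicts the injectivity of the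
four-dimensional differential. -/
theorem dense_offAxis (C : EmbCoord Ω q) : Ω ⊆ closure (offAxis Ω q) := by
  intro x hx
  by_contra hcl
  set V : Set Coord := Ω ∩ (closure (offAxis Ω q))ᶜ with hV
  have hVo : IsOpen V := C.isOpen.inter isClosed_closure.isOpen_compl
  have hxV : x ∈ V := ⟨hx, hcl⟩
  have hax : ∀ y ∈ V, 1 - q y 4 ^ 2 = 0 := fun y hy => by
    by_contra h
    exact hy.2 (subset_closure ⟨hy.1, h⟩)
  have h2 : ∀ m, tanVec q x m 2 = 0 := fun m => by
    have := pd_congr hVo hxV (g := fun _ => 0)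
      (fun y hy => (eq_zero_of_axis (C.onSphere y hy.1) (hax y hy)).1) m
    rw [pd_const] at this
    exact this
  have h3 : ∀ m, tanVec q x m 3 = 0 := fun m => by
    have := pd_congr hVo hxV (g := fun _ => 0)
      (fun y hy => (eq_zero_of_axis (C.onSphere y hy.1) (hax y hy)).2) m
    rw [pd_const] at this
    exact this
  have h4 : ∀ m, tanVec q x m 4 = 0 := fun m => by
    have ht := C.isTangent hx m
    unfold Params.IsTangent at ht
    rw [h2, h3, mul_zero, mul_zero, zero_add, zero_add] at ht
    refine (mul_eq_zero.1 ht).resolve_left fun h0 => ?_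
    have := hax x hxV
    rw [h0] at this
    norm_num at this
  -- The two surviving differentials, of `t̄` and `r`, have a common kernel vector in `ℝ⁴`.
  let L : (Fin 4 → ℝ) →ₗ[ℝ] (Fin 2 → ℝ) :=
    Matrix.toLin' (Matrix.of ![fun m => tanVec q x m 0, fun m => tanVec q x m 1])
  have hker : LinearMap.ker L ≠ ⊥ :=
    LinearMap.ker_ne_bot_of_finrank_lt (by simp)
  obtain ⟨k, hk, hk0⟩ := (Submodule.ne_bot_iff _).1 hker
  refine hk0 (C.inj x hx k fun i => ?_)
  have hL : L k = 0 := hk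
  have hL0 := congrFun hL 0
  have hL1 := congrFun hL 1
  simp only [L, Matrix.toLin'_apply, Matrix.mulVec, dotProduct, Matrix.of_apply,
    Matrix.cons_val, Pi.zero_apply] at hL0 hL1
  fin_cases i
  · exact hL0
  · exact hL1
  · exact Finset.sum_eq_zero fun m _ => mul_eq_zero_of_left (h2 m) _
  · exact Finset.sum_eq_zero fun m _ => mul_eq_zero_of_left (h3 m) _
  · exact Finset.sum_eq_zero fun m _ => mul_eq_zero_of_left (h4 m) _

theorem offAxis_embCoord (C : EmbCoord Ω q) : EmbCoord (offAxis Ω q) q where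
  isOpen := C.offAxis_isOpen
  smooth i := (C.smooth i).mono fun _ h => h.1
  onSphere y h := C.onSphere y h.1
  inj y h := C.inj y h.1

/-- The components of the metric. -/
def metric (p : Params) (q : Coord → Fin 5 → ℝ) (y : Coord) : Mat :=
  Matrix.of fun m n => p.metricForm (q y) (tanVec q y m) (tanVec q y n)

/-- The components of the electromagnetic field. -/
def field (p : Params) (q : Coord → Fin 5 → ℝ) (y : Coord) : Mat :=
  Matrix.of fun m n => p.fieldForm (q y) (tanVec q y m) (tanVec q y n)

/-- The components of the potential. -/
def potential (p : Params) (q : Coord → Fin 5 → ℝ) (y : Coord) : Fin 4 → ℝ :=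
  fun m => p.potForm (q y) (tanVec q y m)

/-- The components of the Kerr coframe. -/
def frame (p : Params) (q : Coord → Fin 5 → ℝ) (y : Coord) : Mat :=
  Matrix.of fun k m => p.coframe (q y) (tanVec q y m) k

theorem smooth_tau (C : EmbCoord Ω q) (m : Fin 4) :
    ContDiffOn ℝ ∞ (fun y => Params.tau (q y) (tanVec q y m)) Ω :=
  ((C.smooth 2).mul (C.smooth_tanVec m 3)).sub ((C.smooth 3).mul (C.smooth_tanVec m 2))

theorem smooth_alpha (C : EmbCoord Ω q) (m : Fin 4) :
    ContDiffOn ℝ ∞ (fun y => p.alpha (q y) (tanVec q y m)) Ω :=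
  ((C.smooth_tanVec m 0).add (C.smooth_tanVec m 1)).sub (contDiffOn_const.mul (C.smooth_tau m))

theorem smooth_sigma (C : EmbCoord Ω q) :
    ContDiffOn ℝ ∞ (fun y => p.sigma (q y 1) (q y 4)) Ω := by
  have := C.smooth 1; have := C.smooth 4
  unfold Params.sigma; fun_prop

theorem smooth_deltaTheta (C : EmbCoord Ω q) :
    ContDiffOn ℝ ∞ (fun y => p.deltaTheta (q y 4)) Ω := by
  have := C.smooth 4
  unfold Params.deltaTheta; fun_prop

theorem smooth_metric (C : EmbCoord Ω q) (hχ : 0 < p.chi)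
    (hσ : ∀ y ∈ Ω, p.sigma (q y 1) (q y 4) ≠ 0) : SmoothMat Ω (metric p q) := by
  intro m n
  have h1 := C.smooth 1; have h4 := C.smooth 4
  have hv := C.smooth_tanVec m; have hw := C.smooth_tanVec n
  have hv0 := hv 0; have hv1 := hv 1; have hv2 := hv 2; have hv3 := hv 3; have hv4 := hv 4
  have hw0 := hw 0; have hw1 := hw 1; have hw2 := hw 2; have hw3 := hw 3; have hw4 := hw 4
  have ht := C.smooth_tau m; have ht' := C.smooth_tau n
  have ha := C.smooth_alpha (p := p) m; have ha' := C.smooth_alpha (p := p) n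
  have hS := C.smooth_sigma (p := p)
  have hu : ContDiffOn ℝ ∞ (fun y => (p.sigma (q y 1) (q y 4))⁻¹) Ω := hS.inv hσ
  have hd := C.smooth_deltaTheta (p := p)
  have hw : ContDiffOn ℝ ∞ (fun y => (p.deltaTheta (q y 4))⁻¹) Ω :=
    hd.inv fun y hy => (Params.deltaTheta_pos hχ (C.onSphere y hy).sq_le).ne'
  simp only [metric, Matrix.of_apply, Params.metricForm, Params.deltaR]
  fun_prop

theorem smooth_potFun (C : EmbCoord Ω q) (hσ : ∀ y ∈ Ω, p.sigma (q y 1) (q y 4) ≠ 0) :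
    ContDiffOn ℝ ∞ (fun y => p.potFun (q y)) Ω := by
  have h1 := C.smooth 1
  have hu : ContDiffOn ℝ ∞ (fun y => (p.sigma (q y 1) (q y 4))⁻¹) Ω := C.smooth_sigma.inv hσ
  simp only [Params.potFun]
  fun_prop

theorem smooth_potential (C : EmbCoord Ω q) (hσ : ∀ y ∈ Ω, p.sigma (q y 1) (q y 4) ≠ 0)
    (m : Fin 4) : ContDiffOn ℝ ∞ (fun y => potential p q y m) Ω :=
  (C.smooth_potFun hσ).mul (C.smooth_alpha m)

theorem smooth_field (C : EmbCoord Ω q) (hσ : ∀ y ∈ Ω, p.sigma (q y 1) (q y 4) ≠ 0) :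
    SmoothMat Ω (field p q) := by
  intro m n
  have h1 := C.smooth 1; have h4 := C.smooth 4
  have hv := C.smooth_tanVec m; have hw := C.smooth_tanVec n
  have hv0 := hv 0; have hv1 := hv 1; have hv2 := hv 2; have hv3 := hv 3; have hv4 := hv 4
  have hw0 := hw 0; have hw1 := hw 1; have hw2 := hw 2; have hw3 := hw 3; have hw4 := hw 4
  have ha := C.smooth_alpha (p := p) m; have ha' := C.smooth_alpha (p := p) n
  have hp := C.smooth_potFun hσ
  have hu : ContDiffOn ℝ ∞ (fun y => (p.sigma (q y 1) (q y 4))⁻¹) Ω := C.smooth_sigma.inv hσ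
  simp only [field, Matrix.of_apply, Params.fieldForm, Params.dPotFun]
  fun_prop

/-! ### The potential and the field -/

theorem jet_q (C : EmbCoord Ω q) (hx : x ∈ Ω) (i : Fin 5) :
    Jet (fun y => q y i) (fun m => tanVec q x m i) x :=
  Jet.of_contDiffOn C.isOpen hx (C.smooth i)

theorem jet_tanVec (C : EmbCoord Ω q) (hx : x ∈ Ω) (n : Fin 4) (i : Fin 5) :
    Jet (fun y => tanVec q y n i) (fun m => pd m (fun y => tanVec q y n i) x) x :=
  Jet.of_contDiffOn C.isOpen hx (C.smooth_tanVec n i)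

theorem pd_tanVec_comm (C : EmbCoord Ω q) (hx : x ∈ Ω) (m n : Fin 4) (i : Fin 5) :
    pd m (fun y => tanVec q y n i) x = pd n (fun y => tanVec q y m i) x :=
  pd_comm C.isOpen hx (C.smooth i) m n

theorem jet_sigma_inv (C : EmbCoord Ω q) (hx : x ∈ Ω) (hσ : p.sigma (q x 1) (q x 4) ≠ 0) :
    Jet (fun y => (p.sigma (q y 1) (q y 4))⁻¹)
      (fun m => -(2 * q x 1 * tanVec q x m 1 + 2 * p.a ^ 2 * q x 4 * tanVec q x m 4)
        * (p.sigma (q x 1) (q x 4))⁻¹ ^ 2) x := by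
  have hS : Jet (fun y => p.sigma (q y 1) (q y 4))
      (fun m => 2 * q x 1 * tanVec q x m 1 + 2 * p.a ^ 2 * q x 4 * tanVec q x m 4) x := by
    refine (((C.jet_q hx 1).pow 2).add ((Jet.const (p.a ^ 2)).mul ((C.jet_q hx 4).pow 2))).congr
      fun m => ?_
    simp; ring
  exact hS.inv hσ

theorem jet_potFun (C : EmbCoord Ω q) (hx : x ∈ Ω) (hσ : p.sigma (q x 1) (q x 4) ≠ 0) :
    Jet (fun y => p.potFun (q y)) (fun m => p.dPotFun (q x) (tanVec q x m)) x := by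
  refine ((((Jet.const p.Q).mul (C.jet_q hx 1)).mul (C.jet_sigma_inv hx hσ)).mul
    (Jet.const p.chi⁻¹)).congr fun m => ?_
  simp only [Params.dPotFun]; ring

theorem jet_tau (C : EmbCoord Ω q) (hx : x ∈ Ω) (n : Fin 4) :
    Jet (fun y => Params.tau (q y) (tanVec q y n)) (fun m =>
      tanVec q x m 2 * tanVec q x n 3 - tanVec q x m 3 * tanVec q x n 2
      + (q x 2 * pd m (fun y => tanVec q y n 3) x - q x 3 * pd m (fun y => tanVec q y n 2) x)) x := by
  refine (((C.jet_q hx 2).mul (C.jet_tanVec hx n 3)).sub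
    ((C.jet_q hx 3).mul (C.jet_tanVec hx n 2))).congr fun m => ?_
  ring

/-- `dτ = 2 dx ∧ dy`. -/
theorem d_tau (C : EmbCoord Ω q) (hx : x ∈ Ω) (m n : Fin 4) :
    pd m (fun y => Params.tau (q y) (tanVec q y n)) x
      - pd n (fun y => Params.tau (q y) (tanVec q y m)) x
    = 2 * (tanVec q x m 2 * tanVec q x n 3 - tanVec q x m 3 * tanVec q x n 2) := by
  rw [(C.jet_tau hx n).pd_eq, (C.jet_tau hx m).pd_eq, C.pd_tanVec_comm hx m n 3,
    C.pd_tanVec_comm hx m n 2]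
  ring

theorem jet_alpha (C : EmbCoord Ω q) (hx : x ∈ Ω) (n : Fin 4) :
    Jet (fun y => p.alpha (q y) (tanVec q y n)) (fun m => pd m (fun y => tanVec q y n 0) x
      + pd m (fun y => tanVec q y n 1) x
      - p.a * pd m (fun y => Params.tau (q y) (tanVec q y n)) x) x := by
  refine (((C.jet_tanVec hx n 0).add (C.jet_tanVec hx n 1)).sub
    ((Jet.const p.a).mul (Jet.of_contDiffOn C.isOpen hx (C.smooth_tau n)))).congr fun m => ?_
  ring

theorem d_alpha (C : EmbCoord Ω q) (hx : x ∈ Ω) (m n : Fin 4) :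
    pd m (fun y => p.alpha (q y) (tanVec q y n)) x - pd n (fun y => p.alpha (q y) (tanVec q y m)) x
    = -(2 * p.a * (tanVec q x m 2 * tanVec q x n 3 - tanVec q x m 3 * tanVec q x n 2)) := by
  have h := C.d_tau hx m n
  rw [(C.jet_alpha hx n).pd_eq, (C.jet_alpha hx m).pd_eq, C.pd_tanVec_comm hx m n 0,
    C.pd_tanVec_comm hx m n 1]
  linear_combination -p.a * h

/-- `F = dA`. -/
theorem field_eq_extDer (C : EmbCoord Ω q) (hx : x ∈ Ω) (hσ : p.sigma (q x 1) (q x 4) ≠ 0) :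
    field p q x = extDer (potential p q) x := by
  ext m n
  have hj : ∀ n m, pd m (fun y => potential p q y n) x
      = p.dPotFun (q x) (tanVec q x m) * p.alpha (q x) (tanVec q x n)
        + p.potFun (q x) * pd m (fun y => p.alpha (q y) (tanVec q y n)) x := fun n m =>
    ((C.jet_potFun hx hσ).mul (Jet.of_contDiffOn C.isOpen hx (C.smooth_alpha n))).pd_eq m
  have h := C.d_alpha (p := p) hx m n
  simp only [field, extDer, Matrix.of_apply, hj, Params.fieldForm]
  linear_combination -(p.potFun (q x)) * h

/-- `d² = 0`: since `F = dA` on an open set, the six second derivatives of the potential cancel in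
pairs. -/
theorem field_closed (C : EmbCoord Ω q) (hσ : ∀ y ∈ Ω, p.sigma (q y 1) (q y 4) ≠ 0) (hx : x ∈ Ω)
    (l m n : Fin 4) : pd l (fun y => field p q y m n) x + pd m (fun y => field p q y n l) x
      + pd n (fun y => field p q y l m) x = 0 := by
  have h : ∀ l m n, pd l (fun y => field p q y m n) x
      = pd l (fun y => pd m (fun z => potential p q z n) y) x
        - pd l (fun y => pd n (fun z => potential p q z m) y) x := fun l m n => by
    rw [pd_congr C.isOpen hx fun y hy => congrFun (congrFun (C.field_eq_extDer hy (hσ y hy)) m) n]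
    exact pd_sub (diffAt C.isOpen hx (contDiffOn_pd C.isOpen (C.smooth_potential hσ n) m))
      (diffAt C.isOpen hx (contDiffOn_pd C.isOpen (C.smooth_potential hσ m) n)) l
  have hc : ∀ l m n, pd l (fun y => pd m (fun z => potential p q z n) y) x
      = pd m (fun y => pd l (fun z => potential p q z n) y) x := fun l m n =>
    pd_comm C.isOpen hx (C.smooth_potential hσ n) l m
  rw [h, h, h, hc l m n, hc m n l, hc n l m]
  ring

end EmbCoord
/-! ### Smoothness of the curvature expressions -/

section Smoothness

variable {U : Set Coord} {G Fm : Coord → Mat}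

/-- This and the following lemmas serve the density argument: both sides of the field equations must
be continuous across the axis, where no Kerr coframe exists. -/
theorem smooth_chr_of_smooth (hU : IsOpen U) (hG : SmoothMat U G) (hd : ∀ y ∈ U, (G y).det ≠ 0)
    (m : Fin 4) : SmoothMat U (chr G m) := fun l n =>
  contDiffOn_const.mul (ContDiffOn.sum fun s _ => (hG.inv hd l s).mul
    (((contDiffOn_pd hU (hG s n) m).add (contDiffOn_pd hU (hG s m) n)).sub
      (contDiffOn_pd hU (hG m n) s)))

theorem smooth_ricci (hU : IsOpen U) (hG : SmoothMat U G) (hd : ∀ y ∈ U, (G y).det ≠ 0) :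
    SmoothMat U (ricci G) := by
  have hc : ∀ l m n, ContDiffOn ℝ ∞ (christoffel G l m n) U :=
    fun l m n => smooth_chr_of_smooth hU hG hd m l n
  intro m n
  exact (ContDiffOn.sum fun l _ => (contDiffOn_pd hU (hc l m n) l).sub
      (contDiffOn_pd hU (hc l m l) n)).add
    (ContDiffOn.sum fun l _ => ContDiffOn.sum fun s _ =>
      ((hc l l s).mul (hc s m n)).sub ((hc l n s).mul (hc s m l)))

theorem smooth_einstein (hU : IsOpen U) (hG : SmoothMat U G) (hd : ∀ y ∈ U, (G y).det ≠ 0) :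
    SmoothMat U (einstein G) := by
  have hr := smooth_ricci hU hG hd
  have hs : ContDiffOn ℝ ∞ (fun y => scalarCurv G y / 2) U :=
    (ContDiffOn.sum fun m _ => ContDiffOn.sum fun n _ =>
      (hG.inv hd m n).mul (hr m n)).div_const 2
  exact hr.sub (SmoothMat.smul hs hG)

theorem smooth_raise (hG : SmoothMat U G) (hd : ∀ y ∈ U, (G y).det ≠ 0) (hF : SmoothMat U Fm) :
    SmoothMat U (raise G Fm) := by
  intro m n
  simp only [raise, Matrix.of_apply]
  exact ContDiffOn.sum fun a _ => ContDiffOn.sum fun b _ =>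
    ((hG.inv hd m a).mul (hG.inv hd n b)).mul (hF a b)

theorem smooth_stressEnergy (hG : SmoothMat U G) (hd : ∀ y ∈ U, (G y).det ≠ 0)
    (hF : SmoothMat U Fm) : SmoothMat U (stressEnergy G Fm) := fun m n =>
  contDiffOn_const.mul ((ContDiffOn.sum fun a _ => ContDiffOn.sum fun b _ =>
    ((hG.inv hd a b).mul (hF a m)).mul (hF b n)).sub
    ((contDiffOn_const.mul (hG m n)).mul (ContDiffOn.sum fun a _ => ContDiffOn.sum fun b _ =>
      (hF a b).mul (smooth_raise hG hd hF a b))))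

theorem smooth_divergence (hU : IsOpen U) (hG : SmoothMat U G) (hd : ∀ y ∈ U, (G y).det ≠ 0)
    (hF : SmoothMat U Fm) (n : Fin 4) : ContDiffOn ℝ ∞ (divergence G Fm n) U := by
  have hc : ∀ l m n, ContDiffOn ℝ ∞ (christoffel G l m n) U :=
    fun l m n => smooth_chr_of_smooth hU hG hd m l n
  have hr := smooth_raise hG hd hF
  exact (ContDiffOn.sum fun m _ => contDiffOn_pd hU (hr m n) m).add
    (ContDiffOn.sum fun m _ => ContDiffOn.sum fun s _ =>
      ((hc m m s).mul (hr s n)).add ((hc n m s).mul (hr m s)))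

end Smoothness

theorem blockMetric_det (A k l : ℝ) : (blockMetric A k l).det = -(k * l) := by
  simp [blockMetric, Matrix.det_succ_row_zero, Fin.sum_univ_succ, Fin.succAbove]

/-! ### The Kerr coframe off the axis and the field equations across it -/

namespace EmbCoord

variable {Ω : Set Coord} {q : Coord → Fin 5 → ℝ} {p : Params} {x : Coord}

theorem det_ne_zero_of_ker {e : Mat} (h : ∀ k : Fin 4 → ℝ, e.mulVec k = 0 → k = 0) :
    e.det ≠ 0 := by
  intro h0
  obtain ⟨v, hv, hv'⟩ := Matrix.exists_mulVec_eq_zero_iff.2 h0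
  exact hv (h v hv')

theorem metric_eq_frame (C : EmbCoord Ω q) (hχ : 0 < p.chi)
    (hσ : ∀ y ∈ Ω, p.sigma (q y 1) (q y 4) ≠ 0) (hx : x ∈ offAxis Ω q) :
    metric p q x = (frame p q x).transpose * p.hFrame (q x 1) (q x 4) * frame p q x := by
  ext m n
  rw [transpose_mul_mul_apply]
  exact Params.metricForm_eq_coframe hχ (hσ x hx.1) (C.onSphere x hx.1) (C.isTangent hx.1 m)
    (C.isTangent hx.1 n) hx.2

theorem field_eq_frame (C : EmbCoord Ω q) (hχ : 0 < p.chi)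
    (hσ : ∀ y ∈ Ω, p.sigma (q y 1) (q y 4) ≠ 0) (hx : x ∈ offAxis Ω q) :
    field p q x = (frame p q x).transpose * p.fieldFrame (q x 1) (q x 4) * frame p q x := by
  ext m n
  rw [transpose_mul_mul_apply]
  exact Params.fieldForm_eq_coframe hχ (hσ x hx.1) (C.onSphere x hx.1) (C.isTangent hx.1 m)
    (C.isTangent hx.1 n) hx.2

/-- The combination `∑ k^m ∂_m` of the coordinate vectors. -/
def comb (q : Coord → Fin 5 → ℝ) (y : Coord) (k : Fin 4 → ℝ) (i : Fin 5) : ℝ :=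
  ∑ m, tanVec q y m i * k m

theorem coframe_comb (y : Coord) (k : Fin 4 → ℝ) (j : Fin 4) :
    ∑ m, p.coframe (q y) (tanVec q y m) j * k m = p.coframe (q y) (comb q y k) j := by
  fin_cases j <;>
    simp only [Fin.zero_eta, Fin.mk_one, Fin.reduceFinMk, Params.coframe, Params.alpha, Params.tau,
      comb, Fin.sum_univ_four, Matrix.cons_val] <;> ring

theorem isTangent_comb (C : EmbCoord Ω q) (hx : x ∈ Ω) (k : Fin 4 → ℝ) :
    Params.IsTangent (q x) (comb q x k) := by
  have h := fun m => C.isTangent hx m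
  simp only [Params.IsTangent] at h
  have := fun m => congrArg (· * k m) (h m)
  simp only [Params.IsTangent, comb, Fin.sum_univ_four]
  linear_combination this 0 + this 1 + this 2 + this 3

/-- A vector killed by the coframe is killed by `sin² θ (aα - β) = Σ τ`, hence by `τ` as `Σ ≠ 0`.
Then `dv`, `dr`, `dz` and `τ` all vanish on it, and off the axis these determine a tangent vector.
-/
theorem det_frame (C : EmbCoord Ω q) (hχ : 0 < p.chi)
    (hσ : p.sigma (q x 1) (q x 4) ≠ 0) (hx : x ∈ offAxis Ω q) : (frame p q x).det ≠ 0 := by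
  refine det_ne_zero_of_ker fun k hk => C.inj x hx.1 k ?_
  set v := comb q x k with hv
  change ∀ i, v i = 0
  have hc : ∀ j, p.coframe (q x) v j = 0 := fun j => by
    rw [hv, ← coframe_comb]
    exact congrFun hk j
  have ht := C.isTangent_comb hx.1 k
  rw [← hv] at ht
  have hs := hx.2
  have hχ' := inv_ne_zero hχ.ne'
  have c0 : p.alpha (q x) v = 0 := (mul_eq_zero.1 (hc 0)).resolve_right hχ'
  have c1 : v 1 = 0 := hc 1
  have c2 : v 4 = 0 := hc 2
  have c3 : p.a * (v 0 + v 1) - (q x 1 ^ 2 + p.a ^ 2) *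
    (Params.tau (q x) v * (1 - q x 4 ^ 2)⁻¹) = 0 := (mul_eq_zero.1 (hc 3)).resolve_right hχ'
  have hτ : Params.tau (q x) v = 0 := by
    field_simp at c3
    have h1 : p.sigma (q x 1) (q x 4) * Params.tau (q x) v = 0 := by
      unfold Params.alpha at c0
      unfold Params.sigma
      linear_combination p.a * (1 - q x 4 ^ 2) * c0 - c3
    exact (mul_eq_zero.1 h1).resolve_left hσ
  have h0 : v 0 = 0 := by
    unfold Params.alpha at c0
    rw [hτ, c1] at c0; linarith
  have hq := C.onSphere x hx.1
  unfold Params.IsTangent at ht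
  unfold Params.tau at hτ
  unfold Params.OnSphere at hq
  rw [c2] at ht
  -- In the `(x, y)`-plane both the radial part, fixed by tangency and `dz`, and the angular part
  -- `τ` vanish; `x² + y² = 1 - z² ≠ 0` recovers the components.
  have hx2 : (1 - q x 4 ^ 2) * v 2 = 0 := by linear_combination -v 2 * hq + q x 2 * ht - q x 3 * hτ
  have hx3 : (1 - q x 4 ^ 2) * v 3 = 0 := by linear_combination -v 3 * hq + q x 3 * ht + q x 2 * hτ
  intro i
  fin_cases i
  · exact h0
  · exact c1
  · exact (mul_eq_zero.1 hx2).resolve_left hs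
  · exact (mul_eq_zero.1 hx3).resolve_left hs
  · exact c2

theorem smooth_frame (C : EmbCoord Ω q) : SmoothMat (offAxis Ω q) (frame p q) := by
  have C' := C.offAxis_embCoord
  have hs : ContDiffOn ℝ ∞ (fun y => (1 - q y 4 ^ 2)⁻¹) (offAxis Ω q) :=
    (contDiffOn_const.sub ((C'.smooth 4).pow 2)).inv fun y hy => hy.2
  have h1 := C'.smooth 1
  intro j m
  have hv := C'.smooth_tanVec m
  have hv0 := hv 0; have hv1 := hv 1; have hv4 := hv 4
  have ht := C'.smooth_tau m
  have ha := C'.smooth_alpha (p := p) m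
  fin_cases j <;>
    simp only [Fin.zero_eta, Fin.mk_one, Fin.reduceFinMk, frame, Params.coframe, Matrix.of_apply,
      Matrix.cons_val] <;> fun_prop

/-- The structure equations reduce to `dα = -2a dx ∧ dy`, rewritten by `area_eq`, and to the
closedness of `dφ̄ = τ/sin² θ`. -/
theorem kerrCoframe (C : EmbCoord Ω q) (hχ : 0 < p.chi)
    (hσ : ∀ y ∈ Ω, p.sigma (q y 1) (q y 4) ≠ 0) :
    KerrCoframe p (offAxis Ω q) (fun y => q y 1) (fun y => q y 4) (frame p q) where
  isOpen := C.offAxis_isOpen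
  smooth_r := C.offAxis_embCoord.smooth 1
  smooth_c := C.offAxis_embCoord.smooth 4
  smooth_e := C.smooth_frame
  sigma_ne y hy := hσ y hy.1
  pTheta_ne y hy := mul_ne_zero (Params.deltaTheta_pos hχ (C.onSphere y hy.1).sq_le).ne' hy.2
  det_e y hy := C.det_frame hχ (hσ y hy.1) hy
  row_one _ _ _ := rfl
  row_two _ _ _ := rfl
  d_zero y hy m n := by
    have hs := hy.2
    have hS := hσ y hy.1
    have hχ0 := hχ.ne'
    have j : ∀ n m, pd m (fun z => frame p q z 0 n) y
        = pd m (fun z => p.alpha (q z) (tanVec q z n)) y * p.chi⁻¹ := fun n m =>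
      (((Jet.of_contDiffOn C.isOpen hy.1 (C.smooth_alpha n)).mul (Jet.const p.chi⁻¹)).pd_eq m).trans
        (by ring)
    have h := C.d_alpha (p := p) hy.1 m n
    have ha := Params.area_eq (C.onSphere y hy.1) (C.isTangent hy.1 m) (C.isTangent hy.1 n)
    rw [j, j, ← sub_mul, h]
    simp only [frame, Params.coframe, Matrix.of_apply, Matrix.cons_val, Params.alpha]
    have hσ' : p.sigma (q y 1) (q y 4) = q y 1 ^ 2 + p.a ^ 2 * q y 4 ^ 2 := rfl
    field_simp
    rw [hσ']
    linear_combination (-(p.a * (q y 1 ^ 2 + p.a ^ 2 * q y 4 ^ 2))) * ha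
  d_three y hy m n := by
    have hs := hy.2
    have hS := hσ y hy.1
    have hχ0 := hχ.ne'
    have hsj : Jet (fun z => (1 - q z 4 ^ 2)⁻¹)
        (fun m => 2 * q y 4 * tanVec q y m 4 * (1 - q y 4 ^ 2)⁻¹ ^ 2) y :=
      (((Jet.const 1).sub ((C.jet_q hy.1 4).pow 2)).inv hs).congr fun m => by simp
    have j : ∀ n m, pd m (fun z => frame p q z 3 n) y
        = (p.a * (pd m (fun y => tanVec q y n 0) y + pd m (fun y => tanVec q y n 1) y)
          - (2 * q y 1 * tanVec q y m 1 * (Params.tau (q y) (tanVec q y n) * (1 - q y 4 ^ 2)⁻¹)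
          + (q y 1 ^ 2 + p.a ^ 2) * (pd m (fun z => Params.tau (q z) (tanVec q z n)) y
            * (1 - q y 4 ^ 2)⁻¹ + Params.tau (q y) (tanVec q y n) *
            (2 * q y 4 * tanVec q y m 4 * (1 - q y 4 ^ 2)⁻¹ ^ 2)))) * p.chi⁻¹ := by
      intro n m
      refine ((((Jet.const p.a).mul ((C.jet_tanVec hy.1 n 0).add (C.jet_tanVec hy.1 n 1))).sub
        ((((C.jet_q hy.1 1).pow 2).add (Jet.const (p.a ^ 2))).mul
        ((Jet.of_contDiffOn C.isOpen hy.1 (C.smooth_tau n)).mul hsj))).mul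
        (Jet.const p.chi⁻¹) |>.pd_eq m).trans ?_
      simp
    have h := C.d_tau hy.1 m n
    have ha := Params.area_eq (C.onSphere y hy.1) (C.isTangent hy.1 m) (C.isTangent hy.1 n)
    -- This says `sin² θ dτ = d(sin² θ) ∧ τ`, that is, `τ/sin² θ` is closed.
    have h' : (1 - q y 4 ^ 2) * (pd m (fun y => Params.tau (q y) (tanVec q y n)) y
        - pd n (fun y => Params.tau (q y) (tanVec q y m)) y)
        = -(2 * q y 4 * (tanVec q y m 4 * Params.tau (q y) (tanVec q y n)
          - tanVec q y n 4 * Params.tau (q y) (tanVec q y m))) := by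
      rw [h]; linear_combination 2 * ha
    rw [j, j, C.pd_tanVec_comm hy.1 m n 0, C.pd_tanVec_comm hy.1 m n 1]
    simp only [frame, Params.coframe, Matrix.of_apply, Matrix.cons_val, Params.alpha]
    have hσ' : p.sigma (q y 1) (q y 4) = q y 1 ^ 2 + p.a ^ 2 * q y 4 ^ 2 := rfl
    field_simp
    rw [hσ']
    linear_combination (-(q y 1 ^ 2 + p.a ^ 2) * (q y 1 ^ 2 + p.a ^ 2 * q y 4 ^ 2)) * h'

/-- The metric in normal form. -/
theorem exists_block (C : EmbCoord Ω q) (hχ : 0 < p.chi)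
    (hσ : ∀ y ∈ Ω, p.sigma (q y 1) (q y 4) ≠ 0) (hx : x ∈ Ω) :
    ∃ (e : Mat) (A k l : ℝ), e.det ≠ 0 ∧ 0 < k ∧ 0 < l ∧
      metric p q x = e.transpose * blockMetric A k l * e := by
  have hσ0 : 0 < p.sigma (q x 1) (q x 4) :=
    lt_of_le_of_ne (by unfold Params.sigma; positivity) (hσ x hx).symm
  have hd := Params.deltaTheta_pos hχ (C.onSphere x hx).sq_le
  -- On the axis the coframe breaks down. There `x = y = 0` kills `τ`, and `dz` vanishes on tangent
  -- vectors, so `dv/χ, dr, dx, dy` bring the metric to block form.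
  by_cases hs : 1 - q x 4 ^ 2 = 0
  · obtain ⟨h2, h3⟩ := eq_zero_of_axis (C.onSphere x hx) hs
    have h4 : q x 4 ≠ 0 := fun h => by rw [h] at hs; norm_num at hs
    have hv4 : ∀ v, Params.IsTangent (q x) v → v 4 = 0 := fun v hv => by
      unfold Params.IsTangent at hv
      rw [h2, h3, zero_mul, zero_mul, zero_add, zero_add] at hv
      exact (mul_eq_zero.1 hv).resolve_left h4
    have hχ' := inv_ne_zero hχ.ne'
    refine ⟨Matrix.of fun k m => (![(tanVec q x m 0 + tanVec q x m 1) * p.chi⁻¹, tanVec q x m 1,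
      tanVec q x m 2, tanVec q x m 3] : Fin 4 → ℝ) k, p.deltaR (q x 1) * (p.sigma (q x 1) (q x 4))⁻¹,
      p.sigma (q x 1) (q x 4) * (p.deltaTheta (q x 4))⁻¹,
      p.sigma (q x 1) (q x 4) * (p.deltaTheta (q x 4))⁻¹, ?_, by positivity, by positivity, ?_⟩
    · refine det_ne_zero_of_ker fun k hk => C.inj x hx k ?_
      have e0 := congrFun hk 0
      have e1 := congrFun hk 1
      have e2 := congrFun hk 2
      have e3 := congrFun hk 3
      simp only [Matrix.mulVec, dotProduct, Matrix.of_apply, Matrix.cons_val, Pi.zero_apply]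
        at e0 e1 e2 e3
      have e0' : (∑ m, tanVec q x m 0 * k m) * p.chi⁻¹ = 0 := by
        simp only [Fin.sum_univ_four] at e0 e1 ⊢
        linear_combination e0 - p.chi⁻¹ * e1
      intro i
      fin_cases i
      · exact (mul_eq_zero.1 e0').resolve_right hχ'
      · exact e1
      · exact e2
      · exact e3
      · exact hv4 _ (C.isTangent_comb hx k)
    · ext m n
      rw [transpose_mul_mul_apply]
      simp only [metric, blockMetric, Matrix.of_apply, Params.metricForm, Params.alpha, Params.tau,
        h2, h3, hs, hv4 _ (C.isTangent hx m), hv4 _ (C.isTangent hx n), Fin.sum_univ_four,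
        Matrix.cons_val]
      ring
  · have hs' : 0 < 1 - q x 4 ^ 2 :=
      lt_of_le_of_ne (by linarith [(C.onSphere x hx).sq_le]) (Ne.symm hs)
    have hP : 0 < p.pTheta (q x 4) := mul_pos hd hs'
    exact ⟨frame p q x, _, _, _, C.det_frame hχ (hσ x hx) ⟨hx, hs⟩,
      mul_pos hσ0 (inv_pos.2 hP), mul_pos hP (inv_pos.2 hσ0),
      C.metric_eq_frame hχ hσ ⟨hx, hs⟩⟩

theorem det_metric (C : EmbCoord Ω q) (hχ : 0 < p.chi)
    (hσ : ∀ y ∈ Ω, p.sigma (q y 1) (q y 4) ≠ 0) (hx : x ∈ Ω) : (metric p q x).det ≠ 0 := by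
  obtain ⟨e, A, k, l, he, hk, hl, h⟩ := C.exists_block hχ hσ hx
  rw [h, Matrix.det_mul, Matrix.det_mul, Matrix.det_transpose, blockMetric_det]
  exact mul_ne_zero (mul_ne_zero he (neg_ne_zero.2 (mul_pos hk hl).ne')) he

/-- The frame computation proves the equation off the axis. The difference of the two sides is
continuous and the off-axis points are dense. -/
theorem einsteinMaxwell (C : EmbCoord Ω q) (hχ : 0 < p.chi)
    (hσ : ∀ y ∈ Ω, p.sigma (q y 1) (q y 4) ≠ 0) (hx : x ∈ Ω) :
    einstein (metric p q) x + p.Λ • metric p q x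
      = (8 * Real.pi) • stressEnergy (metric p q) (field p q) x := by
  have hG := C.smooth_metric hχ hσ
  have hF := C.smooth_field hσ
  have hd := fun y hy => C.det_metric hχ hσ (x := y) hy
  have hs := ((smooth_einstein C.isOpen hG hd).add (SmoothMat.smul (f := fun _ => p.Λ)
    contDiffOn_const hG)).sub (SmoothMat.smul (f := fun _ => 8 * Real.pi) contDiffOn_const
    (smooth_stressEnergy hG hd hF))
  rw [← sub_eq_zero]
  ext i j
  refine mem_of_dense C.isOpen C.dense_offAxis (hs i j).continuousOn (fun y hy => ?_) x hx
  have := (C.kerrCoframe hχ hσ).einsteinMaxwell (fun z hz => C.metric_eq_frame hχ hσ hz)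
    (fun z hz => C.field_eq_frame hχ hσ hz) hy
  rw [← sub_eq_zero] at this
  exact congrFun (congrFun this i) j

theorem divergence_eq_zero (C : EmbCoord Ω q) (hχ : 0 < p.chi)
    (hσ : ∀ y ∈ Ω, p.sigma (q y 1) (q y 4) ≠ 0) (hx : x ∈ Ω) (n : Fin 4) :
    divergence (metric p q) (field p q) n x = 0 := by
  have hG := C.smooth_metric hχ hσ
  have hF := C.smooth_field hσ
  have hd := fun y hy => C.det_metric hχ hσ (x := y) hy
  refine mem_of_dense C.isOpen C.dense_offAxis
    (smooth_divergence C.isOpen hG hd hF n).continuousOn (fun y hy => ?_) x hx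
  exact (C.kerrCoframe hχ hσ).divergence_eq_zero (fun z hz => C.metric_eq_frame hχ hσ hz)
    (fun z hz => C.field_eq_frame hχ hσ hz) (hF.mono fun z hz => hz.1) hy n

end EmbCoord
/-! ### The embedding of `ℝ² × S²` in `ℝ² × ℝ³` -/

/-- The embedding `(t̄, r, n) ↦ (t̄, r, n)`. -/
def emb (p : Spacetime) : Fin 5 → ℝ :=
  ![p.1, p.2.1, (p.2.2 : EuclideanSpace ℝ (Fin 3)) 0, (p.2.2 : EuclideanSpace ℝ (Fin 3)) 1,
    (p.2.2 : EuclideanSpace ℝ (Fin 3)) 2]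

/-- The inclusion of `ℝ² × S²` in `ℝ² × ℝ³`, the latter as a product of normed spaces. -/
def incl (p : Spacetime) : ℝ × ℝ × EuclideanSpace ℝ (Fin 3) := (p.1, p.2.1, p.2.2)

/-- The coordinates of `ℝ² × ℝ³`. -/
def unprod : (ℝ × ℝ × EuclideanSpace ℝ (Fin 3)) →L[ℝ] (Fin 5 → ℝ) :=
  ContinuousLinearMap.pi ![ContinuousLinearMap.fst ℝ _ _,
    (ContinuousLinearMap.fst ℝ _ _).comp (ContinuousLinearMap.snd ℝ _ _),
    ((EuclideanSpace.proj (𝕜 := ℝ) (0 : Fin 3)).comp (ContinuousLinearMap.snd ℝ _ _)).comp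
      (ContinuousLinearMap.snd ℝ _ _),
    ((EuclideanSpace.proj (𝕜 := ℝ) (1 : Fin 3)).comp (ContinuousLinearMap.snd ℝ _ _)).comp
      (ContinuousLinearMap.snd ℝ _ _),
    ((EuclideanSpace.proj (𝕜 := ℝ) (2 : Fin 3)).comp (ContinuousLinearMap.snd ℝ _ _)).comp
      (ContinuousLinearMap.snd ℝ _ _)]

theorem emb_eq : emb = fun p => unprod (incl p) := by
  ext p i; fin_cases i <;> rfl

theorem unprod_injective : Function.Injective unprod := by
  rw [injective_iff_map_eq_zero]
  rintro ⟨a, b, v⟩ h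
  have h' := fun i => congrFun h i
  have h0 := h' 0; have h1 := h' 1; have h2 := h' 2; have h3 := h' 3; have h4 := h' 4
  simp only [unprod, ContinuousLinearMap.pi_apply, Matrix.cons_val, Pi.zero_apply] at h0 h1 h2 h3 h4
  refine Prod.ext h0 (Prod.ext h1 ?_)
  ext i; fin_cases i
  exacts [h2, h3, h4]

theorem fact_finrank : Fact (Module.finrank ℝ (EuclideanSpace ℝ (Fin 3)) = 2 + 1) := ⟨by simp⟩

theorem contMDiff_sphere_val : ContMDiff (𝓡 2) 𝓘(ℝ, EuclideanSpace ℝ (Fin 3)) ∞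
    (Subtype.val : Metric.sphere (0 : EuclideanSpace ℝ (Fin 3)) 1 → EuclideanSpace ℝ (Fin 3)) :=
  @contMDiff_coe_sphere _ _ _ _ 2 fact_finrank

theorem contMDiff_incl :
    ContMDiff model 𝓘(ℝ, ℝ × ℝ × EuclideanSpace ℝ (Fin 3)) ∞ incl := by
  have h1 : ContMDiff model 𝓘(ℝ, ℝ) ∞ (fun p : Spacetime => p.1) := contMDiff_fst
  have h2 : ContMDiff model 𝓘(ℝ, ℝ) ∞ (fun p : Spacetime => p.2.1) :=
    contMDiff_fst.comp contMDiff_snd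
  have h3 : ContMDiff model 𝓘(ℝ, EuclideanSpace ℝ (Fin 3)) ∞
      (fun p : Spacetime => (p.2.2 : EuclideanSpace ℝ (Fin 3))) :=
    contMDiff_sphere_val.comp (contMDiff_snd.comp contMDiff_snd)
  exact h1.prodMk_space (h2.prodMk_space h3)

theorem contMDiff_emb : ContMDiff model 𝓘(ℝ, Fin 5 → ℝ) ∞ emb := by
  rw [emb_eq]; exact unprod.contDiff.contMDiff.comp contMDiff_incl

theorem mfderiv_incl_injective (p : Spacetime) : Function.Injective
    (mfderiv model 𝓘(ℝ, ℝ × ℝ × EuclideanSpace ℝ (Fin 3)) incl p) := by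
  have hs : HasMFDerivAt (𝓡 2) 𝓘(ℝ, EuclideanSpace ℝ (Fin 3))
      (Subtype.val : Metric.sphere (0 : EuclideanSpace ℝ (Fin 3)) 1 → EuclideanSpace ℝ (Fin 3)) p.2.2
      (mfderiv (𝓡 2) 𝓘(ℝ, EuclideanSpace ℝ (Fin 3)) Subtype.val p.2.2) :=
    (contMDiff_sphere_val.mdifferentiable (by simp) _).hasMFDerivAt
  have h1 : HasMFDerivAt model 𝓘(ℝ, ℝ) (fun p : Spacetime => p.1) p _ := hasMFDerivAt_fst p
  have h2 : HasMFDerivAt model 𝓘(ℝ, ℝ) (fun p : Spacetime => p.2.1) p _ :=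
    (hasMFDerivAt_fst p.2).comp p (hasMFDerivAt_snd p)
  have h3 : HasMFDerivAt model 𝓘(ℝ, EuclideanSpace ℝ (Fin 3))
      (fun p : Spacetime => (p.2.2 : EuclideanSpace ℝ (Fin 3))) p _ :=
    hs.comp p ((hasMFDerivAt_snd p.2).comp p (hasMFDerivAt_snd p))
  have h : HasMFDerivAt model 𝓘(ℝ, ℝ × ℝ × EuclideanSpace ℝ (Fin 3)) incl p _ :=
    ⟨h1.1.prodMk (h2.1.prodMk h3.1), h1.2.prodMk (h2.2.prodMk h3.2)⟩
  have h' := h.mfderiv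
  rw [h']
  rintro ⟨a, b, v⟩ ⟨a', b', v'⟩ h0
  have ha : a = a' := congrArg Prod.fst h0
  have hb : b = b' := congrArg (fun z => Prod.fst (Prod.snd z)) h0
  have hv : v = v' := @mfderiv_coe_sphere_injective _ _ _ 2 fact_finrank p.2.2 _ _
    (congrArg (fun z => Prod.snd (Prod.snd z)) h0)
  rw [ha, hb, hv]

/-- The differential of `emb`. -/
def embDeriv (p : Spacetime) : TangentSpace model p →ₗ[ℝ] (Fin 5 → ℝ) :=
  (mfderiv model 𝓘(ℝ, Fin 5 → ℝ) emb p).toLinearMap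

theorem embDeriv_injective (p : Spacetime) : Function.Injective (embDeriv p) := by
  have h : mfderiv model 𝓘(ℝ, Fin 5 → ℝ) emb p
      = unprod.comp (mfderiv model 𝓘(ℝ, ℝ × ℝ × EuclideanSpace ℝ (Fin 3)) incl p) := by
    rw [emb_eq]
    exact (unprod.hasMFDerivAt.comp p
      ((contMDiff_incl.mdifferentiable (by simp)) p).hasMFDerivAt).mfderiv
  have h' : ⇑(embDeriv p) = fun v => unprod
    (mfderiv model 𝓘(ℝ, ℝ × ℝ × EuclideanSpace ℝ (Fin 3)) incl p v) := by
    ext v; simp only [embDeriv, h]; rfl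
  rw [h']
  exact unprod_injective.comp (mfderiv_incl_injective p)

theorem onSphere_emb (p : Spacetime) : Params.OnSphere (emb p) := by
  have h := p.2.2.2
  simp only [mem_sphere_iff_norm, sub_zero, EuclideanSpace.norm_eq, Real.sqrt_eq_one,
    Fin.sum_univ_three, Real.norm_eq_abs, sq_abs] at h
  exact h

theorem mdifferentiableAt_emb (p : Spacetime) : MDifferentiableAt model 𝓘(ℝ, Fin 5 → ℝ) emb p :=
  contMDiff_emb.mdifferentiable (by simp) p

/-- The bridge from the manifold to calculus on `ℝ⁴`: in any coordinates the components of the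
fields are those of the ambient forms on the partial derivatives of five scalar functions. -/
theorem embDeriv_coordVec {ψ : Coord → Spacetime} {x : Coord}
    (hψ : MDifferentiableAt 𝓘(ℝ, Coord) model ψ x) (m : Fin 4) :
    embDeriv (ψ x) (coordVec model ψ x m) = tanVec (fun y => emb (ψ y)) x m := by
  have h := ((mdifferentiableAt_emb (ψ x)).hasMFDerivAt.comp x hψ.hasMFDerivAt)
  have h' := h.hasFDerivAt
  ext i
  have hi := (hasFDerivAt_pi'.1 h') i
  simp only [tanVec, pd]
  have hi' : fderiv ℝ (fun y => emb (ψ y) i) x = _ := hi.fderiv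
  rw [hi']
  rfl

theorem IsCoordinates.mdifferentiableAt {V : Set Spacetime} {Ω : Set Coord} {ψ : Coord → Spacetime}
    (h : IsCoordinates model V Ω ψ) {x : Coord} (hx : x ∈ Ω) :
    MDifferentiableAt 𝓘(ℝ, Coord) model ψ x :=
  (h.2.2.1.contMDiffAt (h.1.mem_nhds hx)).mdifferentiableAt (by simp)

theorem IsCoordinates.embCoord {V : Set Spacetime} {Ω : Set Coord} {ψ : Coord → Spacetime}
    (h : IsCoordinates model V Ω ψ) : EmbCoord Ω (fun y => emb (ψ y)) where
  isOpen := h.1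
  smooth i := by
    have h1 : ContMDiffOn 𝓘(ℝ, Coord) 𝓘(ℝ, Fin 5 → ℝ) ∞ (fun y => emb (ψ y)) Ω :=
      contMDiff_emb.comp_contMDiffOn h.2.2.1
    exact contDiffOn_pi.1 h1.contDiffOn i
  onSphere y _ := onSphere_emb _
  inj y hy k hk := by
    have hd := h.mdifferentiableAt hy
    have h1 : embDeriv (ψ y) (mfderiv 𝓘(ℝ, Coord) model ψ y k) = 0 := by
      have hk' : (k : Coord) = ∑ m, k m • (Pi.single m (1 : ℝ) : Coord) := by
        ext i; simp [Pi.single_apply]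
      have h2 : mfderiv 𝓘(ℝ, Coord) model ψ y k
          = ∑ m, k m • coordVec model ψ y m := by
        conv_lhs => rw [hk']
        erw [map_sum]
        exact Finset.sum_congr rfl fun m _ => ContinuousLinearMap.map_smul _ _ _
      rw [h2, map_sum]
      ext i
      rw [Finset.sum_apply]
      refine Eq.trans (Finset.sum_congr rfl fun m _ => ?_) (hk i)
      rw [map_smul, embDeriv_coordVec hd]
      exact mul_comm _ _
    have h3 := (map_eq_zero_iff _ (embDeriv_injective (ψ y))).1 h1
    exact (map_eq_zero_iff _ (h.2.2.2 y hy).1).1 h3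

/-! ### The curvature expressions are local -/

section Local

variable {U : Set Coord} {G G' F F' : Coord → Mat} {x : Coord}

/-- The component functions agree with the ambient expressions only on the coordinate domain. That
suffices because partial derivatives depend on germs. -/
theorem chr_congr (hU : IsOpen U) (hx : x ∈ U) (h : ∀ y ∈ U, G y = G' y) (m : Fin 4) :
    chr G m x = chr G' m x := by
  ext l n
  have hp := fun i j k => pd_congr hU hx (fun y hy => congrFun (congrFun (h y hy) i) j) k
  simp only [chr, christoffel, Matrix.of_apply, h x hx, hp]

theorem christoffel_congr (hU : IsOpen U) (hx : x ∈ U) (h : ∀ y ∈ U, G y = G' y) (l m n : Fin 4) :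
    christoffel G l m n x = christoffel G' l m n x :=
  congrFun (congrFun (chr_congr hU hx h m) l) n

theorem ricci_congr (hU : IsOpen U) (hx : x ∈ U) (h : ∀ y ∈ U, G y = G' y) :
    ricci G x = ricci G' x := by
  ext m n
  have hc := christoffel_congr hU hx h
  have hp := fun i j l k => pd_congr hU hx (fun y hy => christoffel_congr hU hy h i j l) k
  simp only [ricci, Matrix.of_apply, hc, hp]

theorem einstein_congr (hU : IsOpen U) (hx : x ∈ U) (h : ∀ y ∈ U, G y = G' y) :
    einstein G x = einstein G' x := by
  simp only [einstein, scalarCurv, ricci_congr hU hx h, h x hx]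

theorem raise_congr (h : G x = G' x) (h' : F x = F' x) : raise G F x = raise G' F' x := by
  simp only [raise, h, h']

theorem stressEnergy_congr (h : G x = G' x) (h' : F x = F' x) :
    stressEnergy G F x = stressEnergy G' F' x := by
  simp only [stressEnergy, raise_congr h h', h, h']

theorem divergence_congr (hU : IsOpen U) (hx : x ∈ U) (h : ∀ y ∈ U, G y = G' y)
    (h' : ∀ y ∈ U, F y = F' y) (n : Fin 4) : divergence G F n x = divergence G' F' n x := by
  have hc := christoffel_congr hU hx h
  have hp := fun i j k => pd_congr hU hx
    (fun y hy => congrFun (congrFun (raise_congr (h y hy) (h' y hy)) i) j) k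
  simp only [divergence, raise_congr (h x hx) (h' x hx), hc, hp]

end Local

/-! ### The tensor fields on `ℝ² × S²` -/

namespace Params

variable (P : Params)

/-- The metric. -/
def metricField : BilinField model Spacetime := fun p =>
  (LinearMap.mk₂ ℝ (P.metricForm (emb p))
    (fun u v w => by simp only [metricForm, alpha, tau, Pi.add_apply]; ring)
    (fun c v w => by simp only [metricForm, alpha, tau, Pi.smul_apply, smul_eq_mul]; ring)
    (fun u v w => by simp only [metricForm, alpha, tau, Pi.add_apply]; ring)
    (fun c v w => by simp only [metricForm, alpha, tau, Pi.smul_apply, smul_eq_mul]; ring)).compl₁₂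
    (embDeriv p) (embDeriv p)

/-- The electromagnetic field. -/
def emField : BilinField model Spacetime := fun p =>
  (LinearMap.mk₂ ℝ (P.fieldForm (emb p))
    (fun u v w => by simp only [fieldForm, dPotFun, alpha, tau, Pi.add_apply]; ring)
    (fun c v w => by
      simp only [fieldForm, dPotFun, alpha, tau, Pi.smul_apply, smul_eq_mul]; ring)
    (fun u v w => by simp only [fieldForm, dPotFun, alpha, tau, Pi.add_apply]; ring)
    (fun c v w => by
      simp only [fieldForm, dPotFun, alpha, tau, Pi.smul_apply, smul_eq_mul]; ring)).compl₁₂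
    (embDeriv p) (embDeriv p)

/-- The potential. -/
def potentialField : CovectorField model Spacetime := fun p =>
  (IsLinearMap.mk' (P.potForm (emb p))
    ⟨fun v w => by simp only [potForm, alpha, tau, Pi.add_apply]; ring,
      fun c v => by simp only [potForm, alpha, tau, Pi.smul_apply, smul_eq_mul]; ring⟩).comp
    (embDeriv p)

variable {P} {V : Set Spacetime} {Ω : Set Coord} {ψ : Coord → Spacetime} {x : Coord}

theorem metricField_comp (hψ : MDifferentiableAt 𝓘(ℝ, Coord) model ψ x) :
    P.metricField.comp ψ x = EmbCoord.metric P (fun y => emb (ψ y)) x := by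
  ext m n
  change P.metricForm (emb (ψ x)) (embDeriv (ψ x) (coordVec model ψ x m))
    (embDeriv (ψ x) (coordVec model ψ x n)) = _
  rw [embDeriv_coordVec hψ, embDeriv_coordVec hψ]; rfl

theorem emField_comp (hψ : MDifferentiableAt 𝓘(ℝ, Coord) model ψ x) :
    P.emField.comp ψ x = EmbCoord.field P (fun y => emb (ψ y)) x := by
  ext m n
  change P.fieldForm (emb (ψ x)) (embDeriv (ψ x) (coordVec model ψ x m))
    (embDeriv (ψ x) (coordVec model ψ x n)) = _
  rw [embDeriv_coordVec hψ, embDeriv_coordVec hψ]; rfl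

theorem potentialField_comp (hψ : MDifferentiableAt 𝓘(ℝ, Coord) model ψ x) :
    P.potentialField.comp ψ x = EmbCoord.potential P (fun y => emb (ψ y)) x := by
  ext m
  change P.potForm (emb (ψ x)) (embDeriv (ψ x) (coordVec model ψ x m)) = _
  rw [embDeriv_coordVec hψ]; rfl

theorem emField_antisymm (p : Spacetime) (v w : TangentSpace model p) :
    P.emField p v w = -P.emField p w v := by
  change P.fieldForm (emb p) (embDeriv p v) (embDeriv p w)
    = -P.fieldForm (emb p) (embDeriv p w) (embDeriv p v)
  simp only [fieldForm]; ring

theorem sigma_emb_ne (h : IsCoordinates model P.regularSet Ω ψ) :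
    ∀ y ∈ Ω, P.sigma ((fun y => emb (ψ y)) y 1) ((fun y => emb (ψ y)) y 4) ≠ 0 :=
  fun _ hy => h.2.1 hy

theorem smoothOn_metricField (hχ : 0 < P.chi) : P.metricField.SmoothOn P.regularSet :=
  fun _ _ h m n => (h.embCoord.smooth_metric hχ (sigma_emb_ne h) m n).congr fun _ hy =>
    by rw [metricField_comp (h.mdifferentiableAt hy)]

theorem isTwoFormOn_emField : IsTwoFormOn P.emField P.regularSet :=
  ⟨fun _ _ h m n => (h.embCoord.smooth_field (sigma_emb_ne h) m n).congr fun _ hy =>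
    by rw [emField_comp (h.mdifferentiableAt hy)], fun p _ => emField_antisymm p⟩

theorem smoothOn_potentialField : P.potentialField.SmoothOn P.regularSet :=
  fun _ _ h m => (h.embCoord.smooth_potential (sigma_emb_ne h) m).congr fun _ hy =>
    by rw [potentialField_comp (h.mdifferentiableAt hy)]

theorem isExtDerOn_emField : IsExtDerOn P.emField P.potentialField P.regularSet := by
  intro Ω ψ h x hx
  rw [emField_comp (h.mdifferentiableAt hx), h.embCoord.field_eq_extDer hx (sigma_emb_ne h x hx)]
  have hc := fun n => pd_congr h.1 hx fun y hy =>
    congrFun (potentialField_comp (P := P) (h.mdifferentiableAt hy)) n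
  ext m n
  simp only [extDer, Matrix.of_apply, hc]

theorem vacuumMaxwellOn_emField (hχ : 0 < P.chi) :
    VacuumMaxwellOn P.metricField P.emField P.regularSet := by
  intro Ω ψ h x hx
  have hg : ∀ y ∈ Ω, P.metricField.comp ψ y = _ := fun y hy =>
    metricField_comp (h.mdifferentiableAt hy)
  have hF : ∀ y ∈ Ω, P.emField.comp ψ y = _ := fun y hy => emField_comp (h.mdifferentiableAt hy)
  refine ⟨fun l m n => ?_, fun n => ?_⟩
  · rw [pd_congr h.1 hx fun y hy => congrFun (congrFun (hF y hy) m) n,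
      pd_congr h.1 hx fun y hy => congrFun (congrFun (hF y hy) n) l,
      pd_congr h.1 hx fun y hy => congrFun (congrFun (hF y hy) l) m]
    exact h.embCoord.field_closed (sigma_emb_ne h) hx l m n
  · rw [divergence_congr h.1 hx hg hF]
    exact h.embCoord.divergence_eq_zero hχ (sigma_emb_ne h) hx n

theorem einsteinMaxwellOn_metricField (hχ : 0 < P.chi) :
    EinsteinMaxwellOn P.Λ P.metricField P.emField P.regularSet := by
  intro Ω ψ h x hx
  have hg : ∀ y ∈ Ω, P.metricField.comp ψ y = _ := fun y hy =>
    metricField_comp (h.mdifferentiableAt hy)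
  have hF : ∀ y ∈ Ω, P.emField.comp ψ y = _ := fun y hy => emField_comp (h.mdifferentiableAt hy)
  rw [einstein_congr h.1 hx hg, hg x hx, stressEnergy_congr (hg x hx) (hF x hx)]
  exact h.embCoord.einsteinMaxwell hχ (sigma_emb_ne h) hx

end Params
/-! ### Local coordinates and nondegeneracy -/

/-- The inverse chart, after a linear identification of its model space with `ℝ⁴`. The left inverse
`ξ` need only be continuous: it transports continuity of components back to the manifold. -/
theorem exists_isCoordinates {V : Set Spacetime} (hV : IsOpen V) {p : Spacetime} (hp : p ∈ V) :
    ∃ (Ω : Set Coord) (ψ : Coord → Spacetime) (ξ : Spacetime → Coord),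
      IsCoordinates model V Ω ψ ∧ ContinuousAt ξ p ∧
        ∀ᶠ q in nhds p, ξ q ∈ Ω ∧ ψ (ξ q) = q := by
  let L : Coord ≃L[ℝ] (ℝ × ℝ × EuclideanSpace ℝ (Fin 2)) :=
    ContinuousLinearEquiv.ofFinrankEq (by simp)
  let φ := extChartAt model p
  have ho : IsOpen (φ.target ∩ φ.symm ⁻¹' V) :=
    (continuousOn_extChartAt_symm p).isOpen_inter_preimage (isOpen_extChartAt_target p) hV
  have hL : ContMDiff 𝓘(ℝ, Coord) 𝓘(ℝ, ℝ × ℝ × EuclideanSpace ℝ (Fin 2)) ∞ L :=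
    L.contDiff.contMDiff
  refine ⟨L ⁻¹' (φ.target ∩ φ.symm ⁻¹' V), fun y => φ.symm (L y), fun q => L.symm (φ q),
    ⟨ho.preimage L.continuous, fun y hy => hy.2, ?_, fun y hy => ?_⟩, ?_, ?_⟩
  · exact (contMDiffOn_extChartAt_symm p).comp hL.contMDiffOn fun y hy => hy.1
  · have h1 : MDifferentiableAt 𝓘(ℝ, ℝ × ℝ × EuclideanSpace ℝ (Fin 2)) model φ.symm (L y) :=
      ((contMDiffOn_extChartAt_symm (n := ∞) p).contMDiffAt
        ((isOpen_extChartAt_target p).mem_nhds hy.1)).mdifferentiableAt (by simp)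
    have h2 : MDifferentiableAt 𝓘(ℝ, Coord) 𝓘(ℝ, ℝ × ℝ × EuclideanSpace ℝ (Fin 2)) L y :=
      hL.mdifferentiableAt (by simp)
    have h3 : mfderiv 𝓘(ℝ, Coord) model (fun y => φ.symm (L y)) y
        = (mfderiv 𝓘(ℝ, ℝ × ℝ × EuclideanSpace ℝ (Fin 2)) model φ.symm (L y)).comp
          (mfderiv 𝓘(ℝ, Coord) 𝓘(ℝ, ℝ × ℝ × EuclideanSpace ℝ (Fin 2)) L y) :=
      mfderiv_comp y h1 h2
    have h4 : mfderiv 𝓘(ℝ, Coord) 𝓘(ℝ, ℝ × ℝ × EuclideanSpace ℝ (Fin 2)) L y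
        = (L : Coord →L[ℝ] (ℝ × ℝ × EuclideanSpace ℝ (Fin 2))) :=
      L.hasMFDerivAt.mfderiv
    have h5 := isInvertible_mfderivWithin_extChartAt_symm (I := model) hy.1
    rw [ModelWithCorners.range_eq_univ, mfderivWithin_univ] at h5
    rw [h3, h4]
    exact h5.bijective.comp L.bijective
  · exact L.symm.continuous.continuousAt.comp (continuousAt_extChartAt p)
  · filter_upwards [(isOpen_extChartAt_source (I := model) p).mem_nhds (mem_extChartAt_source p),
      hV.mem_nhds hp] with q hq hqV
    have hq' : φ.symm (φ q) = q := φ.left_inv hq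
    simp only [Set.mem_preimage, ContinuousLinearEquiv.apply_symm_apply]
    exact ⟨⟨φ.map_source hq, by rwa [Set.mem_preimage, hq']⟩, hq'⟩

section General

variable {E : Type*} [NormedAddCommGroup E] [NormedSpace ℝ E] {H : Type*} [TopologicalSpace H]
  {I : ModelWithCorners ℝ E H} {X : Type*} [TopologicalSpace X] [ChartedSpace H X]
  {g h : BilinField I X} {V : Set X} {ψ : Coord → X} {x : Coord}

theorem mfderiv_eq_sum (k : Coord) :
    mfderiv 𝓘(ℝ, Coord) I ψ x k = ∑ m, k m • coordVec I ψ x m := by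
  have hk : k = ∑ m, k m • (Pi.single m (1 : ℝ) : Coord) := by ext i; simp [Pi.single_apply]
  have h : ∀ L : Coord →ₗ[ℝ] TangentSpace I (ψ x),
      L k = ∑ m, k m • L (Pi.single m (1 : ℝ) : Coord) := fun L => by
    conv_lhs => rw [hk]
    simp only [map_sum, map_smul]
  exact h (mfderiv 𝓘(ℝ, Coord) I ψ x).toLinearMap

theorem BilinField.apply_mfderiv (k l : Coord) :
    g (ψ x) (mfderiv 𝓘(ℝ, Coord) I ψ x k) (mfderiv 𝓘(ℝ, Coord) I ψ x l)
      = ∑ m, ∑ n, k m * l n * g.comp ψ x m n := by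
  rw [mfderiv_eq_sum, mfderiv_eq_sum]
  simp only [map_sum, LinearMap.sum_apply, map_smul, LinearMap.smul_apply, smul_eq_mul,
    BilinField.comp, Matrix.of_apply, Finset.mul_sum]
  rw [Finset.sum_comm]
  exact Finset.sum_congr rfl fun m _ => Finset.sum_congr rfl fun n _ => by ring

theorem BilinField.ext_of_comp (hs : Function.Surjective (mfderiv 𝓘(ℝ, Coord) I ψ x))
    (hc : h.comp ψ x = g.comp ψ x) : h (ψ x) = g (ψ x) := by
  ext v w
  obtain ⟨k, rfl⟩ := hs v
  obtain ⟨l, rfl⟩ := hs w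
  refine (BilinField.apply_mfderiv k l).trans (Eq.trans ?_ (BilinField.apply_mfderiv k l).symm)
  rw [hc]

theorem BilinField.LorentzianOn.det_comp_ne_zero (hg : g.LorentzianOn V) (hx : ψ x ∈ V)
    (hb : Function.Bijective (mfderiv 𝓘(ℝ, Coord) I ψ x)) : (g.comp ψ x).det ≠ 0 := by
  refine EmbCoord.det_ne_zero_of_ker fun k hk => ?_
  obtain ⟨b, hb'⟩ := hg (ψ x) hx
  have h0 : ∀ u, g (ψ x) u (mfderiv 𝓘(ℝ, Coord) I ψ x k) = 0 := fun u => by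
    obtain ⟨l, rfl⟩ := hb.2 u
    refine (BilinField.apply_mfderiv l k).trans (Finset.sum_eq_zero fun m _ => ?_)
    have := congrArg (l m * ·) (congrFun hk m)
    simp only [Matrix.mulVec, dotProduct, Pi.zero_apply, mul_zero, Finset.mul_sum] at this
    rw [← this]
    exact Finset.sum_congr rfl fun n _ => by ring
  have h1 : mfderiv 𝓘(ℝ, Coord) I ψ x k = 0 := by
    rw [← b.repr.map_eq_zero_iff]
    ext i
    have hi := h0 (b i)
    rw [← b.sum_repr (mfderiv 𝓘(ℝ, Coord) I ψ x k)] at hi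
    simp only [map_sum, map_smul, hb', smul_eq_mul, Matrix.diagonal_apply, mul_ite, mul_zero,
      Finset.sum_ite_eq, Finset.mem_univ, if_true] at hi
    have : (![-1, 1, 1, 1] : Fin 4 → ℝ) i ≠ 0 := by fin_cases i <;> simp
    exact (mul_eq_zero.1 hi).resolve_right this
  exact (map_eq_zero_iff _ hb.1).1 h1

/-- A nondegenerate diagonal Gram matrix forces linear independence: pairing a relation with each
vector isolates its coefficient. -/
theorem exists_basis_of_gram (hfin : Module.finrank ℝ E = 4) {p : X}
    (b : Fin 4 → TangentSpace I p)
    (hb : ∀ i j, g p (b i) (b j) = Matrix.diagonal (![-1, 1, 1, 1] : Fin 4 → ℝ) i j) :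
    ∃ b : Module.Basis (Fin 4) ℝ (TangentSpace I p),
      ∀ i j, g p (b i) (b j) = Matrix.diagonal (![-1, 1, 1, 1] : Fin 4 → ℝ) i j := by
  have hli : LinearIndependent ℝ b := by
    rw [Fintype.linearIndependent_iff]
    intro c hc i
    have hi := congrArg (g p (b i)) hc
    simp only [map_sum, map_smul, hb, smul_eq_mul, Matrix.diagonal_apply, mul_ite, mul_zero,
      Finset.sum_ite_eq, Finset.mem_univ, if_true, map_zero] at hi
    have : (![-1, 1, 1, 1] : Fin 4 → ℝ) i ≠ 0 := by fin_cases i <;> simp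
    exact (mul_eq_zero.1 hi).resolve_right this
  have hc : Fintype.card (Fin 4) = Module.finrank ℝ (TangentSpace I p) := by
    rw [Fintype.card_fin]; exact hfin.symm
  refine ⟨basisOfLinearIndependentOfCardEqFinrank hli hc, fun i j => ?_⟩
  rw [coe_basisOfLinearIndependentOfCardEqFinrank, hb]

end General

/-- A matrix that brings `blockMetric A k l` to the form `diag(-1, 1, 1, 1)`. -/
theorem exists_blockMetric_diag (A : ℝ) {k l : ℝ} (hk : 0 < k) (hl : 0 < l) :
    ∃ c : Mat, c.transpose * blockMetric A k l * c = Matrix.diagonal ![-1, 1, 1, 1] := by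
  -- In the block with entries `-A, 1, 1, 0` the vector `(1, s)` has norm `2s - A`. The choices `s =
  -- (A ∓ 1)/2` give `-1` and `1`, and the two vectors are orthogonal.
  refine ⟨!![1, 1, 0, 0; (A - 1) / 2, (A + 1) / 2, 0, 0; 0, 0, (√k)⁻¹, 0; 0, 0, 0, (√l)⁻¹], ?_⟩
  have hk' : (√k)⁻¹ * (√k)⁻¹ * k = 1 := by
    rw [← mul_inv, Real.mul_self_sqrt hk.le, inv_mul_cancel₀ hk.ne']
  have hl' : (√l)⁻¹ * (√l)⁻¹ * l = 1 := by
    rw [← mul_inv, Real.mul_self_sqrt hl.le, inv_mul_cancel₀ hl.ne']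
  ext i j
  rw [transpose_mul_mul_apply]
  fin_cases i <;> fin_cases j <;>
    simp [blockMetric, Fin.sum_univ_four, hk', hl'] <;> ring

/-! ### The signature of the extended metric -/

namespace Params

variable {P : Params}

theorem isOpen_regularSet : IsOpen P.regularSet := by
  have : Continuous P.sigmaAt := by
    unfold sigmaAt sigma
    have h : Continuous fun p : Spacetime => (p.2.2 : EuclideanSpace ℝ (Fin 3)) 2 :=
      (EuclideanSpace.proj (𝕜 := ℝ) (2 : Fin 3)).continuous.comp
        (continuous_subtype_val.comp (continuous_snd.comp continuous_snd))
    fun_prop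
  exact isOpen_ne_fun this continuous_const

theorem lorentzianOn_metricField (hχ : 0 < P.chi) :
    P.metricField.LorentzianOn P.regularSet := by
  intro p hp
  obtain ⟨Ω, ψ, ξ, h, -, hξ⟩ := exists_isCoordinates isOpen_regularSet hp
  obtain ⟨hx, hp'⟩ := hξ.self_of_nhds
  rw [← hp']
  generalize ξ p = x at *
  obtain ⟨e, A, k, l, he, hk, hl, hG⟩ := h.embCoord.exists_block hχ (sigma_emb_ne h) hx
  obtain ⟨c, hc⟩ := exists_blockMetric_diag A hk hl
  rw [← metricField_comp (h.mdifferentiableAt hx)] at hG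
  have hN : (e⁻¹ * c).transpose * P.metricField.comp ψ x * (e⁻¹ * c)
      = Matrix.diagonal ![-1, 1, 1, 1] := by
    have hee : e * e⁻¹ = 1 := Matrix.mul_nonsing_inv e (isUnit_iff_ne_zero.2 he)
    have hee' : (e⁻¹).transpose * e.transpose = 1 := by
      rw [← Matrix.transpose_mul, hee, Matrix.transpose_one]
    rw [← hc, hG, Matrix.transpose_mul]
    calc _ = c.transpose * ((e⁻¹).transpose * e.transpose) * blockMetric A k l * (e * e⁻¹) * c := by
          simp only [Matrix.mul_assoc]
      _ = _ := by rw [hee, hee']; simp only [Matrix.mul_one]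
  refine exists_basis_of_gram (by simp)
    (fun j => mfderiv 𝓘(ℝ, Coord) model ψ x fun m => (e⁻¹ * c) m j) fun i j => ?_
  rw [BilinField.apply_mfderiv, ← hN, transpose_mul_mul_apply]

end Params
/-! ### Boyer–Lindquist coordinates -/

theorem contMDiff_spherePoint : ContMDiff 𝓘(ℝ, ℝ × ℝ) (𝓡 2) ∞
    (fun z : ℝ × ℝ => spherePoint z.1 z.2) := by
  have h : ContDiff ℝ ∞ (fun z : ℝ × ℝ => (spherePoint z.1 z.2 : EuclideanSpace ℝ (Fin 3))) := by
    rw [contDiff_piLp]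
    intro i
    fin_cases i <;> simp [spherePoint] <;> fun_prop
  have := fact_finrank
  exact ContMDiff.codRestrict_sphere (n := 2) h.contMDiff fun z => (spherePoint z.1 z.2).2

theorem jet_coord {x : Coord} (i : Fin 4) :
    Jet (fun y : Coord => y i) (fun m => if m = i then 1 else 0) x :=
  ⟨differentiableAt_apply i x, fun m => by
    have : fderiv ℝ (fun y : Coord => y i) x
        = ContinuousLinearMap.proj (R := ℝ) (φ := fun _ : Fin 4 => ℝ) i :=
      (hasFDerivAt_apply i x).fderiv
    rw [pd, this]; simp [Pi.single_apply, eq_comm]⟩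

section KerrMap

variable {T Φ : ℝ → ℝ} {T' Φ' : ℝ} {x : Coord}

theorem mdifferentiableAt_kerrMap (hT : HasDerivAt T T' (x 1)) (hΦ : HasDerivAt Φ Φ' (x 1)) :
    MDifferentiableAt 𝓘(ℝ, Coord) model (kerrMap T Φ) x := by
  have hc : ∀ i : Fin 4, DifferentiableAt ℝ (fun y : Coord => y i) x := fun i =>
    differentiableAt_apply i x
  have hT' : DifferentiableAt ℝ (fun y : Coord => T (y 1)) x :=
    hT.differentiableAt.comp x (hc 1)
  have hΦ' : DifferentiableAt ℝ (fun y : Coord => Φ (y 1)) x :=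
    hΦ.differentiableAt.comp x (hc 1)
  have h0 : MDifferentiableAt 𝓘(ℝ, Coord) 𝓘(ℝ, ℝ) (fun y : Coord => y 0 + T (y 1) - y 1) x :=
    (((hc 0).add hT').sub (hc 1)).mdifferentiableAt
  have h1 : MDifferentiableAt 𝓘(ℝ, Coord) 𝓘(ℝ, ℝ) (fun y : Coord => y 1) x :=
    (hc 1).mdifferentiableAt
  have h2 : MDifferentiableAt 𝓘(ℝ, Coord) 𝓘(ℝ, ℝ × ℝ)
      (fun y : Coord => (y 2, y 3 + Φ (y 1))) x :=
    ((hc 2).prodMk ((hc 3).add hΦ')).mdifferentiableAt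
  have h3 : MDifferentiableAt 𝓘(ℝ, Coord) (𝓡 2)
      (fun y : Coord => spherePoint (y 2) (y 3 + Φ (y 1))) x :=
    (contMDiff_spherePoint.mdifferentiable (by simp) (x 2, x 3 + Φ (x 1))).comp x h2
  exact h0.prodMk (h1.prodMk h3)

theorem tanVec_kerrMap (hT : HasDerivAt T T' (x 1)) (hΦ : HasDerivAt Φ Φ' (x 1)) (m : Fin 4) :
    tanVec (fun y => emb (kerrMap T Φ y)) x m =
      (![![1, 0, 0, 0, 0],
        ![T' - 1, 1, -(Real.sin (x 2) * Real.sin (x 3 + Φ (x 1)) * Φ'),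
          Real.sin (x 2) * Real.cos (x 3 + Φ (x 1)) * Φ', 0],
        ![0, 0, Real.cos (x 2) * Real.cos (x 3 + Φ (x 1)),
          Real.cos (x 2) * Real.sin (x 3 + Φ (x 1)), -Real.sin (x 2)],
        ![0, 0, -(Real.sin (x 2) * Real.sin (x 3 + Φ (x 1))),
          Real.sin (x 2) * Real.cos (x 3 + Φ (x 1)), 0]] : Fin 4 → Fin 5 → ℝ) m := by
  have hc := @jet_coord x
  have hs := (hc 2).comp_one (Real.hasDerivAt_sin (x 2))
  have hk := (hc 2).comp_one (Real.hasDerivAt_cos (x 2))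
  have hφ := (hc 3).add ((hc 1).comp_one hΦ)
  have hsφ := hφ.comp_one (Real.hasDerivAt_sin _)
  have hkφ := hφ.comp_one (Real.hasDerivAt_cos _)
  have h0 := ((hc 0).add ((hc 1).comp_one hT)).sub (hc 1)
  have h2 := hs.mul hkφ
  have h3 := hs.mul hsφ
  have e0 := h0.pd_eq m
  have e1 := (hc 1).pd_eq m
  have e2 := h2.pd_eq m
  have e3 := h3.pd_eq m
  have e4 := hk.pd_eq m
  ext i
  fin_cases i
  · refine Eq.trans e0 ?_; fin_cases m <;> simp
  · refine Eq.trans e1 ?_; fin_cases m <;> simp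
  · refine Eq.trans e2 ?_; fin_cases m <;> simp; ring
  · refine Eq.trans e3 ?_; fin_cases m <;> simp; ring
  · refine Eq.trans e4 ?_; fin_cases m <;> simp

theorem emb_kerrMap : emb (kerrMap T Φ x) = ![x 0 + T (x 1) - x 1, x 1,
    Real.sin (x 2) * Real.cos (x 3 + Φ (x 1)), Real.sin (x 2) * Real.sin (x 3 + Φ (x 1)),
    Real.cos (x 2)] := by
  ext i; fin_cases i <;> rfl

theorem tau_kerrMap (hT : HasDerivAt T T' (x 1)) (hΦ : HasDerivAt Φ Φ' (x 1)) (m : Fin 4) :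
    Params.tau (emb (kerrMap T Φ x)) (tanVec (fun y => emb (kerrMap T Φ y)) x m)
      = Real.sin (x 2) ^ 2 * (![0, Φ', 0, 1] : Fin 4 → ℝ) m := by
  have h := Real.sin_sq_add_cos_sq (x 3 + Φ (x 1))
  rw [tanVec_kerrMap hT hΦ, emb_kerrMap]
  fin_cases m <;> simp [Params.tau]
  · linear_combination Real.sin (x 2) ^ 2 * Φ' * h
  · ring
  · linear_combination Real.sin (x 2) ^ 2 * h

/-- The differentials of `t̄`, `r`, `z = cos θ` and the form `τ` already detect all four coordinate
vectors when `sin θ ≠ 0`; equality of dimensions does the rest. -/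
theorem bijective_mfderiv_kerrMap (hT : HasDerivAt T T' (x 1)) (hΦ : HasDerivAt Φ Φ' (x 1))
    (hs : Real.sin (x 2) ≠ 0) :
    Function.Bijective (mfderiv 𝓘(ℝ, Coord) model (kerrMap T Φ) x) := by
  have hd := mdifferentiableAt_kerrMap hT hΦ
  have hinj : Function.Injective (mfderiv 𝓘(ℝ, Coord) model (kerrMap T Φ) x).toLinearMap := by
    refine LinearMap.ker_eq_bot.1 (LinearMap.ker_eq_bot'.2 fun (k : Coord) hk => ?_)
    have h1 : embDeriv (kerrMap T Φ x) (∑ m, k m • coordVec model (kerrMap T Φ) x m) = 0 := by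
      rw [← mfderiv_eq_sum]
      exact (congrArg _ hk).trans (map_zero _)
    simp only [map_sum, map_smul, embDeriv_coordVec hd] at h1
    have h0 : Params.tau (emb (kerrMap T Φ x)) (∑ m, k m •
        tanVec (fun y => emb (kerrMap T Φ y)) x m) = 0 := by rw [h1]; simp [Params.tau]
    have hτ : ∑ m, k m * Params.tau (emb (kerrMap T Φ x))
        (tanVec (fun y => emb (kerrMap T Φ y)) x m) = 0 := by
      rw [← h0]
      simp only [Params.tau, Fin.sum_univ_four, Pi.add_apply, Pi.smul_apply, smul_eq_mul]; ring
    simp only [tau_kerrMap hT hΦ, Fin.sum_univ_four, Matrix.cons_val] at hτ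
    have hi := fun i => congrFun h1 i
    have i0 := hi 0; have i1 := hi 1; have i4 := hi 4
    simp only [tanVec_kerrMap hT hΦ, Fin.sum_univ_four, Pi.add_apply, Pi.smul_apply, smul_eq_mul,
      Matrix.cons_val, Pi.zero_apply] at i0 i1 i4
    have k1 : k 1 = 0 := by linarith
    rw [k1] at i0 hτ
    have k0 : k 0 = 0 := by linarith
    have k2 : k 2 = 0 := by
      have : k 2 * Real.sin (x 2) = 0 := by linarith
      exact (mul_eq_zero.1 this).resolve_right hs
    have k3 : k 3 = 0 := by
      have : k 3 * Real.sin (x 2) ^ 2 = 0 := by linarith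
      exact (mul_eq_zero.1 this).resolve_right (pow_ne_zero 2 hs)
    funext i; fin_cases i <;> assumption
  have hfin : Module.finrank ℝ Coord = Module.finrank ℝ (ℝ × ℝ × EuclideanSpace ℝ (Fin 2)) := by
    simp
  have : ∀ L : Coord →ₗ[ℝ] (ℝ × ℝ × EuclideanSpace ℝ (Fin 2)), Function.Injective L →
      Function.Bijective L := fun L hL =>
    ⟨hL, (LinearMap.injective_iff_surjective_of_finrank_eq_finrank hfin).1 hL⟩
  exact this _ hinj

end KerrMap

namespace Params

variable {P : Params} {T Φ : ℝ → ℝ} {x : Coord}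

theorem kerrMap_mem_regularSet (hx : x ∈ P.blDomain) : kerrMap T Φ x ∈ P.regularSet :=
  fun h0 => hx.2.2 (by
    have : P.sigma (x 1) (Real.cos (x 2)) = 0 := h0
    rw [this]; ring)

/-- The null form of the metric completes to the Boyer–Lindquist squares: substituting `α = dt - a
sin² θ dφ + (χΣ/Δ_r) dr` into `-(Δ_r/Σ)(α/χ)² + 2 (α/χ) dr` cancels the mixed terms and leaves `Σ
dr²/Δ_r`. -/
theorem metricField_comp_kerrMap (hχ : 0 < P.chi) (hTΦ : P.IsKerrPair T Φ) (hx : x ∈ P.blDomain) :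
    P.metricField.comp (kerrMap T Φ) x = P.blMetric x := by
  obtain ⟨_, _, hne⟩ := hx
  have hs := right_ne_zero_of_mul hne
  have hΔθ := right_ne_zero_of_mul (left_ne_zero_of_mul hne)
  have hΔ := right_ne_zero_of_mul (left_ne_zero_of_mul (left_ne_zero_of_mul hne))
  have hσ := left_ne_zero_of_mul (left_ne_zero_of_mul (left_ne_zero_of_mul hne))
  obtain ⟨hT, hΦ⟩ := hTΦ (x 1) hΔ
  have hd := mdifferentiableAt_kerrMap hT hΦ
  have hsc : 1 - Real.cos (x 2) ^ 2 = Real.sin (x 2) ^ 2 := by rw [Real.sin_sq]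
  have hs2 : 1 - emb (kerrMap T Φ x) 4 ^ 2 = Real.sin (x 2) ^ 2 := hsc
  have hs2' : 1 - emb (kerrMap T Φ x) 4 ^ 2 ≠ 0 := by rw [hs2]; exact pow_ne_zero 2 hs
  have htan : ∀ m, IsTangent (emb (kerrMap T Φ x))
      (tanVec (fun y => emb (kerrMap T Φ y)) x m) := fun m => by
    have h := Real.sin_sq_add_cos_sq (x 3 + Φ (x 1))
    rw [tanVec_kerrMap hT hΦ, emb_kerrMap]
    fin_cases m <;> simp [IsTangent]
    · ring
    · linear_combination Real.sin (x 2) * Real.cos (x 2) * h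
    · ring
  -- The rows are the values on `∂_t, ∂_r, ∂_θ, ∂_φ`. The form `β` has no `dr` part because its
  -- contributions from `T'` and `Φ'` cancel; `α/χ` keeps `Σ/Δ_r`.
  have hcof : ∀ m, P.coframe (emb (kerrMap T Φ x)) (tanVec (fun y => emb (kerrMap T Φ y)) x m)
      = (![![P.chi⁻¹, 0, 0, P.a * P.chi⁻¹],
        ![P.sigma (x 1) (Real.cos (x 2)) * (P.deltaR (x 1))⁻¹, 1, 0, 0],
        ![0, 0, -Real.sin (x 2), 0],
        ![-(P.a * Real.sin (x 2) ^ 2 * P.chi⁻¹), 0, 0, -((x 1 ^ 2 + P.a ^ 2) * P.chi⁻¹)]] :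
        Fin 4 → Fin 4 → ℝ) m := fun m => by
    have hσ' : P.sigma (x 1) (Real.cos (x 2))
        = x 1 ^ 2 + P.a ^ 2 - P.a ^ 2 * Real.sin (x 2) ^ 2 := by
      rw [Real.sin_sq]; simp only [sigma]; ring
    simp only [coframe, alpha, tau_kerrMap hT hΦ, hs2]
    rw [tanVec_kerrMap hT hΦ, emb_kerrMap, hσ']
    have hχ0 := hχ.ne'
    ext i
    fin_cases m <;> fin_cases i <;>
      simp only [Fin.zero_eta, Fin.mk_one, Fin.reduceFinMk, Matrix.cons_val] <;> field_simp <;> ring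
  rw [metricField_comp hd]
  ext m n
  refine (metricForm_eq_coframe hχ hσ (onSphere_emb _) (htan m) (htan n) hs2').trans ?_
  rw [hcof, hcof]
  simp only [hFrame, pTheta]
  change ∑ i, ∑ j, _ * frameMetric (P.sigma (x 1) (Real.cos (x 2))) (P.sigma (x 1) (Real.cos (x 2)))⁻¹
    (P.deltaTheta (Real.cos (x 2)) * (1 - Real.cos (x 2) ^ 2))⁻¹ (P.deltaR (x 1))
    (P.deltaTheta (Real.cos (x 2)) * (1 - Real.cos (x 2) ^ 2)) i j = _
  rw [hsc]
  simp only [blMetric, Matrix.add_apply, Matrix.smul_apply, Matrix.vecMulVec_apply, smul_eq_mul,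
    omega, omega']
  have hχ0 := hχ.ne'
  generalize P.sigma (x 1) (Real.cos (x 2)) = S at *
  generalize P.deltaR (x 1) = D at *
  generalize P.deltaTheta (Real.cos (x 2)) = Dθ at *
  fin_cases m <;> fin_cases n <;>
    simp only [frameMetric, Fin.sum_univ_four, Fin.zero_eta, Fin.mk_one, Fin.reduceFinMk,
      Matrix.cons_val, Matrix.of_apply, Matrix.diagonal_apply_eq, Matrix.diagonal_apply_ne, ne_eq,
      Fin.reduceEq, not_false_eq_true] <;> field_simp <;> ring

theorem alpha_kerrMap (hTΦ : P.IsKerrPair T Φ) (hΔ : P.deltaR (x 1) ≠ 0)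
    (m : Fin 4) : P.alpha (emb (kerrMap T Φ x)) (tanVec (fun y => emb (kerrMap T Φ y)) x m)
      = (![1, P.chi * P.sigma (x 1) (Real.cos (x 2)) / P.deltaR (x 1), 0,
        -(P.a * Real.sin (x 2) ^ 2)] : Fin 4 → ℝ) m := by
  obtain ⟨hT, hΦ⟩ := hTΦ (x 1) hΔ
  have hσ' : P.sigma (x 1) (Real.cos (x 2))
      = x 1 ^ 2 + P.a ^ 2 - P.a ^ 2 * Real.sin (x 2) ^ 2 := by
    rw [Real.sin_sq]; simp only [sigma]; ring
  simp only [alpha, tau_kerrMap hT hΦ]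
  rw [tanVec_kerrMap hT hΦ, hσ']
  fin_cases m <;>
    simp only [Fin.zero_eta, Fin.mk_one, Fin.reduceFinMk, Matrix.cons_val] <;> field_simp <;> ring

/-- The extra term is `Q r/(χΣ)` times the `dr` part `χΣ/Δ_r` of `α`, so `Σ` and `χ` cancel and it
depends on `r` only. -/
theorem potentialField_comp_kerrMap (hχ : 0 < P.chi) (hTΦ : P.IsKerrPair T Φ)
    (hx : x ∈ P.blDomain) : P.potentialField.comp (kerrMap T Φ) x
      = P.blPotential x + Pi.single 1 (P.Q * x 1 / P.deltaR (x 1)) := by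
  obtain ⟨_, _, hne⟩ := hx
  have hΔ := right_ne_zero_of_mul (left_ne_zero_of_mul (left_ne_zero_of_mul hne))
  have hσ := left_ne_zero_of_mul (left_ne_zero_of_mul (left_ne_zero_of_mul hne))
  obtain ⟨hT, hΦ⟩ := hTΦ (x 1) hΔ
  have hχ0 := hχ.ne'
  rw [potentialField_comp (mdifferentiableAt_kerrMap hT hΦ)]
  ext m
  refine (congrArg (P.potFun (emb (kerrMap T Φ x)) * ·) (alpha_kerrMap hTΦ hΔ m)).trans ?_
  have hp : P.potFun (emb (kerrMap T Φ x))
      = P.Q * x 1 * (P.sigma (x 1) (Real.cos (x 2)))⁻¹ * P.chi⁻¹ := rfl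
  simp only [hp, blPotential, omega, Pi.add_apply, Pi.smul_apply, smul_eq_mul, Pi.single_apply]
  fin_cases m <;>
    simp only [Fin.zero_eta, Fin.mk_one, Fin.reduceFinMk, Matrix.cons_val, Fin.reduceEq, if_true,
      if_false] <;> field_simp <;> ring

theorem emField_comp_kerrMap (hχ : 0 < P.chi) (hTΦ : P.IsKerrPair T Φ)
    (hx : x ∈ P.blDomain) : P.emField.comp (kerrMap T Φ) x = extDer P.blPotential x := by
  obtain ⟨_, _, hne⟩ := hx
  have hΔ := right_ne_zero_of_mul (left_ne_zero_of_mul (left_ne_zero_of_mul hne))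
  have hσ := left_ne_zero_of_mul (left_ne_zero_of_mul (left_ne_zero_of_mul hne))
  obtain ⟨hT, hΦ⟩ := hTΦ (x 1) hΔ
  have hχ0 := hχ.ne'
  have hc := @jet_coord x
  have hs := (hc 2).comp_one (Real.hasDerivAt_sin (x 2))
  have hk := (hc 2).comp_one (Real.hasDerivAt_cos (x 2))
  have hS : Jet (fun y : Coord => P.sigma (y 1) (Real.cos (y 2))) _ x :=
    ((hc 1).pow 2).add ((Jet.const (P.a ^ 2)).mul (hk.pow 2))
  have hf := ((Jet.const P.Q).mul (hc 1)).mul (((Jet.const P.chi).mul hS).inv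
    (mul_ne_zero hχ0 hσ))
  have hω : ∀ n, Jet (fun y => P.omega y n)
      (fun m => (![0, 0, 0, -(P.a * (2 * Real.sin (x 2) * Real.cos (x 2)))] : Fin 4 → ℝ) n
        * if m = 2 then 1 else 0) x := by
    intro n
    fin_cases n
    · exact (Jet.const 1).congr fun m => by simp
    · exact (Jet.const 0).congr fun m => by simp
    · exact (Jet.const 0).congr fun m => by simp
    · exact ((Jet.const P.a).mul (hs.pow 2)).neg.congr fun m => by
        simp only [Fin.reduceFinMk, Matrix.cons_val, Nat.cast_ofNat]; ring
  have hA := fun m n => (hf.mul (hω n)).pd_eq m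
  have hA' : ∀ m n, pd m (fun y => P.blPotential y n) x = _ := hA
  rw [emField_comp (mdifferentiableAt_kerrMap hT hΦ)]
  ext m n
  change P.dPotFun _ _ * P.alpha _ _ - P.dPotFun _ _ * P.alpha _ _ - 2 * P.a * _ * _ = _
  rw [alpha_kerrMap hTΦ hΔ, alpha_kerrMap hTΦ hΔ]
  have hp : P.potFun (emb (kerrMap T Φ x))
      = P.Q * x 1 * (P.sigma (x 1) (Real.cos (x 2)))⁻¹ * P.chi⁻¹ := rfl
  simp only [extDer, Matrix.of_apply, hA', dPotFun, hp]
  rw [tanVec_kerrMap hT hΦ, tanVec_kerrMap hT hΦ]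
  have hsin := Real.sin_sq_add_cos_sq (x 3 + Φ (x 1))
  have e1 : emb (kerrMap T Φ x) 1 = x 1 := rfl
  have e4 : emb (kerrMap T Φ x) 4 = Real.cos (x 2) := rfl
  rw [e1, e4]
  simp only [omega]
  have hd : Real.cos (x 3 + Φ (x 1)) ^ 2 = 1 - Real.sin (x 3 + Φ (x 1)) ^ 2 := by linarith
  generalize Real.cos (x 3 + Φ (x 1)) = cφ at *
  generalize Real.sin (x 3 + Φ (x 1)) = sφ at *
  generalize P.sigma (x 1) (Real.cos (x 2)) = S at *
  generalize P.deltaR (x 1) = D at *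
  fin_cases m <;> fin_cases n <;>
    simp only [Fin.zero_eta, Fin.mk_one, Fin.reduceFinMk, Matrix.cons_val, Fin.reduceEq, if_true,
      if_false, mul_zero, zero_mul, add_zero, zero_add, mul_one, sub_zero, zero_sub, neg_zero,
      Nat.cast_ofNat, Nat.reduceSub, pow_one] <;> field_simp <;> ring_nf <;> (try rw [hd]) <;> ring

end Params
/-! ### Primitives on open sets -/

/-- A continuous function on an open subset of `ℝ` has a primitive there. -/
theorem exists_primitive {S : Set ℝ} (hS : IsOpen S) {f : ℝ → ℝ} (hf : ContinuousOn f S) :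
    ∃ F : ℝ → ℝ, ∀ r ∈ S, HasDerivAt F (f r) r := by
  classical
  -- The base point of the integral depends only on the connected component. It is therefore locally
  -- constant, and the fundamental theorem of calculus applies on each component.
  let base : Set ℝ → ℝ := fun C => if h : C.Nonempty then h.some else 0
  refine ⟨fun r => ∫ t in base (connectedComponentIn S r)..r, f t, fun r hr => ?_⟩
  have hb : base (connectedComponentIn S r) ∈ connectedComponentIn S r := by
    have h : (connectedComponentIn S r).Nonempty := ⟨r, mem_connectedComponentIn hr⟩
    simp only [base, dif_pos h]
    exact h.some_mem
  have hsub : Set.uIcc (base (connectedComponentIn S r)) r ⊆ S :=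
    ((isPreconnected_connectedComponentIn.ordConnected).uIcc_subset hb
      (mem_connectedComponentIn hr)).trans (connectedComponentIn_subset S r)
  have hd := intervalIntegral.integral_hasDerivAt_right
    (hf.mono hsub).intervalIntegrable (hf.stronglyMeasurableAtFilter hS r hr)
    (hf.continuousAt (hS.mem_nhds hr))
  refine hd.congr_of_eventuallyEq ?_
  filter_upwards [hS.connectedComponentIn.mem_nhds (mem_connectedComponentIn hr)] with r' hr'
  simp only [connectedComponentIn_eq hr']

namespace Params

variable {P : Params}

theorem continuous_deltaR : Continuous P.deltaR := by
  unfold deltaR; fun_prop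

theorem exists_isKerrPair : ∃ T Φ : ℝ → ℝ, P.IsKerrPair T Φ := by
  have hS : IsOpen {r | P.deltaR r ≠ 0} := isOpen_ne_fun continuous_deltaR continuous_const
  obtain ⟨T, hT⟩ := exists_primitive hS (f := fun r => P.chi * (r ^ 2 + P.a ^ 2) / P.deltaR r)
    (ContinuousOn.div (by fun_prop) continuous_deltaR.continuousOn fun _ h => h)
  obtain ⟨Φ, hΦ⟩ := exists_primitive hS (f := fun r => P.a * P.chi / P.deltaR r)
    (ContinuousOn.div (by fun_prop) continuous_deltaR.continuousOn fun _ h => h)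
  exact ⟨T, Φ, fun r hr => ⟨hT r hr, hΦ r hr⟩⟩

open Polynomial in
theorem finite_deltaR_eq_zero : {r | P.deltaR r = 0}.Finite := by
  let q : ℝ[X] := (1 - C P.lam * X ^ 2) * (X ^ 2 + C (P.a ^ 2)) - C (2 * P.M) * X + C (P.Q ^ 2)
  have hq : ∀ r, q.eval r = P.deltaR r := fun r => by simp [q, deltaR]
  have hne : q ≠ 0 := by
    intro h0
    have h : ∀ r, P.deltaR r = 0 := fun r => by rw [← hq, h0, eval_zero]
    have h1 := h 1; have h2 := h (-1); have h3 := h 2; have h4 := h (-2); have h5 := h 0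
    simp only [deltaR] at h1 h2 h3 h4 h5
    -- The fourth difference of the values at `-2, -1, 0, 1, 2` is `-24 λ`.
    have h6 : P.lam = 0 := by linarith
    rw [h6] at h1 h5
    linarith
  have hs : {r | P.deltaR r = 0} = {r | q.IsRoot r} := by
    ext r; simp only [Set.mem_ofPred_eq, IsRoot.def, hq]
  rw [hs]
  exact Polynomial.finite_setOfPred_isRoot hne

end Params

/-! ### Spherical coordinates -/

/-- Spherical coordinates `(t̄, r, θ, φ̄)`. -/
def sphericalMap : Coord → Spacetime := kerrMap id fun _ => 0

theorem sphericalMap_apply (y : Coord) :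
    sphericalMap y = (y 0, y 1, spherePoint (y 2) (y 3)) := by
  simp only [sphericalMap, kerrMap, id_eq, add_sub_cancel_right, add_zero]

theorem contMDiff_sphericalMap : ContMDiff 𝓘(ℝ, Coord) model ∞ sphericalMap := by
  have hc : ∀ i : Fin 4, ContDiff ℝ ∞ (fun y : Coord => y i) := fun i => contDiff_apply ℝ ℝ i
  have h3 : ContMDiff 𝓘(ℝ, Coord) (𝓡 2) ∞ (fun y : Coord => spherePoint (y 2) (y 3)) :=
    contMDiff_spherePoint.comp (I' := 𝓘(ℝ, ℝ × ℝ)) (f := fun y : Coord => (y 2, y 3))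
      ((hc 2).prodMk (hc 3)).contMDiff
  have h0 : ContMDiff 𝓘(ℝ, Coord) 𝓘(ℝ, ℝ) ∞ (fun y : Coord => y 0) := (hc 0).contMDiff
  have h1 : ContMDiff 𝓘(ℝ, Coord) 𝓘(ℝ, ℝ) ∞ (fun y : Coord => y 1) := (hc 1).contMDiff
  rw [funext sphericalMap_apply]
  exact h0.prodMk (h1.prodMk h3)

theorem isCoordinates_sphericalMap {V : Set Spacetime} (hV : IsOpen V) :
    IsCoordinates model V {y | Real.sin (y 2) ≠ 0 ∧ sphericalMap y ∈ V} sphericalMap := by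
  refine ⟨(isOpen_ne_fun (by fun_prop) continuous_const).inter
    (hV.preimage contMDiff_sphericalMap.continuous), fun y hy => hy.2,
    contMDiff_sphericalMap.contMDiffOn, fun y hy => ?_⟩
  exact bijective_mfderiv_kerrMap (hasDerivAt_id _) (hasDerivAt_const _ _) hy.1

theorem exists_spherePoint (n : Metric.sphere (0 : EuclideanSpace ℝ (Fin 3)) 1) :
    ∃ θ φ : ℝ, 0 ≤ θ ∧ θ ≤ Real.pi ∧ spherePoint θ φ = n := by
  have hn : (n : EuclideanSpace ℝ (Fin 3)) 0 ^ 2 + (n : EuclideanSpace ℝ (Fin 3)) 1 ^ 2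
      + (n : EuclideanSpace ℝ (Fin 3)) 2 ^ 2 = 1 := onSphere_emb ((0, 0, n) : Spacetime)
  set x := (n : EuclideanSpace ℝ (Fin 3)) 0 with hx
  set y := (n : EuclideanSpace ℝ (Fin 3)) 1 with hy
  set z := (n : EuclideanSpace ℝ (Fin 3)) 2 with hz
  have hz1 : -1 ≤ z := by nlinarith [sq_nonneg x, sq_nonneg y]
  have hz2 : z ≤ 1 := by nlinarith [sq_nonneg x, sq_nonneg y]
  -- With `θ = arccos z`, the number `x + iy` has modulus `sin θ`, so its argument serves as `φ`; at
  -- the poles any argument will do.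
  have hnorm : Real.sin (Real.arccos z) = ‖(⟨x, y⟩ : ℂ)‖ := by
    rw [Real.sin_arccos, Complex.norm_eq_sqrt_sq_add_sq]
    congr 1; linarith
  refine ⟨Real.arccos z, Complex.arg ⟨x, y⟩, Real.arccos_nonneg z, Real.arccos_le_pi z, ?_⟩
  ext i
  fin_cases i
  · change Real.sin (Real.arccos z) * Real.cos (Complex.arg ⟨x, y⟩) = x
    rw [hnorm]; exact Complex.norm_mul_cos_arg _
  · change Real.sin (Real.arccos z) * Real.sin (Complex.arg ⟨x, y⟩) = y
    rw [hnorm]; exact Complex.norm_mul_sin_arg _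
  · exact Real.cos_arccos hz1 hz2

theorem exists_sphericalMap (p : Spacetime) :
    ∃ y : Coord, 0 ≤ y 2 ∧ y 2 ≤ Real.pi ∧ sphericalMap y = p := by
  obtain ⟨θ, φ, h0, h1, h⟩ := exists_spherePoint p.2.2
  refine ⟨![p.1, p.2.1, θ, φ], h0, h1, ?_⟩
  rw [sphericalMap_apply]
  simp only [Matrix.cons_val, h]

theorem dense_sin_ne_zero : Dense {θ : ℝ | Real.sin θ ≠ 0} := by
  have h : {θ : ℝ | Real.sin θ = 0} = Set.range fun n : ℤ => (n : ℝ) * Real.pi := by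
    ext θ; exact Real.sin_eq_zero_iff
  have hc : {θ : ℝ | Real.sin θ = 0}.Countable := by rw [h]; exact Set.countable_range _
  exact hc.dense_compl ℝ

namespace Params

variable {P : Params}

theorem dense_deltaR_ne_zero : Dense {r | P.deltaR r ≠ 0 ∧ r ≠ 0} := by
  have h := (P.finite_deltaR_eq_zero.union (Set.finite_singleton (0 : ℝ))).countable.dense_compl ℝ
  refine h.mono fun r hr => ?_
  simp only [Set.mem_compl_iff, Set.mem_union, not_or] at hr
  exact hr

/-- The range of the spherical coordinates where `Δ_r`, `r` and `sin θ` do not vanish. -/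
def genericCoord (P : Params) : Set Coord :=
  {y | (P.deltaR (y 1) ≠ 0 ∧ y 1 ≠ 0) ∧ Real.sin (y 2) ≠ 0}

theorem dense_genericCoord : Dense P.genericCoord := by
  have h := dense_pi (s := ![Set.univ, {r | P.deltaR r ≠ 0 ∧ r ≠ 0}, {θ | Real.sin θ ≠ 0},
    Set.univ]) (Set.univ : Set (Fin 4)) (fun i _ => by
      fin_cases i
      exacts [dense_univ, dense_deltaR_ne_zero, dense_sin_ne_zero, dense_univ])
  refine h.mono fun y hy => ?_
  have h1 := hy 1 trivial
  have h2 := hy 2 trivial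
  exact ⟨h1, h2⟩

theorem sigma_ne_zero {r : ℝ} (hr : r ≠ 0) (c : ℝ) : P.sigma r c ≠ 0 := by
  have : 0 < r ^ 2 := by positivity
  unfold sigma; nlinarith [sq_nonneg (P.a * c)]

/-- Where `Δ_r`, `r` and `sin θ` do not vanish, the coordinates of Boyer and Lindquist
are available. -/
theorem exists_kerrMap_eq (hχ : 0 < P.chi) (T Φ : ℝ → ℝ) {y : Coord} (hy : y ∈ P.genericCoord) :
    ∃ x ∈ P.blDomain, kerrMap T Φ x = sphericalMap y := by
  obtain ⟨⟨h1, h2⟩, h3⟩ := hy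
  -- The angle `y 2` may lie outside `(0, π)`; the same point is described anew with `θ ∈ [0, π]`,
  -- and `sin θ ≠ 0` excludes the end points.
  obtain ⟨z, hz0, hz1, hz⟩ := exists_sphericalMap (sphericalMap y)
  have hr : z 1 = y 1 := congrArg (fun p : Spacetime => p.2.1) hz
  have hc : Real.cos (z 2) = Real.cos (y 2) := congrArg (fun p : Spacetime => emb p 4) hz
  have hs : Real.sin (z 2) ≠ 0 := by
    intro h
    have e1 := Real.sin_sq_add_cos_sq (z 2)
    have e2 := Real.sin_sq_add_cos_sq (y 2)
    rw [h, hc] at e1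
    exact h3 (pow_eq_zero_iff two_ne_zero |>.1 (by linarith))
  have hz0' : 0 < z 2 := lt_of_le_of_ne hz0 fun h => hs (by rw [← h, Real.sin_zero])
  have hz1' : z 2 < Real.pi := lt_of_le_of_ne hz1 fun h => hs (by rw [h, Real.sin_pi])
  refine ⟨![z 0 - T (z 1) + z 1, z 1, z 2, z 3 - Φ (z 1)], ⟨hz0', hz1', ?_⟩, ?_⟩
  · simp only [Matrix.cons_val]
    refine mul_ne_zero (mul_ne_zero (mul_ne_zero (sigma_ne_zero (by rwa [hr]) _) (by rwa [hr]))
      (deltaTheta_pos hχ ?_).ne') hs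
    rw [← Real.sin_sq_add_cos_sq (z 2)]
    exact le_add_of_nonneg_left (sq_nonneg _)
  · rw [← hz, sphericalMap_apply]
    simp only [kerrMap, Matrix.cons_val, sub_add_cancel]
    congr 1; ring

theorem dense_image_genericCoord : Dense (sphericalMap '' P.genericCoord) :=
  (Function.Surjective.denseRange fun p => by
    obtain ⟨y, -, -, h⟩ := exists_sphericalMap p; exact ⟨y, h⟩).dense_image
    contMDiff_sphericalMap.continuous dense_genericCoord

end Params

/-! ### Uniqueness of the extension inside `ℝ² × S²` -/

theorem eq_zero_of_dense {X : Type*} [TopologicalSpace X] {D : Set X} (hD : Dense D) {f : X → ℝ}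
    {p : X} (hf : ContinuousAt f p) (h : ∀ᶠ q in nhds p, q ∈ D → f q = 0) : f p = 0 := by
  by_contra hne
  have h' := (hf.eventually_ne hne).and h
  obtain ⟨U, hU, hUo, hpU⟩ := eventually_nhds_iff.1 h'
  obtain ⟨q, hqU, hqD⟩ := hD.inter_open_nonempty U hUo ⟨p, hpU⟩
  exact (hU q hqU).1 ((hU q hqU).2 hqD)

namespace Params

variable {P : Params} {T Φ : ℝ → ℝ} {V : Set Spacetime} {h : BilinField model Spacetime}

/-- On the Boyer–Lindquist domain the components are prescribed, and the coordinate vectors span the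
tangent space. -/
theorem eq_metricField_of_generic (hχ : 0 < P.chi) (hTΦ : P.IsKerrPair T Φ)
    (hV : P.IsExtension T Φ V h) {p : Spacetime} (hp : p ∈ sphericalMap '' P.genericCoord) :
    p ∈ V ∧ p ∈ P.regularSet ∧ h p = P.metricField p := by
  obtain ⟨y, hy, rfl⟩ := hp
  obtain ⟨x, hx, hxy⟩ := exists_kerrMap_eq hχ T Φ hy
  obtain ⟨hT, hΦ⟩ := hTΦ (x 1)
    (right_ne_zero_of_mul (left_ne_zero_of_mul (left_ne_zero_of_mul hx.2.2)))
  rw [← hxy]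
  refine ⟨(hV.2.2 x hx).1, kerrMap_mem_regularSet hx, BilinField.ext_of_comp
    (bijective_mfderiv_kerrMap hT hΦ (right_ne_zero_of_mul hx.2.2)).2 ?_⟩
  rw [(hV.2.2 x hx).2, metricField_comp_kerrMap hχ hTΦ hx]

/-- In one chart around `p` both metrics have continuous components, which agree on the dense set of
generic points. -/
theorem eq_metricField_of_extension (hχ : 0 < P.chi) (hTΦ : P.IsKerrPair T Φ)
    (hV : P.IsExtension T Φ V h) {p : Spacetime} (hp : p ∈ V) (hpU : p ∈ P.regularSet) :
    h p = P.metricField p := by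
  obtain ⟨Ω, ψ, ξ, hψ, hξc, hξ⟩ := exists_isCoordinates (hV.1.inter isOpen_regularSet) ⟨hp, hpU⟩
  have hψV : IsCoordinates model V Ω ψ := ⟨hψ.1, fun y hy => (hψ.2.1 hy).1, hψ.2.2⟩
  have hψU : IsCoordinates model P.regularSet Ω ψ := ⟨hψ.1, fun y hy => (hψ.2.1 hy).2, hψ.2.2⟩
  obtain ⟨hx, hp'⟩ := hξ.self_of_nhds
  have hc : h.comp ψ (ξ p) = P.metricField.comp ψ (ξ p) := by
    ext m n
    have c1 := (hV.2.1.1 Ω ψ hψV m n).continuousOn.continuousAt (hψ.1.mem_nhds hx)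
    have c2 := (smoothOn_metricField hχ Ω ψ hψU m n).continuousOn.continuousAt (hψ.1.mem_nhds hx)
    have hf : ContinuousAt (fun q => h.comp ψ (ξ q) m n - P.metricField.comp ψ (ξ q) m n) p :=
      (ContinuousAt.comp (f := ξ) c1 hξc).sub (ContinuousAt.comp (f := ξ) c2 hξc)
    refine sub_eq_zero.1 (eq_zero_of_dense P.dense_image_genericCoord hf ?_)
    filter_upwards [hξ] with q hq hqD
    have := (eq_metricField_of_generic hχ hTΦ hV hqD).2.2
    rw [← hq.2] at this
    simp only [BilinField.comp, Matrix.of_apply, this, sub_self]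
  have := BilinField.ext_of_comp (hψ.2.2.2 _ hx).2 hc
  rwa [hp'] at this

/-- Near a singular point there are singular points away from the axis. -/
theorem exists_singular_offAxis {p : Spacetime} (hp : p ∉ P.regularSet) {N : Set Spacetime}
    (hN : IsOpen N) (hpN : p ∈ N) : ∃ y : Coord, Real.sin (y 2) ≠ 0 ∧ y 1 = 0 ∧
      P.a * Real.cos (y 2) = 0 ∧ sphericalMap y ∈ N := by
  obtain ⟨y, -, -, rfl⟩ := exists_sphericalMap p
  have h0 : y 1 ^ 2 + P.a ^ 2 * Real.cos (y 2) ^ 2 = 0 := by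
    by_contra hne; exact hp hne
  have hr : y 1 = 0 := by
    have : y 1 ^ 2 = 0 := by nlinarith [sq_nonneg (y 1), sq_nonneg (P.a * Real.cos (y 2))]
    exact pow_eq_zero_iff two_ne_zero |>.1 this
  have hac : P.a * Real.cos (y 2) = 0 := by
    have : (P.a * Real.cos (y 2)) ^ 2 = 0 := by
      nlinarith [sq_nonneg (y 1), sq_nonneg (P.a * Real.cos (y 2))]
    exact pow_eq_zero_iff two_ne_zero |>.1 this
  -- If `a = 0`, all of `{r = 0}` is singular and `θ` can be moved slightly off the axis. If `cos θ
  -- = 0`, the point lies on the equator already.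
  rcases mul_eq_zero.1 hac with ha | hcos
  · have hc : Continuous fun θ : ℝ => sphericalMap (Function.update y 2 θ) :=
      contMDiff_sphericalMap.continuous.comp (continuous_const.update 2 continuous_id)
    obtain ⟨θ, hθN, hθ⟩ := dense_sin_ne_zero.inter_open_nonempty _ (hN.preimage hc)
      ⟨y 2, by simpa using hpN⟩
    refine ⟨Function.update y 2 θ, by simpa using hθ, by simpa using hr, by simp [ha], hθN⟩
  · refine ⟨y, fun hs => ?_, hr, hac, hpN⟩
    have := Real.sin_sq_add_cos_sq (y 2)
    rw [hs, hcos] at this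
    norm_num at this

/-- The forms `dv` and `τ`, hence `α`, and also `dr`, vanish on `∂_θ`, so only the round part of the
metric contributes. No term with `1/Σ` survives, so the formula is valid at `Σ = 0` as well. -/
theorem metricField_comp_sphericalMap_row (y : Coord) (n : Fin 4) :
    P.metricField.comp sphericalMap y 2 n
      = P.sigma (y 1) (Real.cos (y 2)) * (P.deltaTheta (Real.cos (y 2)))⁻¹
        * if n = 2 then 1 else 0 := by
  have hT : HasDerivAt id 1 (y 1) := hasDerivAt_id _
  have hΦ : HasDerivAt (fun _ : ℝ => (0 : ℝ)) 0 (y 1) := hasDerivAt_const _ _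
  have h := Real.sin_sq_add_cos_sq (y 3)
  have h' := Real.sin_sq_add_cos_sq (y 2)
  rw [show P.metricField.comp sphericalMap y = _ from
    metricField_comp (mdifferentiableAt_kerrMap hT hΦ)]
  change P.metricForm (emb (kerrMap id (fun _ => 0) y))
    (tanVec (fun y => emb (kerrMap id (fun _ => 0) y)) y 2)
    (tanVec (fun y => emb (kerrMap id (fun _ => 0) y)) y n) = _
  simp only [metricForm, alpha, tau_kerrMap hT hΦ]
  simp only [tanVec_kerrMap hT hΦ]
  change _ + P.sigma (y 1) (Real.cos (y 2)) * (P.deltaTheta (Real.cos (y 2)))⁻¹ * _ + _ = _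
  generalize P.sigma (y 1) (Real.cos (y 2)) * (P.deltaTheta (Real.cos (y 2)))⁻¹ = k
  fin_cases n <;>
    simp only [Fin.zero_eta, Fin.mk_one, Fin.reduceFinMk, Matrix.cons_val, Fin.reduceEq, if_true,
      if_false, add_zero, zero_mul, mul_zero, neg_zero, sub_zero, zero_add, mul_one]
  · linear_combination k * Real.cos (y 2) ^ 2 * h + k * h'
  · ring

/-- At a singular point off the axis the `θ` row of an extension would, by continuity, be the limit
of `(Σ/Δ_θ) dθ`, which is zero. That contradicts nondegeneracy, whatever `M` and `Q` are. -/
theorem subset_regularSet_of_extension (hχ : 0 < P.chi) (hTΦ : P.IsKerrPair T Φ)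
    (hV : P.IsExtension T Φ V h) : V ⊆ P.regularSet := by
  intro p hp
  by_contra hpU
  obtain ⟨y, hs, hr, hac, hyV⟩ := exists_singular_offAxis hpU hV.1 hp
  have hψ := isCoordinates_sphericalMap hV.1
  have hΩ := hψ.1.mem_nhds (show y ∈ _ from ⟨hs, hyV⟩)
  refine hV.2.1.2.det_comp_ne_zero (ψ := sphericalMap) hyV (hψ.2.2.2 y ⟨hs, hyV⟩) ?_
  refine Matrix.det_eq_zero_of_row_eq_zero 2 fun n => ?_
  have hθ : ∀ z : Coord, P.deltaTheta (Real.cos (z 2)) ≠ 0 := fun z =>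
    (deltaTheta_pos hχ (by
      rw [← Real.sin_sq_add_cos_sq (z 2)]; exact le_add_of_nonneg_left (sq_nonneg _))).ne'
  have c2 : Continuous fun z : Coord => P.sigma (z 1) (Real.cos (z 2)) *
      (P.deltaTheta (Real.cos (z 2)))⁻¹ * if n = 2 then (1 : ℝ) else 0 := by
    refine Continuous.mul (Continuous.mul ?_ (Continuous.inv₀ ?_ hθ)) continuous_const
    · unfold sigma; fun_prop
    · unfold deltaTheta; fun_prop
  have c1 := (hV.2.1.1 _ _ hψ 2 n).continuousOn.continuousAt hΩ
  have h0 := eq_zero_of_dense P.dense_genericCoord (c1.sub c2.continuousAt) (by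
    filter_upwards with z hz
    have := (eq_metricField_of_generic hχ hTΦ hV ⟨z, hz, rfl⟩).2.2
    rw [Pi.sub_apply, ← metricField_comp_sphericalMap_row]
    simp only [BilinField.comp, Matrix.of_apply, this, sub_self])
  have hσ : P.sigma (y 1) (Real.cos (y 2)) = 0 := by
    have : P.sigma (y 1) (Real.cos (y 2)) = y 1 ^ 2 + (P.a * Real.cos (y 2)) ^ 2 := by
      simp only [sigma]; ring
    rw [this, hr, hac]; ring
  simpa [hσ] using h0

end Params
/-! ### Curvature of a pulled back metric -/

section Pullback

variable {U O : Set Coord} {H : Coord → Mat} {Z : Coord → Coord} {x : Coord}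

theorem pd_comp {f : Coord → ℝ} (hf : DifferentiableAt ℝ f (Z x)) (hZ : DifferentiableAt ℝ Z x)
    (m : Fin 4) : pd m (fun y => f (Z y)) x = ∑ k, pd m (fun y => Z y k) x * pd k f (Z x) := by
  have h1 : fderiv ℝ (fun y => f (Z y)) x = (fderiv ℝ f (Z x)).comp (fderiv ℝ Z x) :=
    fderiv_comp x hf hZ
  have h2 : ∀ k, pd m (fun y => Z y k) x
      = fderiv ℝ Z x (Pi.single m (1 : ℝ) : Coord) k := fun k => by
    have := (hasFDerivAt_pi'.1 hZ.hasFDerivAt k).fderiv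
    rw [pd, this]; rfl
  have h3 : fderiv ℝ Z x (Pi.single m (1 : ℝ) : Coord)
      = ∑ k, pd m (fun y => Z y k) x • (Pi.single k (1 : ℝ) : Coord) := by
    ext i; simp [h2, Pi.single_apply]
  rw [pd, h1, ContinuousLinearMap.comp_apply, h3, map_sum]
  simp only [map_smul, smul_eq_mul, pd]

theorem chr_symm_of_symm (hO : IsOpen O) (hs : ∀ z ∈ O, (H z).transpose = H z) (hx : x ∈ O)
    (l m n : Fin 4) : chr H m x l n = chr H n x l m := by
  have h : ∀ k i j, pd k (fun z => H z i j) x = pd k (fun z => H z j i) x := fun k i j =>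
    pd_congr hO hx (fun z hz => congrFun (congrFun (hs z hz).symm i) j) k
  simp only [chr, christoffel, Matrix.of_apply]
  refine congrArg _ (Finset.sum_congr rfl fun s _ => ?_)
  rw [h s m n]; ring

/-- Lowering the index of `Γ` gives the Koszul bracket; adding its transpose leaves only `∂_m H`. -/
theorem pdM_eq_chr (hO : IsOpen O) (hs : ∀ z ∈ O, (H z).transpose = H z) (hx : x ∈ O)
    (hd : (H x).det ≠ 0) (m : Fin 4) :
    pdM m H x = H x * chr H m x + (chr H m x).transpose * H x := by
  have h : ∀ k i j, pd k (fun z => H z i j) x = pd k (fun z => H z j i) x := fun k i j =>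
    pd_congr hO hx (fun z hz => congrFun (congrFun (hs z hz).symm i) j) k
  have hc : H x * chr H m x = Matrix.of fun s n => (1 / 2) * (pd m (fun y => H y s n) x
      + pd n (fun y => H y s m) x - pd s (fun y => H y m n) x) := by
    have h1 : chr H m x = (H x)⁻¹ * Matrix.of fun s n => (1 / 2) * (pd m (fun y => H y s n) x
        + pd n (fun y => H y s m) x - pd s (fun y => H y m n) x) := by
      ext l n
      simp only [chr, christoffel, Matrix.of_apply, Matrix.mul_apply, Finset.mul_sum]
      exact Finset.sum_congr rfl fun s _ => by ring
    rw [h1, ← Matrix.mul_assoc, Matrix.mul_nonsing_inv _ (isUnit_iff_ne_zero.2 hd), Matrix.one_mul]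
  have hc' : (chr H m x).transpose * H x = (H x * chr H m x).transpose := by
    rw [Matrix.transpose_mul, hs x hx]
  rw [hc', hc]
  ext i j
  simp only [pdM_apply, Matrix.add_apply, Matrix.transpose_apply, Matrix.of_apply]
  rw [h m j i, h j m i, h i m j]
  ring

/-- The Jacobian matrix. -/
def jacobian (Z : Coord → Coord) (y : Coord) : Mat := Matrix.of fun k m => pd m (fun z => Z z k) y

/-- A pulled-back metric fits the frame formalism: the coframe is the Jacobian, the frame metric is
`H ∘ Z`, and the frame connection is the Christoffel symbols of `H` along `Z`. Both sides of the
torsion equation vanish. Invariance of curvature under `Z` then follows from `kretschmann_eq`. -/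
theorem isFrame_pullback (hU : IsOpen U) (hO : IsOpen O) (hZ : ContDiffOn ℝ ∞ Z U)
    (hm : Set.MapsTo Z U O) (hH : SmoothMat O H) (hs : ∀ z ∈ O, (H z).transpose = H z)
    (hd : ∀ z ∈ O, (H z).det ≠ 0) (hJ : ∀ y ∈ U, (jacobian Z y).det ≠ 0) {G : Coord → Mat}
    (hG : ∀ y ∈ U, G y = (jacobian Z y).transpose * H (Z y) * jacobian Z y) :
    IsFrame U G (jacobian Z) (fun y => H (Z y)) (fun k y => chr H k (Z y))
      (fun l k y => pdM l (chr H k) (Z y)) := by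
  have hc := smooth_chr_of_smooth hO hH hd
  have hZi : ∀ i, ContDiffOn ℝ ∞ (fun y => Z y i) U := contDiffOn_pi.1 hZ
  have hZd : ∀ y ∈ U, DifferentiableAt ℝ Z y := fun y hy =>
    (hZ.contDiffAt (hU.mem_nhds hy)).differentiableAt (by simp)
  have hchain : ∀ {A : Coord → Mat}, SmoothMat O A → ∀ y ∈ U, ∀ m,
      pdM m (fun z => A (Z z)) y = ∑ k, jacobian Z y k m • pdM k A (Z y) := by
    intro A hA y hy m
    ext i j
    simp only [Matrix.sum_apply, Matrix.smul_apply, smul_eq_mul, pdM_apply]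
    exact pd_comp (diffAt hO (hm hy) (hA i j)) (hZd y hy) m
  refine ⟨hU, fun i j => contDiffOn_pd hU (hZi i) j, fun i j => (hH i j).comp hZ hm,
    fun k i j => (hc k i j).comp hZ hm, hJ, fun y hy => hd _ (hm hy), fun y hy => hs _ (hm hy), hG,
    fun y hy m => ?_, fun y hy m n k => ?_, fun y hy m k => hchain (hc k) y hy m⟩
  · rw [hchain hH y hy m]
    exact Finset.sum_congr rfl fun k _ => by rw [pdM_eq_chr hO hs (hm hy) (hd _ (hm hy)) k]
  · have h1 : pd m (fun z => jacobian Z z k n) y - pd n (fun z => jacobian Z z k m) y = 0 :=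
      sub_eq_zero.2 (pd_comm hU hy (hZi k) m n)
    rw [h1]
    refine (Finset.sum_eq_zero fun p _ => Finset.sum_eq_zero fun q _ => ?_).symm
    rw [chr_symm_of_symm hO hs (hm hy) k q p, sub_self, mul_zero]

/-- The Kretschmann scalar, up to sign, of the metric with components `H`. -/
def kretschmannAt (H : Coord → Mat) (z : Coord) : ℝ :=
  kretschmann (H z) (frameCurv (fun k => chr H k z) fun l k => pdM l (chr H k) z)

theorem continuousOn_kretschmannAt (hO : IsOpen O) (hH : SmoothMat O H)
    (hd : ∀ z ∈ O, (H z).det ≠ 0) : ContinuousOn (kretschmannAt H) O := by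
  have hc := smooth_chr_of_smooth hO hH hd
  have hi := hH.inv hd
  have hf : ∀ a b, SmoothMat O fun z =>
      frameCurv (fun k => chr H k z) (fun l k => pdM l (chr H k) z) a b := fun a b =>
    ((((hc b).pdM hO a).sub ((hc a).pdM hO b)).add
      (((hc a).mul (hc b)).sub ((hc b).mul (hc a)))).add
    (SmoothMat.sum _ fun k _ => SmoothMat.smul ((hc b k a).sub (hc a k b)) (hc k))
  have h : ContDiffOn ℝ ∞ (fun z => kretschmannAt H z) O := by
    simp only [kretschmannAt, kretschmann, Matrix.trace, Matrix.diag_apply]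
    exact ContDiffOn.sum fun a _ => ContDiffOn.sum fun b _ => (hi a b).mul <|
      ContDiffOn.sum fun c _ => ContDiffOn.sum fun d _ => (hi c d).mul <|
        ContDiffOn.sum fun i _ => ((hf a c).mul (hf b d)) i i
  exact h.continuousOn

end Pullback

section General

variable {E : Type*} [NormedAddCommGroup E] [NormedSpace ℝ E] {H : Type*} [TopologicalSpace H]
  {I : ModelWithCorners ℝ E H} {X : Type*} [TopologicalSpace X] [ChartedSpace H X]
  {g : BilinField I X} {V : Set X}

theorem BilinField.LorentzianOn.symm (hg : g.LorentzianOn V) {p : X} (hp : p ∈ V)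
    (v w : TangentSpace I p) : g p v w = g p w v := by
  obtain ⟨b, hb⟩ := hg p hp
  have h : g p = (g p).flip := by
    refine b.ext fun i => b.ext fun j => ?_
    rw [LinearMap.flip_apply, hb, hb]
    by_cases hij : i = j
    · rw [hij]
    · rw [Matrix.diagonal_apply_ne _ hij, Matrix.diagonal_apply_ne _ (Ne.symm hij)]
  conv_lhs => rw [h]
  rfl

end General

section CoordSpace

variable {h : BilinField 𝓘(ℝ, Coord) Coord} {O : Set Coord}

theorem isCoordinates_id (hO : IsOpen O) : IsCoordinates 𝓘(ℝ, Coord) O O id :=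
  ⟨hO, fun _ hx => hx, contMDiffOn_id, fun x _ => by
    rw [mfderiv_id]; exact Function.bijective_id⟩

theorem BilinField.apply_eq_sum (z k l : Coord) :
    h z k l = ∑ m, ∑ n, k m * l n * h.comp id z m n := by
  have := BilinField.apply_mfderiv (g := h) (ψ := id) (x := z) k l
  rw [mfderiv_id] at this
  exact this

theorem comp_id_transpose (hh : h.LorentzianOn O) {z : Coord} (hz : z ∈ O) :
    (h.comp id z).transpose = h.comp id z := by
  ext m n
  exact hh.symm hz _ _

end CoordSpace

/-! ### Blow-up of the curvature at `Σ = 0` -/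

namespace Params

variable {P : Params}

/-- For `r < 0` and `M ≥ 0` the terms `2M/r³` and `-Q²/r⁴` are both nonpositive, so they cannot
cancel; this is why the singularity is approached from negative `r`. -/
theorem eventually_le_kretschmann (hM : 0 ≤ P.M) (hMQ : P.M ≠ 0 ∨ P.Q ≠ 0) (B : ℝ) :
    ∀ᶠ r in nhdsWithin (0 : ℝ) (Set.Iio 0),
      B ≤ 4 * (2 * P.M / r ^ 3 - P.Q ^ 2 / r ^ 4 + P.lam) ^ 2 := by
  have hm : 0 < 2 * P.M + P.Q ^ 2 := by
    rcases hMQ with h | h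
    · have := lt_of_le_of_ne hM (Ne.symm h)
      positivity
    · have : 0 < P.Q ^ 2 := by positivity
      linarith
  have hk : 0 < |P.lam| + |B| + 1 := by positivity
  have h1 : ∀ᶠ r in nhdsWithin (0 : ℝ) (Set.Iio 0), -1 < r :=
    nhdsWithin_le_nhds (lt_mem_nhds (by norm_num))
  -- With `s = -r < 1` one has `2M/s³ + Q²/s⁴ ≥ (2M + Q²)/s`. The bound on `r` makes this exceed
  -- `|λ| + |B| + 1`, so the bracket is at most `-(|B| + 1)`.
  have h2 : ∀ᶠ r in nhdsWithin (0 : ℝ) (Set.Iio 0),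
      -((2 * P.M + P.Q ^ 2) / (|P.lam| + |B| + 1)) < r :=
    nhdsWithin_le_nhds (lt_mem_nhds (neg_lt_zero.2 (div_pos hm hk)))
  filter_upwards [h1, h2, self_mem_nhdsWithin] with r hr1 hr2 hr0
  have hr0' : r < 0 := hr0
  obtain ⟨s, rfl⟩ : ∃ s, r = -s := ⟨-r, by ring⟩
  have hs0 : 0 < s := by linarith
  have hs1 : s < 1 := by linarith
  have hs2 : s * (|P.lam| + |B| + 1) < 2 * P.M + P.Q ^ 2 := by
    rw [← lt_div_iff₀ hk]; linarith
  have hs3 : |P.lam| + |B| + 1 < (2 * P.M + P.Q ^ 2) / s := by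
    rw [lt_div_iff₀ hs0]; linarith
  have e1 : 2 * P.M / (-s) ^ 3 = -(2 * P.M / s ^ 3) := by
    rw [show (-s) ^ 3 = -s ^ 3 by ring, div_neg]
  have e2 : P.Q ^ 2 / (-s) ^ 4 = P.Q ^ 2 / s ^ 4 := by rw [show (-s) ^ 4 = s ^ 4 by ring]
  have e3 : 2 * P.M / s ≤ 2 * P.M / s ^ 3 :=
    div_le_div_of_nonneg_left (by linarith) (by positivity)
      (pow_le_of_le_one hs0.le hs1.le (by norm_num))
  have e4 : P.Q ^ 2 / s ≤ P.Q ^ 2 / s ^ 4 :=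
    div_le_div_of_nonneg_left (sq_nonneg _) (by positivity)
      (pow_le_of_le_one hs0.le hs1.le (by norm_num))
  rw [e1, e2]
  have e5 : -(2 * P.M / s ^ 3) - P.Q ^ 2 / s ^ 4 + P.lam ≤ -(|B| + 1) := by
    have : (2 * P.M + P.Q ^ 2) / s = 2 * P.M / s + P.Q ^ 2 / s := add_div _ _ _
    linarith [le_abs_self P.lam]
  nlinarith [le_abs_self B, abs_nonneg B]

/-- The curvature invariant of the hypothetical metric is continuous at `Y p`, and `Y` is continuous
at `p`; the invariant of `g` near `p` would therefore stay close to one value. It is unbounded on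
lines `r ↑ 0` with `a cos θ = 0` ending at singular points arbitrarily near `p`. -/
theorem not_extendsThrough (hχ : 0 < P.chi) (hM : 0 ≤ P.M) (hMQ : P.M ≠ 0 ∨ P.Q ≠ 0)
    {p : Spacetime} (hp : p ∉ P.regularSet) :
    ¬ ExtendsThrough P.metricField P.regularSet p := by
  rintro ⟨W, O, Y, h, hW, hpW, hO, hYm, hYc, hYs, ⟨hhs, hhL⟩, hpull⟩
  have hid := isCoordinates_id hO
  have hH : SmoothMat O (h.comp id) := hhs O id hid
  have hHd : ∀ z ∈ O, (h.comp id z).det ≠ 0 := fun z hz =>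
    hhL.det_comp_ne_zero (ψ := id) hz (hid.2.2.2 z hz)
  have hHs : ∀ z ∈ O, (h.comp id z).transpose = h.comp id z := fun z hz =>
    comp_id_transpose hhL hz
  have hK := (continuousOn_kretschmannAt hO hH hHd).continuousAt (hO.mem_nhds (hYm hpW))
  have hKY : ContinuousAt (fun q => kretschmannAt (h.comp id) (Y q)) p :=
    ContinuousAt.comp (f := Y) hK hYc
  obtain ⟨N, hN, hNo, hpN⟩ := eventually_nhds_iff.1
    ((hKY.eventually (lt_mem_nhds (sub_one_lt _))).and (hW.mem_nhds hpW))
  obtain ⟨y, hs, hr, hac, hyN⟩ := exists_singular_offAxis hp hNo hpN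
  have hcont : Continuous fun r : ℝ => sphericalMap (Function.update y 1 r) :=
    contMDiff_sphericalMap.continuous.comp (continuous_const.update 1 continuous_id)
  have hev : ∀ᶠ r in nhdsWithin (0 : ℝ) (Set.Iio 0),
      sphericalMap (Function.update y 1 r) ∈ N :=
    nhdsWithin_le_nhds (hcont.continuousAt.preimage_mem_nhds (hNo.mem_nhds (by
      rwa [← hr, Function.update_eq_self])))
  -- On `N` the invariant exceeds its value at `Y p` minus one. The threshold is chosen so that the
  -- curvature bound at this `r` says the opposite.
  obtain ⟨r, ⟨hrN, hrB⟩, hr0⟩ := ((hev.and (eventually_le_kretschmann hM hMQ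
    (1 - kretschmannAt (h.comp id) (Y p)))).and self_mem_nhdsWithin).exists
  have hr0' : r ≠ 0 := ne_of_lt hr0
  set x := Function.update y 1 r with hx
  have hx1 : x 1 = r := by simp [hx]
  have hx2 : x 2 = y 2 := by simp [hx]
  have hxU : sphericalMap x ∈ P.regularSet := by
    rw [sphericalMap_apply]
    exact P.sigma_ne_zero (by rwa [hx1]) _
  have hψ := isCoordinates_sphericalMap (hW.inter (P.isOpen_regularSet))
  have hψU : IsCoordinates model P.regularSet _ sphericalMap :=
    ⟨hψ.1, fun z hz => (hψ.2.1 hz).2, hψ.2.2⟩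
  set Ω := {z | Real.sin (z 2) ≠ 0 ∧ sphericalMap z ∈ W ∩ P.regularSet} with hΩ
  have hxΩ : x ∈ Ω := ⟨by rwa [hx2], (hN _ hrN).2, hxU⟩
  let Z : Coord → Coord := fun z => Y (sphericalMap z)
  have hZm : ContMDiffOn 𝓘(ℝ, Coord) 𝓘(ℝ, Coord) ∞ Z Ω :=
    hYs.comp hψ.2.2.1 fun z hz => hz.2
  have hZ : ContDiffOn ℝ ∞ Z Ω := hZm.contDiffOn
  have hG : ∀ z ∈ Ω, P.metricField.comp sphericalMap z
      = (jacobian Z z).transpose * h.comp id (Z z) * jacobian Z z := by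
    intro z hz
    have hd1 := hψ.mdifferentiableAt hz
    have hd2 : MDifferentiableAt model 𝓘(ℝ, Coord) Y (sphericalMap z) :=
      (hYs.contMDiffAt ((hW.inter P.isOpen_regularSet).mem_nhds hz.2)).mdifferentiableAt (by simp)
    have hcv : ∀ m, mfderiv model 𝓘(ℝ, Coord) Y (sphericalMap z) (coordVec model sphericalMap z m)
        = fun k => jacobian Z z k m := by
      intro m
      have h1 := (hd2.hasMFDerivAt.comp z hd1.hasMFDerivAt).hasFDerivAt
      refine funext fun k : Fin 4 => ?_
      have h2 := (hasFDerivAt_pi'.1 h1 k).fderiv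
      simp only [jacobian, Matrix.of_apply, pd]
      have h2' : fderiv ℝ (fun y => Z y k) z = _ := h2
      rw [h2']; rfl
    ext m n
    rw [transpose_mul_mul_apply]
    refine (hpull _ hz.2 _ _).trans ?_
    rw [hcv, hcv]
    exact BilinField.apply_eq_sum _ _ _
  -- `Y` is not assumed to be a local diffeomorphism; its Jacobian is invertible because the
  -- pulled-back metric is nondegenerate.
  have hJ : ∀ z ∈ Ω, (jacobian Z z).det ≠ 0 := fun z hz h0 => by
    refine (lorentzianOn_metricField hχ).det_comp_ne_zero (ψ := sphericalMap) hz.2.2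
      (hψ.2.2.2 z hz) ?_
    rw [hG z hz, Matrix.det_mul, h0, mul_zero]
  have hF := isFrame_pullback hψ.1 hO hZ (fun z hz => hYm hz.2.1) hH hHs hHd hJ hG
  have hkr := hF.kretschmann_eq hxΩ
  have hσ := sigma_emb_ne hψU
  have hoff : x ∈ EmbCoord.offAxis Ω fun z => emb (sphericalMap z) := by
    refine ⟨hxΩ, ?_⟩
    change 1 - Real.cos (x 2) ^ 2 ≠ 0
    rw [← Real.sin_sq]
    exact pow_ne_zero 2 hxΩ.1
  have hle := (hψU.embCoord.kerrCoframe hχ hσ).kretschmann_le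
    (G := P.metricField.comp sphericalMap) (fun z hz => by
      rw [metricField_comp (hψ.mdifferentiableAt hz.1)]
      exact hψU.embCoord.metric_eq_frame hχ hσ hz) hoff
    (by change P.a * Real.cos (x 2) = 0; rwa [hx2])
  rw [hkr] at hle
  have hle' : kretschmannAt (h.comp id) (Y (sphericalMap x))
      ≤ -(4 * (2 * P.M / x 1 ^ 3 - P.Q ^ 2 / x 1 ^ 4 + P.lam) ^ 2) := hle
  rw [hx1] at hle'
  have := (hN _ hrN).1
  linarith

end Params
end
end KNdS

/-! ### The theorem -/

theorem theorem1p1 (P : KNdS.Params) (hM : 0 ≤ P.M) (hQ : 0 ≤ P.Q) (hJ : 0 ≤ P.J)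
    (hχ : 0 < P.chi) :
    (∃ T Φ : ℝ → ℝ, P.IsKerrPair T Φ) ∧
    ∃ (g F : KNdS.BilinField KNdS.model KNdS.Spacetime)
      (A : KNdS.CovectorField KNdS.model KNdS.Spacetime),
      -- extension of the metric, the potential (up to an exact term) and the field
      (∀ T Φ : ℝ → ℝ, P.IsKerrPair T Φ →
        P.IsExtension T Φ P.regularSet g ∧
        (∀ x ∈ P.blDomain,
          A.comp (KNdS.kerrMap T Φ) x
              = P.blPotential x + Pi.single 1 (P.Q * x 1 / P.deltaR (x 1)) ∧
          F.comp (KNdS.kerrMap T Φ) x = KNdS.extDer P.blPotential x) ∧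
        -- maximality: every extension inside `ℝ² × S²` is a restriction of this one
        ∀ (V : Set KNdS.Spacetime) (h : KNdS.BilinField KNdS.model KNdS.Spacetime),
          P.IsExtension T Φ V h → V ⊆ P.regularSet ∧ ∀ p ∈ V, h p = g p) ∧
      -- maximality: a change of coordinates does not help unless `M = Q = 0`
      ((P.M ≠ 0 ∨ P.Q ≠ 0) →
        ∀ p : KNdS.Spacetime, p ∉ P.regularSet → ¬ KNdS.ExtendsThrough g P.regularSet p) ∧
      -- the field equations on the whole of `U`
      A.SmoothOn P.regularSet ∧ KNdS.IsTwoFormOn F P.regularSet ∧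
      KNdS.IsExtDerOn F A P.regularSet ∧
      KNdS.VacuumMaxwellOn g F P.regularSet ∧
      KNdS.EinsteinMaxwellOn P.Λ g F P.regularSet := by
  refine ⟨P.exists_isKerrPair, P.metricField, P.emField, P.potentialField, fun T Φ hTΦ =>
    ⟨⟨P.isOpen_regularSet, ⟨P.smoothOn_metricField hχ, P.lorentzianOn_metricField hχ⟩,
      fun x hx => ⟨P.kerrMap_mem_regularSet hx, P.metricField_comp_kerrMap hχ hTΦ hx⟩⟩,
    fun x hx => ⟨P.potentialField_comp_kerrMap hχ hTΦ hx, P.emField_comp_kerrMap hχ hTΦ hx⟩,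
    fun V h hV => ?_⟩,
    fun hMQ p hp => P.not_extendsThrough hχ hM hMQ hp, P.smoothOn_potentialField,
    P.isTwoFormOn_emField, P.isExtDerOn_emField, P.vacuumMaxwellOn_emField hχ,
    P.einsteinMaxwellOn_metricField hχ⟩
  have hsub := P.subset_regularSet_of_extension hχ hTΦ hV
  exact ⟨hsub, fun p hp => P.eq_metricField_of_extension hχ hTΦ hV hp (hsub hp)⟩
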